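/- **Theorem 4.1.** Let $L,a>0$, let $\Omega_{L,a}=\mathbb T^2_L\times[0,a]$ (where $\mathbb T^2_L=(\mathbb R/L\mathbb Z)^2$), and let $\hbar,c,g>0$. Let $H_0(\mathrm{curl})$ be the closure, in the graph norm $(\|E\|_{L^2}^2+\|\nabla\times E\|_{L^2}^2)^{1/2}$, of the smooth laterally periodic fields $E:\Omega_{L,a}\to\mathbb C^3$ with $E_x=E_y=0$ at $z=0$ and $z=a$. Put $$\mathcal V=\{E\in H_0(\mathrm{curl}):\nabla\cdot E=0\ \text{in the sense of distributions on } \mathbb T^2_L\times(0,a)\},\qquad h_0=(L^2a)^{-1/2}e_z,$$ $$\mathcal H_{\mathrm{phys}}=\overline{\mathcal V}^{\,L^2}\ominus\operatorname{span}\{h_0\},\qquad \mathcal V_{\mathrm{phys}}=\mathcal V\cap\mathcal H_{\mathrm{phys}},$$ and let $\mathcal L_{\mathrm{Mx}}$ be the self-adjoint operator on $\mathcal H_{\mathrm{phys}}$ associated with the closed form $\int_{\Omega_{L,a}}(\nabla\times E)\cdot\overline{(\nabla\times F)}\,dx$, $E,F\in\mathcal V_{\mathrm{phys}}$. Let $\Xi$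 be complex (circular) cylindrical white noise on $\mathcal H_{\mathrm{phys}}$, i.e. a jointly Gaussian family of centered complex random variables $\langle h,\Xi\rangle$, $h\in\mathcal H_{\mathrm{phys}}$, with $\mathbb E[\langle h,\Xi\rangle\overline{\langle k,\Xi\rangle}]=\langle h,k\rangle$ and $\mathbb E[\langle h,\Xi\rangle\langle k,\Xi\rangle]=0$; the inner product is conjugate-linear in its first entry. Then, for every $\tau>0$: * $\mathcal L_{\mathrm{Mx}}$ has a bounded inverse, the operators $\mathcal L_{\mathrm{Mx}}^{3/4}e^{-\tau\mathcal L_{\mathrm{Mx}}/2}$ and $\mathcal L_{\mathrm{Mx}}^{1/2}e^{-\tau\mathcal L_{\mathrm{Mx}}}$ of the functional calculus are bounded, and there is an $\mathcal H_{\mathrm{phys}}$-valued random variable $$\Sigma_\tau=\Big(\frac{\hbar c}{g}\Big)^{1/2}\mathcal L_{\mathrm{Mx}}^{3/4}e^{-\tau\mathcal L_{\mathrm{Mx}}/2}\,\Xi ,$$ where $\Sigma=T\Xi$ means that $\langle h,\Sigma\rangle=\langle T^*h,\Xi\rangle$ almost surely, for each $h\in\mathcal H_{\mathrm{phys}}$;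 * the operator $\mathcal L_{\mathrm{Mx}}^{1/2}e^{-\tau\mathcal L_{\mathrm{Mx}}}$ is trace class, and for each such $\Sigma_\tau$ the quadratic energy $U_\tau=\tfrac12\langle\Sigma_\tau,g\mathcal L_{\mathrm{Mx}}^{-1}\Sigma_\tau\rangle$ is integrable with $$\mathbb E[U_\tau]=\frac{\hbar c}{2}\,\mathrm{Tr}\big(\mathcal L_{\mathrm{Mx}}^{1/2}e^{-\tau\mathcal L_{\mathrm{Mx}}}\big)<\infty .$$ -/

import Mathlib

open MeasureTheory ProbabilityTheory

noncomputable section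

/-! ### The slab and its vector fields -/

namespace Slab

open scoped ContDiff

/-- Points `x = (x₀, x₁, x₂)`; the plate coordinate is `z = x₂`. -/
abbrev Pt := Fin 3 → ℝ

/-- `ℂ³` with its Hermitian inner product (conjugate-linear in the first entry). -/
abbrev V3 := EuclideanSpace ℂ (Fin 3)

/-- A fundamental cell of the slab `𝕋²_L × [0,a]`, up to a null set. -/
def cell (L a : ℝ) : Set Pt := Set.univ.pi fun i => Set.Ioc 0 ((![L, L, a] : Fin 3 → ℝ) i)

/-- Lebesgue measure on the slab. -/
abbrev vol (L a : ℝ) : Measure Pt := volume.restrict (cell L a)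

/-- The Hilbert space `L²(𝕋²_L × [0,a]; ℂ³)`. -/
abbrev L2 (L a : ℝ) := Lp V3 2 (vol L a)

/-- Periodicity with period `L` in both lateral variables. -/
def LatPeriodic (L : ℝ) {β : Type} (F : Pt → β) : Prop :=
  ∀ x, F (x + Pi.single 0 L) = F x ∧ F (x + Pi.single 1 L) = F x

/-- The support lies in a compact part `ε ≤ z ≤ a - ε` of the open slab. -/
def PlateSupported (a : ℝ) {β : Type} [Zero β] (F : Pt → β) : Prop :=
  ∃ ε > 0, ∀ x, F x ≠ 0 → ε ≤ x 2 ∧ x 2 ≤ a - ε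

/-- Partial derivative in the `i`-th coordinate direction. -/
def pd (i : Fin 3) (f : Pt → ℂ) (x : Pt) : ℂ := fderiv ℝ f x (Pi.single i 1)

/-- Pointwise curl of a differentiable field. -/
def curl (F : Pt → V3) (x : Pt) : V3 :=
  !₂[pd 1 (fun y => F y 2) x - pd 2 (fun y => F y 1) x,
     pd 2 (fun y => F y 0) x - pd 0 (fun y => F y 2) x,
     pd 0 (fun y => F y 1) x - pd 1 (fun y => F y 0) x]

/-- Pointwise gradient of a differentiable function. -/
def grad (f : Pt → ℂ) (x : Pt) : V3 := !₂[pd 0 f x, pd 1 f x, pd 2 f x]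

/-- Smooth (up to the plates) lateral-periodic fields. -/
structure SmoothField (L : ℝ) (F : Pt → V3) : Prop where
  smooth : ContDiff ℝ ∞ F
  periodic : LatPeriodic L F

/-- Vector test fields: smooth, lateral-periodic, compactly supported in the open interval `(0,a)`
in the plate variable. -/
structure TestField (L a : ℝ) (F : Pt → V3) : Prop extends SmoothField L F where
  supported : PlateSupported a F

/-- Scalar test functions: smooth, lateral-periodic, compactly supported in the open interval
`(0,a)` in the plate variable. -/
structure TestFunction (L a : ℝ) (f : Pt → ℂ) : Prop where
  smooth : ContDiff ℝ ∞ f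
  periodic : LatPeriodic L f
  supported : PlateSupported a f

/-- Smooth lateral-periodic fields with vanishing tangential components on the plates. -/
structure SmoothPECField (L a : ℝ) (F : Pt → V3) : Prop extends SmoothField L F where
  tangential : ∀ x, x 2 = 0 ∨ x 2 = a → F x 0 = 0 ∧ F x 1 = 0

/-! #### Linearity facts -/

theorem pd_add (i : Fin 3) {f g : Pt → ℂ} (hf : ContDiff ℝ ∞ f) (hg : ContDiff ℝ ∞ g) (x : Pt) :
    pd i (fun y => f y + g y) x = pd i f x + pd i g x := by
  have h1 := hf.differentiable (by simp) x
  have h2 := hg.differentiable (by simp) x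
  unfold pd
  rw [fderiv_fun_add h1 h2]
  rfl

theorem pd_smul (i : Fin 3) (c : ℂ) {f : Pt → ℂ} (hf : ContDiff ℝ ∞ f) (x : Pt) :
    pd i (fun y => c * f y) x = c * pd i f x := by
  have h1 := hf.differentiable (by simp) x
  unfold pd
  rw [fderiv_const_mul h1]
  rfl

theorem comp_smooth {F : Pt → V3} (hF : ContDiff ℝ ∞ F) (i : Fin 3) :
    ContDiff ℝ ∞ (fun y => F y i) :=
  (contDiff_piLp 2).1 hF i

theorem curl_add {F G : Pt → V3} (hF : ContDiff ℝ ∞ F) (hG : ContDiff ℝ ∞ G) (x : Pt) :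
    curl (fun y => F y + G y) x = curl F x + curl G x := by
  have h (i j : Fin 3) := pd_add i (comp_smooth hF j) (comp_smooth hG j) x
  ext i
  fin_cases i <;> simp [curl, h] <;> ring

theorem curl_smul (c : ℂ) {F : Pt → V3} (hF : ContDiff ℝ ∞ F) (x : Pt) :
    curl (fun y => c • F y) x = c • curl F x := by
  have h (i j : Fin 3) := pd_smul i c (comp_smooth hF j) x
  ext i
  fin_cases i <;> simp [curl, h] <;> ring

theorem pd_continuous (i : Fin 3) {f : Pt → ℂ} (hf : ContDiff ℝ ∞ f) : Continuous (pd i f) :=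
  (hf.continuous_fderiv (by simp)).clm_apply continuous_const

theorem curl_continuous {F : Pt → V3} (hF : ContDiff ℝ ∞ F) : Continuous (curl F) := by
  have h (i j : Fin 3) := pd_continuous i (comp_smooth hF j)
  refine (PiLp.continuous_toLp 2 _).comp (continuous_pi fun i => ?_)
  fin_cases i <;> simp <;> exact (h _ _).sub (h _ _)

theorem grad_continuous {f : Pt → ℂ} (hf : ContDiff ℝ ∞ f) : Continuous (grad f) := by
  refine (PiLp.continuous_toLp 2 _).comp (continuous_pi fun i => ?_)
  fin_cases i <;> simp <;> exact pd_continuous _ hf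

theorem memLp_of_continuous (L a : ℝ) {F : Pt → V3} (hF : Continuous F) :
    MemLp F 2 (vol L a) := by
  have hc : IsCompact (Set.univ.pi fun i => Set.Icc 0 ((![L, L, a] : Fin 3 → ℝ) i) : Set Pt) :=
    isCompact_univ_pi fun _ => isCompact_Icc
  have hsub : cell L a ⊆ Set.univ.pi fun i => Set.Icc 0 ((![L, L, a] : Fin 3 → ℝ) i) :=
    Set.pi_mono fun _ _ => Set.Ioc_subset_Icc_self
  obtain ⟨M, hM⟩ := hc.exists_bound_of_continuousOn hF.continuousOn
  have : IsFiniteMeasure (vol L a) :=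
    ⟨by simpa using (measure_mono hsub).trans_lt hc.measure_lt_top⟩
  refine MemLp.of_bound hF.aestronglyMeasurable M ?_
  refine (ae_restrict_iff' (MeasurableSet.univ_pi fun _ => measurableSet_Ioc)).2 ?_
  exact Filter.Eventually.of_forall fun x hx => hM x (hsub hx)

theorem integrable_pair (L a : ℝ) {F : Pt → V3} (hF : Continuous F) (E : L2 L a) :
    Integrable (fun x => inner ℂ (F x) (E x)) (vol L a) := by
  have h := L2.integrable_inner (𝕜 := ℂ) ((memLp_of_continuous L a hF).toLp F) E
  refine h.congr ?_
  filter_upwards [(memLp_of_continuous L a hF).coeFn_toLp] with x hx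
  rw [hx]

theorem pair_add (L a : ℝ) {F : Pt → V3} (hF : Continuous F) (E G : L2 L a) :
    ∫ x, inner ℂ (F x) ((E + G : L2 L a) x) ∂vol L a =
      ∫ x, inner ℂ (F x) (E x) ∂vol L a + ∫ x, inner ℂ (F x) (G x) ∂vol L a := by
  rw [← integral_add (integrable_pair L a hF E) (integrable_pair L a hF G)]
  refine integral_congr_ae ?_
  filter_upwards [Lp.coeFn_add E G] with x hx
  rw [hx, Pi.add_apply, inner_add_right]

theorem pair_smul (L a : ℝ) (F : Pt → V3) (c : ℂ) (E : L2 L a) :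
    ∫ x, inner ℂ (F x) ((c • E : L2 L a) x) ∂vol L a =
      c * ∫ x, inner ℂ (F x) (E x) ∂vol L a := by
  rw [← integral_const_mul]
  refine integral_congr_ae ?_
  filter_upwards [Lp.coeFn_smul c E] with x hx
  rw [hx, Pi.smul_apply, inner_smul_right]

theorem pair_zero (L a : ℝ) (F : Pt → V3) :
    ∫ x, inner ℂ (F x) ((0 : L2 L a) x) ∂vol L a = 0 := by
  simpa using pair_smul L a F 0 0

/-! ### The perfect-conductor form domain -/

/-- The graph of the distributional curl in `L²`: the pairs `(E, C)` with `E, C ∈ L²` and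
`∇ × E = C` in the sense of distributions.  Its domain is `H(curl)`, and the graph norm of
`H(curl)` is the norm of `L² × L²`. -/
def weakCurlGraph (L a : ℝ) : Submodule ℂ (L2 L a × L2 L a) where
  carrier := {p | ∀ Φ, TestField L a Φ →
    ∫ x, inner ℂ (curl Φ x) (p.1 x) ∂vol L a = ∫ x, inner ℂ (Φ x) (p.2 x) ∂vol L a}
  zero_mem' := fun Φ _ => by
    rw [Prod.fst_zero, Prod.snd_zero, pair_zero, pair_zero]
  add_mem' := fun {p q} hp hq Φ hΦ => by
    rw [Prod.fst_add, Prod.snd_add, pair_add L a (curl_continuous hΦ.smooth),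
      pair_add L a hΦ.smooth.continuous, hp Φ hΦ, hq Φ hΦ]
  smul_mem' := fun c p hp Φ hΦ => by
    rw [Prod.smul_fst, Prod.smul_snd, pair_smul, pair_smul, hp Φ hΦ]

/-- The pairs `(F, ∇ × F)` of smooth lateral-periodic fields `F` with zero tangential components on
the plates. -/
def smoothPECGraph (L a : ℝ) : Submodule ℂ (L2 L a × L2 L a) where
  carrier := {p | ∃ F, SmoothPECField L a F ∧ p.1 =ᵐ[vol L a] F ∧ p.2 =ᵐ[vol L a] curl F}
  zero_mem' := by
    refine ⟨fun _ => 0, ⟨⟨contDiff_const, fun _ => ⟨rfl, rfl⟩⟩, fun _ _ => ⟨rfl, rfl⟩⟩,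
      Lp.coeFn_zero _ _ _, ?_⟩
    have h : curl (fun _ => 0) = 0 := by
      funext x
      ext i
      fin_cases i <;> simp [curl, pd]
    rw [h]
    exact Lp.coeFn_zero _ _ _
  add_mem' := by
    rintro p q ⟨F, hF, hF1, hF2⟩ ⟨G, hG, hG1, hG2⟩
    refine ⟨fun x => F x + G x, ⟨⟨hF.smooth.add hG.smooth, fun x => ?_⟩, fun x hx => ?_⟩, ?_, ?_⟩
    · simp only [(hF.periodic x).1, (hF.periodic x).2, (hG.periodic x).1, (hG.periodic x).2,
        and_self]
    · simp [hF.tangential x hx, hG.tangential x hx]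
    · filter_upwards [Lp.coeFn_add p.1 q.1, hF1, hG1] with x h h1 h2
      rw [Prod.fst_add, h, Pi.add_apply, h1, h2]
    · filter_upwards [Lp.coeFn_add p.2 q.2, hF2, hG2] with x h h1 h2
      rw [Prod.snd_add, h, Pi.add_apply, h1, h2, curl_add hF.smooth hG.smooth]
  smul_mem' := by
    rintro c p ⟨F, hF, hF1, hF2⟩
    refine ⟨fun x => c • F x, ⟨⟨hF.smooth.const_smul c, fun x => ?_⟩, fun x hx => ?_⟩, ?_, ?_⟩
    · simp only [(hF.periodic x).1, (hF.periodic x).2, and_self]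
    · simp [hF.tangential x hx]
    · filter_upwards [Lp.coeFn_smul c p.1, hF1] with x h h1
      rw [Prod.smul_fst, h, Pi.smul_apply, h1]
    · filter_upwards [Lp.coeFn_smul c p.2, hF2] with x h h1
      rw [Prod.smul_snd, h, Pi.smul_apply, h1, curl_smul c hF.smooth]

/-- The graph `{(E, ∇ × E) : E ∈ H₀(curl)}`: the `E ∈ H(curl)` that are limits, in the graph norm,
of smooth lateral-periodic fields with zero tangential components on the plates. -/
def hzcurlGraph (L a : ℝ) : Submodule ℂ (L2 L a × L2 L a) :=
  weakCurlGraph L a ⊓ (smoothPECGraph L a).topologicalClosure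

/-- The weak curl as an operator in `L²` with domain `H₀(curl)`. -/
def hzcurl (L a : ℝ) : L2 L a →ₗ.[ℂ] L2 L a := (hzcurlGraph L a).toLinearPMap

/-- The fields in `L²` with `∇ · E = 0` in the sense of distributions. -/
def divFree (L a : ℝ) : Submodule ℂ (L2 L a) where
  carrier := {E | ∀ φ, TestFunction L a φ → ∫ x, inner ℂ (grad φ x) (E x) ∂vol L a = 0}
  zero_mem' := fun φ _ => pair_zero L a _
  add_mem' := fun {E F} hE hF φ hφ => by
    rw [pair_add L a (grad_continuous hφ.smooth), hE φ hφ, hF φ hφ, add_zero]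
  smul_mem' := fun c E hE φ hφ => by
    rw [pair_smul, hE φ hφ, mul_zero]

/-- The unreduced perfect-conductor form domain `{E ∈ H₀(curl) : ∇ · E = 0}`. -/
def VPEC (L a : ℝ) : Submodule ℂ (L2 L a) := (hzcurl L a).domain ⊓ divFree L a

/-- The Maxwell form `∫ (∇ × E) · conj (∇ × F)`. -/
def qPEC (L a : ℝ) (E F : VPEC L a) : ℂ :=
  inner ℂ (hzcurl L a ⟨F, F.2.1⟩) (hzcurl L a ⟨E, E.2.1⟩)

/-- The unreduced Hilbert space: the `L²`-closure of the form domain. -/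
def HPEC (L a : ℝ) : Submodule ℂ (L2 L a) := (VPEC L a).topologicalClosure

/-- The normalized static normal mode `(L² a)^{-1/2} e_z`. -/
def hzero (L a : ℝ) : L2 L a :=
  (memLp_of_continuous L a (F := fun _ => !₂[0, 0, (((Real.sqrt (L ^ 2 * a))⁻¹ : ℝ) : ℂ)])
    continuous_const).toLp _

/-- The physical Hilbert space: the orthogonal complement of the static normal mode in `HPEC`. -/
def Hphys (L a : ℝ) : Submodule ℂ (L2 L a) := HPEC L a ⊓ (Submodule.span ℂ {hzero L a})ᗮ

instance (L a : ℝ) : CompleteSpace (Hphys L a) :=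
  (((VPEC L a).isClosed_topologicalClosure).inter
    (Submodule.isClosed_orthogonal _)).completeSpace_coe

/-- The graph of the operator associated with the Maxwell form restricted to
`Vphys = VPEC ∩ Hphys`: the pairs `(E, G)` with `E ∈ Vphys`, `G ∈ Hphys` and
`q[E, F] = ⟨G, F⟩` for all `F ∈ Vphys`. -/
def maxwellGraph (L a : ℝ) : Submodule ℂ (Hphys L a × Hphys L a) where
  carrier := {p | ∃ hE : (p.1 : L2 L a) ∈ VPEC L a, ∀ (F : Hphys L a)
    (hF : (F : L2 L a) ∈ VPEC L a), qPEC L a ⟨p.1, hE⟩ ⟨F, hF⟩ = inner ℂ F p.2}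
  zero_mem' := by
    refine ⟨(VPEC L a).zero_mem, fun F hF => ?_⟩
    have h : hzcurl L a ⟨0, (hzcurl L a).domain.zero_mem⟩ = 0 := (hzcurl L a).map_zero
    simp only [Prod.fst_zero, Prod.snd_zero, inner_zero_right, qPEC]
    exact (congrArg _ h).trans (inner_zero_right _)
  add_mem' := by
    rintro p q ⟨hE, hp⟩ ⟨hE', hq⟩
    refine ⟨(VPEC L a).add_mem hE hE', fun F hF => ?_⟩
    have h := (hzcurl L a).map_add ⟨(p.1 : L2 L a), hE.1⟩ ⟨(q.1 : L2 L a), hE'.1⟩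
    rw [Prod.snd_add, inner_add_right, ← hp F hF, ← hq F hF]
    exact (congrArg _ h).trans (inner_add_right _ _ _)
  smul_mem' := by
    rintro c p ⟨hE, hp⟩
    refine ⟨(VPEC L a).smul_mem c hE, fun F hF => ?_⟩
    have h := (hzcurl L a).map_smul c ⟨(p.1 : L2 L a), hE.1⟩
    rw [Prod.smul_snd, inner_smul_right, ← hp F hF]
    exact (congrArg _ h).trans (inner_smul_right _ _ _)

/-- The reduced perfect-conductor Maxwell operator: the (unbounded) operator on `Hphys` associated
with the Maxwell form. -/
def LMx (L a : ℝ) : Hphys L a →ₗ.[ℂ] Hphys L a := (maxwellGraph L a).toLinearPMap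

end Slab

/-! ### Operators in a Hilbert space -/

section Operators

variable {H : Type} [NormedAddCommGroup H] [InnerProductSpace ℂ H]

/-- `G` is the everywhere defined bounded inverse of the unbounded operator `A`. -/
def IsBoundedInverse (A : H →ₗ.[ℂ] H) (G : H →L[ℂ] H) : Prop :=
  ∀ x y, (x, y) ∈ A.graph ↔ x = G y

open Classical in
/-- The bounded inverse `A⁻¹` (zero if there is none). -/
def boundedInverse (A : H →ₗ.[ℂ] H) : H →L[ℂ] H :=
  if h : ∃ G, IsBoundedInverse A G then h.choose else 0

/-- `T = f(A)` in the functional calculus of the self-adjoint operator `A`: some unitary `U` turns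
`A` into the operator of multiplication by a real measurable function `φ` on some `L²(X, μ)`, with
its maximal domain `{v : φ v ∈ L²}`, and turns the bounded operator `T` into multiplication by
`f ∘ φ`.  (By the spectral theorem each self-adjoint `A` has such a representation, and `f(A)` does
not depend on its choice.) -/
def IsFunctionOf [CompleteSpace H] (A : H →ₗ.[ℂ] H) (f : ℝ → ℝ) (T : H →L[ℂ] H) : Prop :=
  ∃ (X : Type) (_ : MeasurableSpace X) (μ : Measure X) (φ : X → ℝ) (U : H ≃ₗᵢ[ℂ] Lp ℂ 2 μ),
    Measurable φ ∧
    (∀ x y : H, (x, y) ∈ A.graph ↔ U y =ᵐ[μ] fun s => (φ s : ℂ) * U x s) ∧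
    ∀ x : H, U (T x) =ᵐ[μ] fun s => (f (φ s) : ℂ) * U x s

open Classical in
/-- The bounded operator `f(A)` (zero if there is none). -/
def functionOf [CompleteSpace H] (A : H →ₗ.[ℂ] H) (f : ℝ → ℝ) : H →L[ℂ] H :=
  if h : ∃ T, IsFunctionOf A f T then h.choose else 0

/-- Trace class operators: the trace of `|T| = (T* T)^{1/2}` is finite, in every orthonormal
basis. -/
def IsTraceClass [CompleteSpace H] (T : H →L[ℂ] H) : Prop :=
  ∀ (ι : Type) (e : HilbertBasis ι ℂ H), Summable fun i => inner ℂ (e i) (CFC.abs T (e i))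

/-- The trace of a trace class operator, computed in some orthonormal basis. -/
def opTrace [CompleteSpace H] (T : H →L[ℂ] H) : ℂ :=
  ∑' i, inner ℂ ((exists_hilbertBasis ℂ H).choose_spec.choose i)
    (T ((exists_hilbertBasis ℂ H).choose_spec.choose i))

/-! ### White noise -/

variable {Ω : Type*} [MeasurableSpace Ω]

/-- Cylindrical white noise on the complex Hilbert space `H`, given by the random variables
`Ξ h = ⟨h, Ξ⟩`: they are jointly Gaussian, centered and circular, with
`E[⟨h, Ξ⟩ conj ⟨k, Ξ⟩] = ⟨h, k⟩`.  For an orthonormal basis `u`, the coordinates `ξ_j = Ξ (u_j)`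
satisfy `E[ξ_i conj ξ_j] = δ_{ij}` and `E[ξ_i ξ_j] = 0`. -/
structure IsCylindricalWhiteNoise (P : Measure Ω) (Ξ : H → Ω → ℂ) : Prop where
  gaussian : IsGaussianProcess Ξ P
  centered : ∀ h, ∫ ω, Ξ h ω ∂P = 0
  covariance : ∀ h k, ∫ ω, Ξ h ω * starRingEnd ℂ (Ξ k ω) ∂P = inner ℂ h k
  circular : ∀ h k, ∫ ω, Ξ h ω * Ξ k ω ∂P = 0

/-- The `H`-valued random variable `S` is `T Ξ`, that is, `⟨h, S⟩ = ⟨T* h, Ξ⟩` almost surely, for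
each `h`. -/
structure IsNoiseImage [CompleteSpace H] (P : Measure Ω) (Ξ : H → Ω → ℂ) (T : H →L[ℂ] H)
    (S : Ω → H) : Prop where
  measurable : AEStronglyMeasurable S P
  apply : ∀ h, ∀ᵐ ω ∂P, inner ℂ h (S ω) = Ξ (ContinuousLinearMap.adjoint T h) ω

end Operators

namespace Slab

/-- `(ħ c / g)^{1/2} A^{3/4} e^{-τ A / 2}` for the Maxwell operator `A`. -/
def sourceOp (L a hbar c g τ : ℝ) : Hphys L a →L[ℂ] Hphys L a :=
  ((Real.sqrt (hbar * c / g) : ℝ) : ℂ) •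
    functionOf (LMx L a) fun t => t ^ (3 / 4 : ℝ) * Real.exp (-τ * t / 2)

/-- `A^{1/2} e^{-τ A}` for the Maxwell operator `A`. -/
def heatOp (L a τ : ℝ) : Hphys L a →L[ℂ] Hphys L a :=
  functionOf (LMx L a) fun t => t ^ (1 / 2 : ℝ) * Real.exp (-τ * t)

/-- The quadratic energy `½ ⟨S, g A⁻¹ S⟩` for the Maxwell operator `A`. -/
def energy (L a g : ℝ) (S : Hphys L a) : ℂ :=
  (1 / 2 : ℂ) * inner ℂ S ((g : ℂ) • boundedInverse (LMx L a) S)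

end Slab

end

/-! Everything follows from one explicit diagonalization. Lateral plane waves with plate profiles
(sin, sin, cos) satisfy the conductor condition, and on divergence-free amplitudes curl curl
multiplies them by the squared wave number. Normalized, and without the static mode, they form a
Hilbert basis of the physical space (`Slab.transBasis`), in which the Maxwell operator is exactly
the maximal diagonal operator (`Slab.isDiagonalPMap_LMx`). Completeness rests on Stone–Weierstrass
(`Slab.exists_cosSpan_approx`) and on testing the weak divergence with cut-off waves
(`Slab.inner_gradDir_fourierVec`). The domain is identified by Green's formula, extended to H₀(curl)
by density (`Slab.inner_curl_eq_of_mem_hzcurlGraph`), and by closedness of the curl graph.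

The rest is abstract (`IsDiagonalPMap.integral_energy`). Let A be diagonal with eigenvalues λ_i
bounded below by a positive constant and with Σ exp(-tλ_i) finite for all t > 0. Bounded functions
of A are diagonal, whatever spectral representation defines them. The filter T = σ^{1/2} A^{3/4}
e^{-τA/2} has square-summable eigenvalues m_i, so Σ m_i Ξ(u_i) u_i converges in L²(P; H) and
realizes TΞ. Any realization S has coordinates Ξ(T u_i), of second moment m_i², and Tonelli gives
E⟨S, A⁻¹S⟩ = Σ λ_i⁻¹ m_i² = σ Σ λ_i^{1/2} e^{-τλ_i}, which is σ times the trace.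

The slab meets the two hypotheses by `Slab.le_transEig` (spectral gap) and
`Slab.summable_exp_neg_transEig` (a product of three Gaussian sums). With σ = ħc/g the energy factor
g/2 leaves ħc/2. -/

noncomputable section

/-! ### Diagonal operators: positivity, trace, inverse and functional calculus. -/

section DiagonalOperators

variable {H : Type} [NormedAddCommGroup H] [InnerProductSpace ℂ H]

theorem HasSum.of_forall_eq {ι M : Type*} [AddCommMonoid M] [TopologicalSpace M] {f g : ι → M}
    {a : M} (hg : HasSum g a) (h : ∀ i, f i = g i) : HasSum f a :=
  (funext h : f = g) ▸ hg

theorem inner_mul_inner_swap (x y : H) :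
    inner ℂ x y * inner ℂ y x = ((‖inner ℂ y x‖ ^ 2 : ℝ) : ℂ) := by
  rw [← inner_conj_symm, Complex.conj_mul']
  norm_cast

theorem HilbertBasis.ext_inner {ι : Type*} (u : HilbertBasis ι ℂ H) {x y : H}
    (h : ∀ i, inner ℂ (u i) x = inner ℂ (u i) y) : x = y := by
  apply u.repr.injective
  ext i
  rw [u.repr_apply_apply, u.repr_apply_apply, h]

/-- `T` is diagonal in the Hilbert basis `u`, with eigenvalues `m`. -/
def IsDiagonal {ι : Type*} (u : HilbertBasis ι ℂ H) (m : ι → ℝ) (T : H →L[ℂ] H) : Prop :=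
  ∀ x i, inner ℂ (u i) (T x) = m i * inner ℂ (u i) x

/-- Expand x in the basis and apply the bounded functional ⟨u_i, T ·⟩ term by term; orthonormality
leaves only the i-th term. -/
theorem isDiagonal_of_apply {ι : Type*} (u : HilbertBasis ι ℂ H) {m : ι → ℝ} {T : H →L[ℂ] H}
    (h : ∀ i, T (u i) = (m i : ℂ) • u i) : IsDiagonal u m T := by
  intro x i
  classical
  have h1 := ((u.hasSum_repr x).mapL T).mapL (innerSL ℂ (u i))
  refine h1.unique ?_
  have h2 := ((u.hasSum_repr x).mapL (innerSL ℂ (u i))).mul_left (m i : ℂ)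
  refine h2.of_forall_eq fun j => ?_
  by_cases hij : i = j
  · subst hij
    simp [h]
    ring
  · simp [h, orthonormal_iff_ite.1 u.orthonormal, hij]

theorem exists_isDiagonal [CompleteSpace H] {ι : Type*} (u : HilbertBasis ι ℂ H) (m : ι → ℝ)
    {C : ℝ} (hC : ∀ i, |m i| ≤ C) : ∃ T : H →L[ℂ] H, IsDiagonal u m T := by
  have hmem (f : lp (fun _ : ι => ℂ) 2) : Memℓp (fun i => (m i : ℂ) * f i) 2 := by
    have h := lp.memℓp f
    rw [memℓp_gen_iff (by simp)] at h ⊢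
    simp only [ENNReal.toReal_ofNat, Real.rpow_ofNat] at h ⊢
    refine Summable.of_nonneg_of_le (fun i => by positivity) (fun i => ?_) (h.mul_left (C ^ 2))
    rw [norm_mul, mul_pow, Complex.norm_real, Real.norm_eq_abs]
    gcongr
    exact hC i
  let M : lp (fun _ : ι => ℂ) 2 →ₗ[ℂ] lp (fun _ : ι => ℂ) 2 :=
    { toFun := fun f => ⟨_, hmem f⟩
      map_add' := fun f g => by
        ext i
        simp only [lp.coeFn_add, Pi.add_apply, mul_add]
      map_smul' := fun c f => by
        ext i
        simp
        ring }
  let T : H →ₗ[ℂ] H := u.repr.symm.toLinearEquiv.toLinearMap ∘ₗ M ∘ₗ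
    u.repr.toLinearEquiv.toLinearMap
  have hT (x : H) (i : ι) : inner ℂ (u i) (T x) = m i * inner ℂ (u i) x := by
    rw [← u.repr_apply_apply, ← u.repr_apply_apply]
    simp [T, M]
  have hsymm : T.IsSymmetric := by
    intro x y
    rw [← u.tsum_inner_mul_inner, ← u.tsum_inner_mul_inner]
    refine tsum_congr fun i => ?_
    rw [hT, ← inner_conj_symm, hT, map_mul, Complex.conj_ofReal, inner_conj_symm]
    ring
  -- Hellinger–Toeplitz: a symmetric operator defined on the whole complete space is bounded. The
  -- constant `C` served only to keep the products in ℓ².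
  exact ⟨⟨T, hsymm.continuous⟩, hT⟩

theorem IsDiagonal.apply_basis {ι : Type*} {u : HilbertBasis ι ℂ H} {m : ι → ℝ}
    {T : H →L[ℂ] H} (hT : IsDiagonal u m T) (i : ι) : T (u i) = (m i : ℂ) • u i := by
  classical
  refine u.ext_inner fun j => ?_
  rw [hT, inner_smul_right]
  by_cases hij : j = i
  · rw [hij]
  · simp [orthonormal_iff_ite.1 u.orthonormal, hij]

theorem IsDiagonal.adjoint [CompleteSpace H] {ι : Type*} {u : HilbertBasis ι ℂ H} {m : ι → ℝ}
    {T : H →L[ℂ] H} (hT : IsDiagonal u m T) : ContinuousLinearMap.adjoint T = T := by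
  ext x
  refine u.ext_inner fun i => ?_
  rw [ContinuousLinearMap.adjoint_inner_right, hT]
  rw [hT.apply_basis, inner_smul_left, Complex.conj_ofReal]

theorem IsDiagonal.hasSum_inner {ι : Type*} {u : HilbertBasis ι ℂ H} {m : ι → ℝ}
    {T : H →L[ℂ] H} (hT : IsDiagonal u m T) (x : H) :
    HasSum (fun i => m i * ‖inner ℂ (u i) x‖ ^ 2) (inner ℂ x (T x)).re := by
  have h := Complex.hasSum_re (u.hasSum_inner_mul_inner x (T x))
  refine h.of_forall_eq fun i => ?_
  rw [hT, mul_left_comm, inner_mul_inner_swap, ← Complex.ofReal_mul, Complex.ofReal_re]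

theorem IsDiagonal.isPositive [CompleteSpace H] {ι : Type*} {u : HilbertBasis ι ℂ H} {m : ι → ℝ}
    {T : H →L[ℂ] H} (hT : IsDiagonal u m T) (hm : ∀ i, 0 ≤ m i) : T.IsPositive := by
  rw [ContinuousLinearMap.isPositive_iff]
  refine ⟨(ContinuousLinearMap.isSelfAdjoint_iff'.2 hT.adjoint).isSymmetric, fun x => ?_⟩
  rw [← inner_conj_symm, Complex.nonneg_iff]
  constructor
  · exact (hT.hasSum_inner x).nonneg fun i => by have := hm i; positivity
  · have h := u.hasSum_inner_mul_inner x (T x)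
    have h2 := Complex.hasSum_im h
    rw [Complex.conj_im]
    have : (fun i => (inner ℂ x (u i) * inner ℂ (u i) (T x)).im) = fun _ => 0 := by
      funext i
      rw [hT, mul_left_comm, inner_mul_inner_swap, ← Complex.ofReal_mul, Complex.ofReal_im]
    rw [this] at h2
    simp [h2.unique hasSum_zero]

/-- The trace of a nonnegative diagonal operator, in an arbitrary basis. -/
theorem IsDiagonal.hasSum_trace [CompleteSpace H] {ι κ : Type*} {u : HilbertBasis ι ℂ H}
    {m : ι → ℝ} {T : H →L[ℂ] H} (hT : IsDiagonal u m T) (hm : ∀ i, 0 ≤ m i) (hs : Summable m)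
    (e : HilbertBasis κ ℂ H) :
    HasSum (fun k => inner ℂ (e k) (T (e k))) ((∑' i, m i : ℝ) : ℂ) := by
  -- In this nonnegative double family the sum over k is m_i by Parseval for `e`, and the sum over i
  -- is ⟨e_k, T e_k⟩. Interchanging the sums makes the trace independent of the basis.
  let g : ι × κ → ℝ := fun p => m p.1 * ‖inner ℂ (u p.1) (e p.2)‖ ^ 2
  have hrow (i : ι) : HasSum (fun k => g (i, k)) (m i) := by
    have h := (Complex.hasSum_re (e.hasSum_inner_mul_inner (u i) (u i))).mul_left (m i)
    rw [inner_self_eq_norm_sq_to_K, u.orthonormal.1 i] at h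
    have h' : m i * (((1 : ℝ) : ℂ) ^ 2).re = m i := by simp
    refine h' ▸ HasSum.of_forall_eq h fun k => ?_
    rw [mul_comm (inner ℂ (u i) (e k)), inner_mul_inner_swap, Complex.ofReal_re]
  have hg : Summable g := by
    rw [summable_prod_of_nonneg fun p => by have := hm p.1; dsimp only [g]; positivity]
    exact ⟨fun i => (hrow i).summable, by simpa only [(hrow _).tsum_eq] using hs⟩
  have hsum : HasSum g (∑' i, m i) :=
    (hg.hasSum.prod_fiberwise hrow).tsum_eq ▸ hg.hasSum
  have hcol := ((Equiv.prodComm κ ι).hasSum_iff.2 hsum).prod_fiberwise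
    fun k => hT.hasSum_inner (e k)
  have := (Complex.hasSum_ofReal).2 hcol
  convert this using 1
  funext k
  have h0 := ((hT.isPositive hm).inner_nonneg_right (e k))
  rw [Complex.nonneg_iff] at h0
  exact Complex.ext rfl (by simp [← h0.2])

/-- A positive operator is its own absolute value, so the sum to be controlled is the trace series
itself. -/
theorem IsDiagonal.isTraceClass [CompleteSpace H] {ι : Type*} {u : HilbertBasis ι ℂ H}
    {m : ι → ℝ} {T : H →L[ℂ] H} (hT : IsDiagonal u m T) (hm : ∀ i, 0 ≤ m i) (hs : Summable m) :
    IsTraceClass T := by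
  intro κ e
  rw [CFC.abs_of_nonneg T ((ContinuousLinearMap.nonneg_iff_isPositive T).2 (hT.isPositive hm))]
  exact (hT.hasSum_trace hm hs e).summable

theorem IsDiagonal.opTrace_eq [CompleteSpace H] {ι : Type*} {u : HilbertBasis ι ℂ H}
    {m : ι → ℝ} {T : H →L[ℂ] H} (hT : IsDiagonal u m T) (hm : ∀ i, 0 ≤ m i) (hs : Summable m) :
    opTrace T = ((∑' i, m i : ℝ) : ℂ) :=
  (hT.hasSum_trace hm hs _).tsum_eq

/-- `A` is the maximal diagonal operator with eigenvalues `lam` in the Hilbert basis `u`. -/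
def IsDiagonalPMap {ι : Type*} (u : HilbertBasis ι ℂ H) (lam : ι → ℝ) (A : H →ₗ.[ℂ] H) : Prop :=
  ∀ x y, (x, y) ∈ A.graph ↔ ∀ i, inner ℂ (u i) y = lam i * inner ℂ (u i) x

theorem IsDiagonalPMap.isBoundedInverse {ι : Type*} {u : HilbertBasis ι ℂ H} {lam : ι → ℝ}
    {A : H →ₗ.[ℂ] H} (hA : IsDiagonalPMap u lam A) (h0 : ∀ i, lam i ≠ 0) {G : H →L[ℂ] H}
    (hG : IsDiagonal u (fun i => (lam i)⁻¹) G) : IsBoundedInverse A G := by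
  intro x y
  have h0' (i : ι) : (lam i : ℂ) ≠ 0 := by exact_mod_cast h0 i
  rw [hA]
  constructor
  · refine fun h => u.ext_inner fun i => ?_
    rw [hG, h i]
    push_cast
    rw [inv_mul_cancel_left₀ (h0' i)]
  · rintro rfl i
    rw [hG]
    push_cast
    rw [mul_inv_cancel_left₀ (h0' i)]

theorem IsBoundedInverse.eq {A : H →ₗ.[ℂ] H} {G G' : H →L[ℂ] H} (h : IsBoundedInverse A G)
    (h' : IsBoundedInverse A G') : G = G' := by
  ext y
  exact (h' _ _).1 ((h _ _).2 rfl)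

theorem isBoundedInverse_boundedInverse {A : H →ₗ.[ℂ] H} {G : H →L[ℂ] H}
    (h : IsBoundedInverse A G) : IsBoundedInverse A (boundedInverse A) := by
  have h' : ∃ G, IsBoundedInverse A G := ⟨G, h⟩
  rw [boundedInverse, dif_pos h']
  exact h'.choose_spec

/-- A Hilbert basis identifies the space with `L²` of the counting measure on the index set. -/
theorem exists_linearIsometryEquiv_count [CompleteSpace H] {ι : Type} (u : HilbertBasis ι ℂ H) :
    letI : MeasurableSpace ι := ⊤
    ∃ U : H ≃ₗᵢ[ℂ] Lp ℂ 2 (Measure.count : Measure ι), ∀ x i, U x i = inner ℂ (u i) x := by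
  let _ : MeasurableSpace ι := ⊤
  have hms (i : ι) : MeasurableSet ({i} : Set ι) := trivial
  have hfin (i : ι) : (Measure.count : Measure ι) {i} ≠ ⊤ := by simp
  let v : ι → Lp ℂ 2 (Measure.count : Measure ι) := fun i =>
    indicatorConstLp 2 (hms i) (hfin i) (1 : ℂ)
  have hv (i : ι) (f : Lp ℂ 2 (Measure.count : Measure ι)) : inner ℂ (v i) f = f i := by
    rw [L2.inner_indicatorConstLp_one]
    simp
  have hvv (i j : ι) : v j i = Set.indicator {j} (fun _ => (1 : ℂ)) i := by
    have := indicatorConstLp_coeFn (p := 2) (hs := hms j) (hμs := hfin j) (c := (1 : ℂ))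
    exact Measure.ae_count_iff.1 this i
  classical
  have hon : Orthonormal ℂ v := by
    rw [orthonormal_iff_ite]
    intro i j
    rw [hv, hvv, Set.indicator_apply]
    simp
  have htot : (Submodule.span ℂ (Set.range v))ᗮ = ⊥ := by
    rw [Submodule.eq_bot_iff]
    intro f hf
    apply Lp.ext
    refine Measure.ae_count_iff.2 fun i => ?_
    rw [← hv, (Submodule.mem_orthogonal _ _).1 hf _ (Submodule.subset_span ⟨i, rfl⟩),
      Measure.ae_count_iff.1 (Lp.coeFn_zero ℂ 2 (Measure.count : Measure ι)) i]
    rfl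
  let b := HilbertBasis.mkOfOrthogonalEqBot hon htot
  have hb (i : ι) : b i = v i := by
    rw [HilbertBasis.coe_mkOfOrthogonalEqBot]
  refine ⟨u.repr.trans b.repr.symm, fun x i => ?_⟩
  rw [← hv, ← hb, ← b.repr_apply_apply]
  simp [u.repr_apply_apply]

/-- Coordinates in the basis are themselves a spectral representation, with counting measure on `ι`
and φ = `lam`. -/
theorem IsDiagonalPMap.isFunctionOf [CompleteSpace H] {ι : Type} {u : HilbertBasis ι ℂ H}
    {lam : ι → ℝ} {A : H →ₗ.[ℂ] H} (hA : IsDiagonalPMap u lam A) {f : ℝ → ℝ} {T : H →L[ℂ] H}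
    (hT : IsDiagonal u (fun i => f (lam i)) T) : IsFunctionOf A f T := by
  let _ : MeasurableSpace ι := ⊤
  obtain ⟨U, hU⟩ := exists_linearIsometryEquiv_count u
  refine ⟨ι, ⊤, Measure.count, lam, U, measurable_from_top, fun x y => ?_, fun x => ?_⟩
  · rw [hA, Filter.EventuallyEq, Measure.ae_count_iff]
    simp only [hU]
  · rw [Filter.EventuallyEq, Measure.ae_count_iff]
    intro i
    rw [hU, hU, hT]

/-- This makes the choice in `functionOf` harmless: every representation yields the same operator.
In any of them the eigenvector u_i becomes a function w with φ w = λ_i w, so φ = λ_i wherever w ≠ 0,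
and multiplication by f ∘ φ acts on w as f(λ_i). -/
theorem IsDiagonalPMap.isDiagonal_of_isFunctionOf [CompleteSpace H] {ι : Type}
    {u : HilbertBasis ι ℂ H} {lam : ι → ℝ} {A : H →ₗ.[ℂ] H} (hA : IsDiagonalPMap u lam A)
    {f : ℝ → ℝ} {T : H →L[ℂ] H} (hT : IsFunctionOf A f T) :
    IsDiagonal u (fun i => f (lam i)) T := by
  obtain ⟨X, _, μ, φ, U, -, hgraph, hfun⟩ := hT
  refine isDiagonal_of_apply u fun i => U.injective (Lp.ext ?_)
  have h1 : (u i, (lam i : ℂ) • u i) ∈ A.graph := by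
    classical
    refine (hA _ _).2 fun j => ?_
    rw [inner_smul_right]
    by_cases hij : j = i
    · rw [hij]
    · simp [orthonormal_iff_ite.1 u.orthonormal, hij]
  have h2 := (hgraph _ _).1 h1
  rw [map_smul] at h2 ⊢
  filter_upwards [h2, hfun (u i), Lp.coeFn_smul (lam i : ℂ) (U (u i)),
    Lp.coeFn_smul (f (lam i) : ℂ) (U (u i))] with s e1 e2 e3 e4
  rw [e2, e4]
  rw [e3] at e1
  simp only [Pi.smul_apply, smul_eq_mul] at e1 ⊢
  by_cases h0 : U (u i) s = 0
  · simp [h0]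
  · have := mul_right_cancel₀ h0 e1
    rw [Complex.ofReal_inj.1 this]

theorem IsDiagonalPMap.functionOf [CompleteSpace H] {ι : Type} {u : HilbertBasis ι ℂ H}
    {lam : ι → ℝ} {A : H →ₗ.[ℂ] H} (hA : IsDiagonalPMap u lam A) {f : ℝ → ℝ} {C : ℝ}
    (hC : ∀ i, |f (lam i)| ≤ C) :
    IsFunctionOf A f (functionOf A f) ∧ IsDiagonal u (fun i => f (lam i)) (functionOf A f) := by
  obtain ⟨T, hT⟩ := exists_isDiagonal u (fun i => f (lam i)) hC
  have h : ∃ T, IsFunctionOf A f T := ⟨T, hA.isFunctionOf hT⟩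
  have h' : IsFunctionOf A f (_root_.functionOf A f) := by
    rw [_root_.functionOf, dif_pos h]
    exact h.choose_spec
  exact ⟨h', hA.isDiagonal_of_isFunctionOf h'⟩

end DiagonalOperators

/-! ### White noise: its L² isometry, its Hilbert–Schmidt images and their energy. -/

section WhiteNoise

variable {H : Type} [NormedAddCommGroup H] [InnerProductSpace ℂ H]
  {Ω : Type*} [MeasurableSpace Ω] {P : Measure Ω} {Ξ : H → Ω → ℂ}

theorem IsCylindricalWhiteNoise.memLp (hΞ : IsCylindricalWhiteNoise P Ξ) (h : H) :
    MemLp (Ξ h) 2 P :=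
  (hΞ.gaussian.hasGaussianLaw_eval h).memLp_two

/-- White noise as a map into `L²` of the probability space. -/
def IsCylindricalWhiteNoise.toLp (hΞ : IsCylindricalWhiteNoise P Ξ) (h : H) : Lp ℂ 2 P :=
  (hΞ.memLp h).toLp (Ξ h)

theorem IsCylindricalWhiteNoise.coeFn_toLp (hΞ : IsCylindricalWhiteNoise P Ξ) (h : H) :
    hΞ.toLp h =ᵐ[P] Ξ h :=
  (hΞ.memLp h).coeFn_toLp

/-- The arguments change places because ⟨h, Ξ⟩ is conjugate-linear in h. -/
theorem IsCylindricalWhiteNoise.inner_toLp (hΞ : IsCylindricalWhiteNoise P Ξ) (h k : H) :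
    inner ℂ (hΞ.toLp h) (hΞ.toLp k) = inner ℂ k h := by
  rw [L2.inner_def, ← hΞ.covariance]
  refine integral_congr_ae ?_
  filter_upwards [hΞ.coeFn_toLp h, hΞ.coeFn_toLp k] with ω h1 h2
  rw [h1, h2, RCLike.inner_apply]

/-- Linearity of the noise is not part of its definition; the covariance forces it. The inner
products of `W` and Ξ(y) with each other and with themselves all equal ⟨y, y⟩, so their difference
has norm zero. -/
theorem IsCylindricalWhiteNoise.eq_toLp_of_hasSum (hΞ : IsCylindricalWhiteNoise P Ξ)
    {ι : Type*} (u : HilbertBasis ι ℂ H) {y : H} {W : Lp ℂ 2 P}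
    (hW : HasSum (fun i => (inner ℂ y (u i) : ℂ) • hΞ.toLp (u i)) W) : W = hΞ.toLp y := by
  have hpair (z : H) : inner ℂ (hΞ.toLp z) W = inner ℂ y z := by
    refine (hW.mapL (innerSL ℂ (hΞ.toLp z))).unique ?_
    refine (u.hasSum_inner_mul_inner y z).of_forall_eq fun i => ?_
    rw [innerSL_apply_apply, inner_smul_right, hΞ.inner_toLp]
  have hWW : inner ℂ W W = inner ℂ y y := by
    refine (hW.mapL (innerSL ℂ W)).unique ?_
    refine (u.hasSum_inner_mul_inner y y).of_forall_eq fun i => ?_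
    rw [innerSL_apply_apply, inner_smul_right, ← inner_conj_symm W, hpair, inner_conj_symm]
  rw [← sub_eq_zero, ← inner_self_eq_zero (𝕜 := ℂ), inner_sub_left, inner_sub_right,
    inner_sub_right, ← inner_conj_symm W (hΞ.toLp y), hpair, hWW, hΞ.inner_toLp, inner_conj_symm]
  ring

/-- A diagonal Hilbert–Schmidt operator turns white noise into a random vector. -/
theorem IsCylindricalWhiteNoise.exists_isNoiseImage [CompleteSpace H]
    (hΞ : IsCylindricalWhiteNoise P Ξ) {ι : Type*} {u : HilbertBasis ι ℂ H} {m : ι → ℝ}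
    {T : H →L[ℂ] H} (hT : IsDiagonal u m T) (hm : Summable fun i => m i ^ 2) :
    ∃ S, IsNoiseImage P Ξ T S := by
  classical
  -- The vectors Ξ(u_i) u_i are orthonormal in L²(P; H), so Σ m_i Ξ(u_i) u_i converges there
  -- precisely because Σ m_i² is finite.
  let v : ι → Lp H 2 P := fun i =>
    (ContinuousLinearMap.toSpanSingleton ℂ (u i)).compLpL 2 P (hΞ.toLp (u i))
  have hv (i : ι) : v i =ᵐ[P] fun ω => hΞ.toLp (u i) ω • u i :=
    (ContinuousLinearMap.toSpanSingleton ℂ (u i)).coeFn_compLpL (hΞ.toLp (u i))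
  have hon : Orthonormal ℂ v := by
    rw [orthonormal_iff_ite]
    intro i j
    have h1 : inner ℂ (v i) (v j) =
        ∫ ω, inner ℂ (hΞ.toLp (u i) ω) (hΞ.toLp (u j) ω) * inner ℂ (u i) (u j) ∂P := by
      rw [L2.inner_def]
      refine integral_congr_ae ?_
      filter_upwards [hv i, hv j] with ω h1 h2
      rw [h1, h2, inner_smul_left, inner_smul_right, RCLike.inner_apply]
      ring
    rw [h1, integral_mul_const, ← L2.inner_def, hΞ.inner_toLp,
      orthonormal_iff_ite.1 u.orthonormal, orthonormal_iff_ite.1 u.orthonormal]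
    by_cases hij : i = j
    · simp [hij]
    · simp [hij]
  have hsum : Summable fun i => (m i : ℂ) • v i :=
    (hon.orthogonalFamily.summable_iff_norm_sq_summable fun i => (m i : ℂ)).2
      (by simpa using hm)
  obtain ⟨S, hS⟩ := hsum
  refine ⟨S, Lp.aestronglyMeasurable S, fun h => ?_⟩
  -- The series of ⟨h, S⟩ has coefficients m_i⟨h, u_i⟩ = ⟨Th, u_i⟩, which are those of Ξ(Th).
  have key : (innerSL ℂ h).compLpL 2 P S = hΞ.toLp (T h) := by
    refine hΞ.eq_toLp_of_hasSum u ?_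
    refine (hS.mapL ((innerSL ℂ h).compLpL 2 P)).of_forall_eq fun i => ?_
    rw [map_smul]
    have h1 : (innerSL ℂ h).compLpL 2 P (v i) = (inner ℂ h (u i) : ℂ) • hΞ.toLp (u i) := by
      apply Lp.ext
      filter_upwards [(innerSL ℂ h).coeFn_compLpL (p := 2) (v i), hv i,
        Lp.coeFn_smul (inner ℂ h (u i) : ℂ) (hΞ.toLp (u i))] with ω e1 e2 e3
      rw [e1, e2, e3, innerSL_apply_apply, inner_smul_right, Pi.smul_apply, smul_eq_mul, mul_comm]
    rw [h1, smul_smul, ← inner_conj_symm, hT, map_mul, Complex.conj_ofReal, inner_conj_symm]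
  rw [hT.adjoint]
  have e := (innerSL ℂ h).coeFn_compLpL (p := 2) S
  rw [key] at e
  filter_upwards [e, hΞ.coeFn_toLp (T h)] with ω e1 e2
  rw [← e2, e1, innerSL_apply_apply]

theorem IsCylindricalWhiteNoise.lintegral_norm_sq (hΞ : IsCylindricalWhiteNoise P Ξ) (h : H) :
    ∫⁻ ω, ENNReal.ofReal (‖Ξ h ω‖ ^ 2) ∂P = ENNReal.ofReal (‖h‖ ^ 2) := by
  rw [← ofReal_integral_eq_lintegral_ofReal
    ((memLp_two_iff_integrable_sq_norm (hΞ.memLp h).1).1 (hΞ.memLp h))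
    (Filter.Eventually.of_forall fun ω => by positivity)]
  congr 1
  have h1 := hΞ.covariance h h
  rw [inner_self_eq_norm_sq_to_K] at h1
  simp only [Complex.mul_conj'] at h1
  have h2 : ∫ ω, ((‖Ξ h ω‖ ^ 2 : ℝ) : ℂ) ∂P = ((‖h‖ ^ 2 : ℝ) : ℂ) := by
    push_cast
    exact h1
  rw [integral_complex_ofReal] at h2
  exact_mod_cast h2

/-- The expected quadratic energy of a noise image. -/
theorem IsNoiseImage.integral_inner [CompleteSpace H]
    (hΞ : IsCylindricalWhiteNoise P Ξ) {ι : Type*} [Countable ι] {u : HilbertBasis ι ℂ H}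
    {m κ : ι → ℝ} {T G : H →L[ℂ] H} (hT : IsDiagonal u m T) (hG : IsDiagonal u κ G)
    (hκ : ∀ i, 0 ≤ κ i) (hs : Summable fun i => κ i * m i ^ 2) {S : Ω → H}
    (hS : IsNoiseImage P Ξ T S) :
    Integrable (fun ω => inner ℂ (S ω) (G (S ω))) P ∧
      ∫ ω, inner ℂ (S ω) (G (S ω)) ∂P = ((∑' i, κ i * m i ^ 2 : ℝ) : ℂ) := by
  have hre (ω : Ω) : inner ℂ (S ω) (G (S ω)) = ((inner ℂ (S ω) (G (S ω))).re : ℂ) := by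
    have h0 := (hG.isPositive hκ).inner_nonneg_right (S ω)
    rw [Complex.nonneg_iff] at h0
    exact Complex.ext rfl (by simp [← h0.2])
  have hnn (ω : Ω) : 0 ≤ (inner ℂ (S ω) (G (S ω))).re :=
    (Complex.nonneg_iff.1 ((hG.isPositive hκ).inner_nonneg_right (S ω))).1
  have hmeas : AEStronglyMeasurable (fun ω => (inner ℂ (S ω) (G (S ω))).re) P :=
    Complex.continuous_re.comp_aestronglyMeasurable
      (hS.measurable.inner (G.continuous.comp_aestronglyMeasurable hS.measurable))
  have hpt : ∀ᵐ ω ∂P, ENNReal.ofReal (inner ℂ (S ω) (G (S ω))).re =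
      ∑' i, ENNReal.ofReal (κ i) * ENNReal.ofReal (‖Ξ (T (u i)) ω‖ ^ 2) := by
    -- The exceptional null set depends on i; countability of `ι` merges them into one.
    have h1 : ∀ᵐ ω ∂P, ∀ i, inner ℂ (u i) (S ω) = Ξ (T (u i)) ω := by
      rw [ae_all_iff]
      intro i
      have := hS.apply (u i)
      rwa [hT.adjoint] at this
    filter_upwards [h1] with ω h2
    have h3 := hG.hasSum_inner (S ω)
    simp only [h2] at h3
    rw [← h3.tsum_eq, ENNReal.ofReal_tsum_of_nonneg
      (fun i => by have := hκ i; positivity) h3.summable]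
    exact tsum_congr fun i => ENNReal.ofReal_mul (hκ i)
  -- Tonelli in [0, ∞] needs no prior integrability; each term contributes κ_i ‖T u_i‖² = κ_i m_i².
  -- Finiteness of this value then proves integrability.
  have hint : ∫⁻ ω, ENNReal.ofReal (inner ℂ (S ω) (G (S ω))).re ∂P =
      ENNReal.ofReal (∑' i, κ i * m i ^ 2) := by
    rw [lintegral_congr_ae hpt, lintegral_tsum]
    · rw [ENNReal.ofReal_tsum_of_nonneg (fun i => by have := hκ i; positivity) hs]
      refine tsum_congr fun i => ?_
      rw [lintegral_const_mul' _ _ ENNReal.ofReal_ne_top, hΞ.lintegral_norm_sq, hT.apply_basis,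
        norm_smul, u.orthonormal.1 i, ← ENNReal.ofReal_mul (hκ i)]
      simp
    · intro i
      exact (((hΞ.memLp (T (u i))).aestronglyMeasurable.norm.aemeasurable.pow_const
        2).ennreal_ofReal).const_mul _
  constructor
  · have h1 : Integrable (fun ω => (inner ℂ (S ω) (G (S ω))).re) P := by
      refine ⟨hmeas, ?_⟩
      rw [hasFiniteIntegral_iff_ofReal (Filter.Eventually.of_forall hnn), hint]
      exact ENNReal.ofReal_lt_top
    exact h1.ofReal.congr (Filter.Eventually.of_forall fun ω => (hre ω).symm)
  · rw [integral_congr_ae (Filter.Eventually.of_forall hre), integral_complex_ofReal,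
      integral_eq_lintegral_of_nonneg_ae (Filter.Eventually.of_forall hnn) hmeas, hint,
      ENNReal.toReal_ofReal (tsum_nonneg fun i => by have := hκ i; positivity)]

end WhiteNoise

namespace Slab

open scoped ContDiff

/-! ### Integration by parts on the slab -/

/-- Side lengths of the cell. -/
def side (L a : ℝ) : Pt := ![L, L, a]

theorem cell_ae_eq_Icc (L a : ℝ) : cell L a =ᵐ[volume] Set.Icc (0 : Pt) (side L a) :=
  Measure.univ_pi_Ioc_ae_eq_Icc (f := (0 : Pt)) (g := side L a)

theorem cell_subset_Icc (L a : ℝ) : cell L a ⊆ Set.Icc (0 : Pt) (side L a) := by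
  intro x hx
  exact ⟨fun i => (hx i trivial).1.le, fun i => (hx i trivial).2⟩

theorem measurableSet_cell (L a : ℝ) : MeasurableSet (cell L a) :=
  MeasurableSet.univ_pi fun _ => measurableSet_Ioc

instance (L a : ℝ) : IsFiniteMeasure (vol L a) :=
  ⟨by simpa using (measure_mono (cell_subset_Icc L a)).trans_lt isCompact_Icc.measure_lt_top⟩

theorem integrable_of_continuous (L a : ℝ) {E : Type*} [NormedAddCommGroup E] {f : Pt → E}
    (hf : Continuous f) : Integrable f (vol L a) :=
  (hf.continuousOn.integrableOn_compact isCompact_Icc).mono_set (cell_subset_Icc L a)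

/-- Divergence theorem for the field f e_i: only the two faces orthogonal to e_i contribute, and f
takes the same values on them. -/
theorem integral_pd_eq_zero {L a : ℝ} (hL : 0 ≤ L) (ha : 0 ≤ a) (i : Fin 3) {f : Pt → ℂ}
    (hf : ContDiff ℝ ∞ f) (hb : ∀ x, x i = 0 → f (x + Pi.single i (side L a i)) = f x) :
    ∫ x, pd i f x ∂vol L a = 0 := by
  rw [setIntegral_congr_set (cell_ae_eq_Icc L a)]
  have hle : (0 : Pt) ≤ side L a := by
    intro j
    fin_cases j <;> simpa [side]
  have key := integral_divergence_of_hasFDerivAt_off_countable' (0 : Pt) (side L a) hle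
    (fun j x => if j = i then f x else 0) (fun j x => if j = i then fderiv ℝ f x else 0) ∅
    Set.countable_empty (fun j => ?_) (fun x _ j => ?_) ?_
  · have h1 (x : Pt) : ∑ j : Fin 3, (if j = i then fderiv ℝ f x else 0) (Pi.single j 1) =
        pd i f x := by
      rw [Finset.sum_eq_single i]
      · simp [pd]
      · intro j _ hj
        simp [hj]
      · simp
    simp only [h1] at key
    rw [key]
    refine Finset.sum_eq_zero fun j _ => ?_
    by_cases hj : j = i
    · subst hj
      simp only [if_true]
      rw [sub_eq_zero]
      refine integral_congr_ae (Filter.Eventually.of_forall fun y => ?_)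
      have := hb (j.insertNth 0 y) (by simp)
      change f _ = f (j.insertNth 0 y)
      rw [← this]
      congr 1
      ext m
      refine Fin.succAboveCases j ?_ (fun m => ?_) m
      · simp
      · simp
    · simp [hj]
  · by_cases hj : j = i
    · simpa [hj] using hf.continuous.continuousOn
    · simpa [hj] using continuousOn_const
  · by_cases hj : j = i
    · simpa [hj] using (hf.differentiable (by simp) x).hasFDerivAt
    · simpa [hj] using hasFDerivAt_const (0 : ℂ) x
  · refine ContinuousOn.integrableOn_compact isCompact_Icc ?_
    refine (continuous_finsetSum _ fun j _ => ?_).continuousOn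
    by_cases hj : j = i
    · simpa [hj] using (hf.continuous_fderiv (by simp)).clm_apply continuous_const
    · simpa [hj] using continuous_const

theorem pd_conj_mul (i : Fin 3) {f g : Pt → ℂ} (hf : ContDiff ℝ ∞ f) (hg : ContDiff ℝ ∞ g)
    (x : Pt) : pd i (fun y => starRingEnd ℂ (f y) * g y) x =
      starRingEnd ℂ (pd i f x) * g x + starRingEnd ℂ (f x) * pd i g x := by
  have h1 := (hf.differentiable (by simp) x).hasFDerivAt
  have h2 := (hg.differentiable (by simp) x).hasFDerivAt
  have h3 := (Complex.conjCLE.toContinuousLinearMap.hasFDerivAt.comp x h1).mul h2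
  have h4 : HasFDerivAt (fun y => starRingEnd ℂ (f y) * g y) _ x := h3
  rw [pd, h4.fderiv]
  simp [pd]
  ring

theorem conj_mul_smooth {f g : Pt → ℂ} (hf : ContDiff ℝ ∞ f) (hg : ContDiff ℝ ∞ g) :
    ContDiff ℝ ∞ fun y => starRingEnd ℂ (f y) * g y :=
  (Complex.conjCLE.toContinuousLinearMap.contDiff.comp hf).mul hg

theorem integral_conj_mul_pd {L a : ℝ} (hL : 0 ≤ L) (ha : 0 ≤ a) (i : Fin 3) {f g : Pt → ℂ}
    (hf : ContDiff ℝ ∞ f) (hg : ContDiff ℝ ∞ g)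
    (hb : ∀ x, x i = 0 → starRingEnd ℂ (f (x + Pi.single i (side L a i))) *
      g (x + Pi.single i (side L a i)) = starRingEnd ℂ (f x) * g x) :
    ∫ x, starRingEnd ℂ (pd i f x) * g x ∂vol L a =
      -∫ x, starRingEnd ℂ (f x) * pd i g x ∂vol L a := by
  have h := integral_pd_eq_zero hL ha i (conj_mul_smooth hf hg) hb
  simp only [pd_conj_mul i hf hg] at h
  rw [integral_add] at h
  · exact eq_neg_of_add_eq_zero_left h
  · exact integrable_of_continuous L a
      ((Complex.continuous_conj.comp (pd_continuous i hf)).mul hg.continuous)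
  · exact integrable_of_continuous L a
      ((Complex.continuous_conj.comp hf.continuous).mul (pd_continuous i hg))

theorem V3.inner_eq (v w : V3) : inner ℂ v w =
    starRingEnd ℂ (v 0) * w 0 + starRingEnd ℂ (v 1) * w 1 + starRingEnd ℂ (v 2) * w 2 := by
  rw [PiLp.inner_apply, Fin.sum_univ_three]
  simp only [RCLike.inner_apply]
  ring

theorem add_single_two (x : Pt) (a : ℝ) (hx : x 2 = 0) :
    (x + (Pi.single 2 a : Pt)) 2 = a := by
  simp [hx]

theorem integral_add_add {μ : Measure Pt} {f g h : Pt → ℂ} (hf : Integrable f μ)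
    (hg : Integrable g μ) (hh : Integrable h μ) :
    ∫ x, f x + g x + h x ∂μ = ∫ x, f x ∂μ + ∫ x, g x ∂μ + ∫ x, h x ∂μ := by
  rw [← integral_add hf hg]
  exact integral_add (hf.add hg) hh

theorem integral_sub_add_sub {μ : Measure Pt} {f f' g g' h h' : Pt → ℂ} (hf : Integrable f μ)
    (hf' : Integrable f' μ) (hg : Integrable g μ) (hg' : Integrable g' μ) (hh : Integrable h μ)
    (hh' : Integrable h' μ) :
    ∫ x, (f x - f' x) + (g x - g' x) + (h x - h' x) ∂μ =
      (∫ x, f x ∂μ - ∫ x, f' x ∂μ) + (∫ x, g x ∂μ - ∫ x, g' x ∂μ) +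
        (∫ x, h x ∂μ - ∫ x, h' x ∂μ) := by
  rw [← integral_sub hf hf', ← integral_sub hg hg', ← integral_sub hh hh']
  exact integral_add_add (hf.sub hf') (hg.sub hg') (hh.sub hh')

/-- Green's formula for the curl. -/
theorem integral_inner_curl {L a : ℝ} (hL : 0 ≤ L) (ha : 0 ≤ a) {F Ψ : Pt → V3}
    (hF : SmoothPECField L a F) (hΨ : SmoothField L Ψ) :
    ∫ x, inner ℂ (curl Ψ x) (F x) ∂vol L a = ∫ x, inner ℂ (Ψ x) (curl F x) ∂vol L a := by
  have sF (i : Fin 3) := comp_smooth hF.smooth i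
  have sΨ (i : Fin 3) := comp_smooth hΨ.smooth i
  have p0 (i j : Fin 3) := integral_conj_mul_pd hL ha 0 (sΨ i) (sF j) fun x _ => by
    simp only [side, Matrix.cons_val_zero, (hF.periodic x).1, (hΨ.periodic x).1]
  have p1 (i j : Fin 3) := integral_conj_mul_pd hL ha 1 (sΨ i) (sF j) fun x _ => by
    simp only [side, Matrix.cons_val_one, Matrix.cons_val_zero, (hF.periodic x).2, (hΨ.periodic x).2]
  -- After integration by parts, z-derivatives meet only the tangential components of `F`, which
  -- vanish on the plates. Hence `Ψ` needs no boundary condition there, which later permits taking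
  -- it to be the curl of a mode.
  have p2 (i j : Fin 3) (hj : j = 0 ∨ j = 1) :=
    integral_conj_mul_pd hL ha 2 (sΨ i) (sF j) fun x hx => by
      have h0 := hF.tangential x (Or.inl hx)
      have h1 := hF.tangential (x + Pi.single 2 (side L a 2))
        (Or.inr (add_single_two x _ hx))
      rcases hj with rfl | rfl
      · rw [h0.1, h1.1, mul_zero, mul_zero]
      · rw [h0.2, h1.2, mul_zero, mul_zero]
  have i1 (m i j : Fin 3) : Integrable (fun x => starRingEnd ℂ (pd m (fun y => Ψ y i) x) * F x j)
      (vol L a) := integrable_of_continuous L a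
    ((Complex.continuous_conj.comp (pd_continuous m (sΨ i))).mul (sF j).continuous)
  have i2 (m i j : Fin 3) : Integrable (fun x => starRingEnd ℂ (Ψ x i) * pd m (fun y => F y j) x)
      (vol L a) := integrable_of_continuous L a
    ((Complex.continuous_conj.comp (sΨ i).continuous).mul (pd_continuous m (sF j)))
  have e1 (x : Pt) : inner ℂ (curl Ψ x) (F x) =
      ((starRingEnd ℂ (pd 1 (fun y => Ψ y 2) x) * F x 0 -
        starRingEnd ℂ (pd 2 (fun y => Ψ y 1) x) * F x 0) +
      (starRingEnd ℂ (pd 2 (fun y => Ψ y 0) x) * F x 1 -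
        starRingEnd ℂ (pd 0 (fun y => Ψ y 2) x) * F x 1)) +
      (starRingEnd ℂ (pd 0 (fun y => Ψ y 1) x) * F x 2 -
        starRingEnd ℂ (pd 1 (fun y => Ψ y 0) x) * F x 2) := by
    rw [V3.inner_eq]
    simp only [curl, PiLp.toLp_apply, Matrix.cons_val, map_sub]
    ring
  have e2 (x : Pt) : inner ℂ (Ψ x) (curl F x) =
      ((starRingEnd ℂ (Ψ x 0) * pd 1 (fun y => F y 2) x -
        starRingEnd ℂ (Ψ x 0) * pd 2 (fun y => F y 1) x) +
      (starRingEnd ℂ (Ψ x 1) * pd 2 (fun y => F y 0) x -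
        starRingEnd ℂ (Ψ x 1) * pd 0 (fun y => F y 2) x)) +
      (starRingEnd ℂ (Ψ x 2) * pd 0 (fun y => F y 1) x -
        starRingEnd ℂ (Ψ x 2) * pd 1 (fun y => F y 0) x) := by
    rw [V3.inner_eq]
    simp only [curl, PiLp.toLp_apply, Matrix.cons_val]
    ring
  simp only [e1, e2]
  refine (integral_sub_add_sub (i1 1 2 0) (i1 2 1 0) (i1 2 0 1) (i1 0 2 1) (i1 0 1 2)
    (i1 1 0 2)).trans (Eq.trans ?_ (integral_sub_add_sub (i2 1 0 2) (i2 2 0 1) (i2 2 1 0)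
    (i2 0 1 2) (i2 0 2 1) (i2 1 2 0)).symm)
  rw [p1, p1, p0, p0, p2 _ 0 (Or.inl rfl), p2 _ 1 (Or.inr rfl)]
  ring

/-- Integration by parts of a test gradient against a smooth field. -/
theorem integral_inner_grad {L a : ℝ} (hL : 0 ≤ L) (ha : 0 ≤ a) {F : Pt → V3} {φ : Pt → ℂ}
    (hF : SmoothField L F) (hφ : TestFunction L a φ) :
    ∫ x, inner ℂ (grad φ x) (F x) ∂vol L a =
      -∫ x, starRingEnd ℂ (φ x) * (pd 0 (fun y => F y 0) x + pd 1 (fun y => F y 1) x +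
        pd 2 (fun y => F y 2) x) ∂vol L a := by
  have sF (i : Fin 3) := comp_smooth hF.smooth i
  have hz (x : Pt) (hx : x 2 = 0 ∨ x 2 = a) : φ x = 0 := by
    obtain ⟨ε, hε, h⟩ := hφ.supported
    by_contra h0
    have := h x h0
    rcases hx with hx | hx <;> linarith
  have i1 (i : Fin 3) : Integrable (fun x => starRingEnd ℂ (pd i φ x) * F x i) (vol L a) :=
    integrable_of_continuous L a
      ((Complex.continuous_conj.comp (pd_continuous i hφ.smooth)).mul (sF i).continuous)
  have i2 (i : Fin 3) : Integrable (fun x => starRingEnd ℂ (φ x) * pd i (fun y => F y i) x)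
      (vol L a) := integrable_of_continuous L a
    ((Complex.continuous_conj.comp hφ.smooth.continuous).mul (pd_continuous i (sF i)))
  have p0 := integral_conj_mul_pd hL ha 0 hφ.smooth (sF 0) fun x _ => by
    simp only [side, Matrix.cons_val_zero, (hF.periodic x).1, (hφ.periodic x).1]
  have p1 := integral_conj_mul_pd hL ha 1 hφ.smooth (sF 1) fun x _ => by
    simp only [side, Matrix.cons_val_one, Matrix.cons_val_zero, (hF.periodic x).2, (hφ.periodic x).2]
  have p2 := integral_conj_mul_pd hL ha 2 hφ.smooth (sF 2) fun x hx => by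
    have h1 : φ (x + Pi.single 2 (side L a 2)) = 0 := hz _ (Or.inr (add_single_two x _ hx))
    rw [hz x (Or.inl hx)]
    refine (congrArg (fun c => starRingEnd ℂ c * _) h1).trans ?_
    simp
  simp only [V3.inner_eq, mul_add]
  simp only [grad, PiLp.toLp_apply, Matrix.cons_val]
  refine (integral_add_add (i1 0) (i1 1) (i1 2)).trans
    (Eq.trans ?_ (congrArg Neg.neg (integral_add_add (i2 0) (i2 1) (i2 2)).symm))
  rw [p0, p1, p2]
  ring

/-! ### Plane waves with a plate profile -/

/-- The lateral wave number `2 π p / L`. -/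
def latNum (L : ℝ) (p : ℤ) : ℝ := 2 * Real.pi * p / L

/-- The plate wave number `π n / a`. -/
def plateNum (a : ℝ) (n : ℤ) : ℝ := Real.pi * n / a

/-- The lateral plane wave with indices `p, q` times a profile in the plate variable. -/
def wave (L : ℝ) (p q : ℤ) (χ : ℝ → ℂ) (x : Pt) : ℂ :=
  Complex.exp (Complex.I * (latNum L p * x 0 + latNum L q * x 1)) * χ (x 2)

/-- The profile `cos (π n z / a)`. -/
def cosProf (a : ℝ) (n : ℤ) (z : ℝ) : ℂ := Complex.cos (plateNum a n * z)

/-- The profile `sin (π n z / a)`. -/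
def sinProf (a : ℝ) (n : ℤ) (z : ℝ) : ℂ := Complex.sin (plateNum a n * z)

theorem hasDerivAt_cosProf (a : ℝ) (n : ℤ) (z : ℝ) :
    HasDerivAt (cosProf a n) (-(plateNum a n : ℂ) * sinProf a n z) z := by
  have h : HasDerivAt (fun w : ℂ => Complex.cos (plateNum a n * w))
      (-Complex.sin (plateNum a n * z) * (plateNum a n * 1)) (z : ℂ) :=
    ((hasDerivAt_id (z : ℂ)).const_mul (plateNum a n : ℂ)).ccos
  refine h.comp_ofReal.congr_deriv ?_
  rw [sinProf]
  ring

theorem hasDerivAt_sinProf (a : ℝ) (n : ℤ) (z : ℝ) :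
    HasDerivAt (sinProf a n) ((plateNum a n : ℂ) * cosProf a n z) z := by
  have h : HasDerivAt (fun w : ℂ => Complex.sin (plateNum a n * w))
      (Complex.cos (plateNum a n * z) * (plateNum a n * 1)) (z : ℂ) :=
    ((hasDerivAt_id (z : ℂ)).const_mul (plateNum a n : ℂ)).csin
  refine h.comp_ofReal.congr_deriv ?_
  rw [cosProf]
  ring

theorem contDiff_cosProf (a : ℝ) (n : ℤ) : ContDiff ℝ ∞ (cosProf a n) :=
  (Complex.contDiff_cos.restrict_scalars ℝ).comp (contDiff_const.mul Complex.ofRealCLM.contDiff)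

theorem contDiff_sinProf (a : ℝ) (n : ℤ) : ContDiff ℝ ∞ (sinProf a n) :=
  (Complex.contDiff_sin.restrict_scalars ℝ).comp (contDiff_const.mul Complex.ofRealCLM.contDiff)

theorem contDiff_wave (L : ℝ) (p q : ℤ) {χ : ℝ → ℂ} (hχ : ContDiff ℝ ∞ χ) :
    ContDiff ℝ ∞ (wave L p q χ) := by
  have h (i : Fin 3) : ContDiff ℝ ∞ fun x : Pt => (x i : ℂ) :=
    Complex.ofRealCLM.contDiff.comp (contDiff_apply ℝ ℝ i)
  exact (contDiff_const.mul ((contDiff_const.mul (h 0)).add (contDiff_const.mul (h 1)))).cexp.mul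
    (hχ.comp (contDiff_apply ℝ ℝ 2))

theorem hasFDerivAt_wave (L : ℝ) (p q : ℤ) {χ : ℝ → ℂ} {d : ℂ} {x : Pt}
    (hχ : HasDerivAt χ d (x 2)) :
    ∃ D : Pt →L[ℝ] ℂ, HasFDerivAt (wave L p q χ) D x ∧ ∀ i, D (Pi.single i 1) =
      (![Complex.I * latNum L p * wave L p q χ x, Complex.I * latNum L q * wave L p q χ x,
        wave L p q (fun _ => d) x] : Fin 3 → ℂ) i := by
  have h (i : Fin 3) : HasFDerivAt (fun x : Pt => (x i : ℂ))
      (Complex.ofRealCLM ∘L ContinuousLinearMap.proj i) x :=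
    (Complex.ofRealCLM ∘L ContinuousLinearMap.proj i : Pt →L[ℝ] ℂ).hasFDerivAt
  have h1 := ((((h 0).const_mul (latNum L p : ℂ)).add ((h 1).const_mul
    (latNum L q : ℂ))).const_mul Complex.I).cexp
  have h2 := hχ.hasFDerivAt.comp x
    (ContinuousLinearMap.proj (R := ℝ) (φ := fun _ : Fin 3 => ℝ) 2).hasFDerivAt
  refine ⟨_, h1.mul h2, fun i => ?_⟩
  fin_cases i <;> simp [wave] <;> ring

theorem pd_zero_wave (L : ℝ) (p q : ℤ) {χ : ℝ → ℂ} (hχ : ContDiff ℝ ∞ χ) (x : Pt) :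
    pd 0 (wave L p q χ) x = Complex.I * latNum L p * wave L p q χ x := by
  obtain ⟨D, hD, h⟩ := hasFDerivAt_wave L p q (hχ.differentiable (by simp) (x 2)).hasDerivAt
  rw [pd, hD.fderiv, h]
  rfl

theorem pd_one_wave (L : ℝ) (p q : ℤ) {χ : ℝ → ℂ} (hχ : ContDiff ℝ ∞ χ) (x : Pt) :
    pd 1 (wave L p q χ) x = Complex.I * latNum L q * wave L p q χ x := by
  obtain ⟨D, hD, h⟩ := hasFDerivAt_wave L p q (hχ.differentiable (by simp) (x 2)).hasDerivAt
  rw [pd, hD.fderiv, h]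
  rfl

theorem pd_two_wave (L : ℝ) (p q : ℤ) {χ : ℝ → ℂ} {d : ℂ} {x : Pt}
    (hχ : HasDerivAt χ d (x 2)) : pd 2 (wave L p q χ) x = wave L p q (fun _ => d) x := by
  obtain ⟨D, hD, h⟩ := hasFDerivAt_wave L p q hχ
  rw [pd, hD.fderiv, h]
  rfl

theorem exp_latNum_add {L : ℝ} (hL : L ≠ 0) (p : ℤ) (t : ℂ) :
    Complex.exp (Complex.I * (latNum L p * L) + t) = Complex.exp t := by
  have h : Complex.I * (latNum L p * L) + t = t + p * (2 * Real.pi * Complex.I) := by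
    have : (L : ℂ) ≠ 0 := by exact_mod_cast hL
    simp only [latNum]
    push_cast
    field_simp
    ring
  rw [h, Complex.exp_add, Complex.exp_int_mul_two_pi_mul_I, mul_one]

theorem wave_periodic {L : ℝ} (hL : L ≠ 0) (p q : ℤ) (χ : ℝ → ℂ) :
    LatPeriodic L (wave L p q χ) := by
  intro x
  constructor
  · have h : Complex.I * (latNum L p * ((x 0 + L : ℝ) : ℂ) + latNum L q * x 1) =
        Complex.I * (latNum L p * L) + Complex.I * (latNum L p * x 0 + latNum L q * x 1) := by
      push_cast
      ring
    simp only [wave, Pi.add_apply, Pi.single_eq_same, ne_eq, Fin.reduceEq, not_false_eq_true,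
      Pi.single_eq_of_ne, add_zero, one_ne_zero]
    rw [h, exp_latNum_add hL]
  · have h : Complex.I * (latNum L p * x 0 + latNum L q * ((x 1 + L : ℝ) : ℂ)) =
        Complex.I * (latNum L q * L) + Complex.I * (latNum L p * x 0 + latNum L q * x 1) := by
      push_cast
      ring
    simp only [wave, Pi.add_apply, Pi.single_eq_same, ne_eq, Fin.reduceEq, not_false_eq_true,
      Pi.single_eq_of_ne, add_zero, zero_ne_one]
    rw [h, exp_latNum_add hL]

theorem wave_mul (L : ℝ) (p q p' q' : ℤ) (χ χ' : ℝ → ℂ) (x : Pt) :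
    wave L p q χ x * wave L p' q' χ' x = wave L (p + p') (q + q') (fun z => χ z * χ' z) x := by
  simp only [wave]
  rw [mul_mul_mul_comm, ← Complex.exp_add]
  congr 2
  simp only [latNum]
  push_cast
  ring

theorem conj_wave (L : ℝ) (p q : ℤ) (χ : ℝ → ℂ) (x : Pt) :
    starRingEnd ℂ (wave L p q χ x) = wave L (-p) (-q) (fun z => starRingEnd ℂ (χ z)) x := by
  simp only [wave, map_mul, ← Complex.exp_conj, Complex.conj_I, map_add, Complex.conj_ofReal]
  congr 2
  simp only [latNum]
  push_cast
  ring

theorem conj_cosProf (a : ℝ) (n : ℤ) (z : ℝ) : starRingEnd ℂ (cosProf a n z) = cosProf a n z := by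
  rw [cosProf, ← Complex.cos_conj, map_mul, Complex.conj_ofReal, Complex.conj_ofReal]

theorem conj_sinProf (a : ℝ) (n : ℤ) (z : ℝ) : starRingEnd ℂ (sinProf a n z) = sinProf a n z := by
  rw [sinProf, ← Complex.sin_conj, map_mul, Complex.conj_ofReal, Complex.conj_ofReal]

theorem plateNum_add (a : ℝ) (m n : ℤ) : plateNum a (m + n) = plateNum a m + plateNum a n := by
  simp only [plateNum]
  push_cast
  ring

theorem plateNum_sub (a : ℝ) (m n : ℤ) : plateNum a (m - n) = plateNum a m - plateNum a n := by
  simp only [plateNum]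
  push_cast
  ring

theorem cosProf_mul_cosProf (a : ℝ) (m n : ℤ) (z : ℝ) : cosProf a m z * cosProf a n z =
    (1 / 2) * cosProf a (m + n) z + (1 / 2) * cosProf a (m - n) z := by
  simp only [cosProf, plateNum_add, plateNum_sub, Complex.ofReal_add, Complex.ofReal_sub, add_mul,
    sub_mul, Complex.cos_add, Complex.cos_sub]
  ring

theorem sinProf_mul_sinProf (a : ℝ) (m n : ℤ) (z : ℝ) : sinProf a m z * sinProf a n z =
    (1 / 2) * cosProf a (m - n) z - (1 / 2) * cosProf a (m + n) z := by
  simp only [cosProf, sinProf, plateNum_add, plateNum_sub, Complex.ofReal_add, Complex.ofReal_sub,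
    add_mul, sub_mul, Complex.cos_add, Complex.cos_sub]
  ring

theorem sinProf_mul_cosProf (a : ℝ) (m n : ℤ) (z : ℝ) : sinProf a m z * cosProf a n z =
    (1 / 2) * sinProf a (m + n) z + (1 / 2) * sinProf a (m - n) z := by
  simp only [cosProf, sinProf, plateNum_add, plateNum_sub, Complex.ofReal_add, Complex.ofReal_sub,
    add_mul, sub_mul, Complex.sin_add, Complex.sin_sub]
  ring

/-! ### Completeness of the trigonometric systems -/

theorem ae_mem_Ioo (L a : ℝ) : ∀ᵐ x ∂vol L a, ∀ i, x i ∈ Set.Ioo 0 (side L a i) := by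
  have h : cell L a =ᵐ[volume] Set.univ.pi fun i => Set.Ioo ((0 : Pt) i) (side L a i) :=
    (cell_ae_eq_Icc L a).trans (Measure.univ_pi_Ioo_ae_eq_Icc (f := (0 : Pt))).symm
  rw [vol, Measure.restrict_congr_set h]
  filter_upwards [ae_restrict_mem (MeasurableSet.univ_pi fun _ => measurableSet_Ioo)] with x hx i
  exact hx i trivial

/-- Trigonometric polynomials with cosine profiles. -/
def cosSpan (L a : ℝ) : Submodule ℂ (Pt → ℂ) :=
  Submodule.span ℂ (Set.range fun k : ℤ × ℤ × ℤ => wave L k.1 k.2.1 (cosProf a k.2.2))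

theorem wave_mem_cosSpan (L a : ℝ) (p q n : ℤ) : wave L p q (cosProf a n) ∈ cosSpan L a :=
  Submodule.subset_span ⟨(p, q, n), rfl⟩

/-- By the product-to-sum formula the cosine system spans an algebra. Sine profiles would not, hence
their separate treatment later. -/
theorem mul_mem_cosSpan {L a : ℝ} {s t : Pt → ℂ} (hs : s ∈ cosSpan L a) (ht : t ∈ cosSpan L a) :
    s * t ∈ cosSpan L a := by
  have h := Submodule.mul_mem_mul hs ht
  rw [cosSpan, Submodule.span_mul_span] at h
  refine (Submodule.span_le.2 ?_) h
  rintro _ ⟨_, ⟨⟨p, q, n⟩, rfl⟩, _, ⟨⟨p', q', n'⟩, rfl⟩, rfl⟩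
  have : (wave L p q (cosProf a n) * wave L p' q' (cosProf a n') : Pt → ℂ) =
      (1 / 2 : ℂ) • wave L (p + p') (q + q') (cosProf a (n + n')) +
      (1 / 2 : ℂ) • wave L (p + p') (q + q') (cosProf a (n - n')) := by
    funext x
    rw [Pi.mul_apply, wave_mul]
    simp only [wave, cosProf_mul_cosProf, Pi.add_apply, Pi.smul_apply, smul_eq_mul]
    ring
  change (wave L p q (cosProf a n) * wave L p' q' (cosProf a n') : Pt → ℂ) ∈ cosSpan L a
  rw [this]
  exact (cosSpan L a).add_mem ((cosSpan L a).smul_mem _ (wave_mem_cosSpan _ _ _ _ _))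
    ((cosSpan L a).smul_mem _ (wave_mem_cosSpan _ _ _ _ _))

theorem star_mem_cosSpan {L a : ℝ} {t : Pt → ℂ} (ht : t ∈ cosSpan L a) :
    star t ∈ cosSpan L a := by
  induction ht using Submodule.span_induction with
  | mem t h =>
    obtain ⟨⟨p, q, n⟩, rfl⟩ := h
    have : star (wave L p q (cosProf a n)) = wave L (-p) (-q) (cosProf a n) := by
      funext x
      refine (conj_wave L p q _ x).trans ?_
      simp only [conj_cosProf]
    rw [this]
    exact wave_mem_cosSpan _ _ _ _ _
  | zero => simp
  | add s t _ _ hs ht =>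
    rw [star_add]
    exact (cosSpan L a).add_mem hs ht
  | smul c t _ ht =>
    rw [star_smul]
    exact (cosSpan L a).smul_mem _ ht

theorem one_mem_cosSpan (L a : ℝ) : (1 : Pt → ℂ) ∈ cosSpan L a := by
  have : (1 : Pt → ℂ) = wave L 0 0 (cosProf a 0) := by
    funext x
    simp [wave, cosProf, latNum, plateNum]
  rw [this]
  exact wave_mem_cosSpan _ _ _ _ _

theorem continuous_of_mem_cosSpan {L a : ℝ} {t : Pt → ℂ} (ht : t ∈ cosSpan L a) :
    Continuous t := by
  induction ht using Submodule.span_induction with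
  | mem t h =>
    obtain ⟨k, rfl⟩ := h
    exact (contDiff_wave _ _ _ (contDiff_cosProf _ _)).continuous
  | zero => exact continuous_zero
  | add s t _ _ hs ht => exact hs.add ht
  | smul c t _ ht => exact continuous_const.smul ht

/-- The map that identifies opposite lateral faces of the cell. -/
def torusMap (L a : ℝ) (x : Pt) : Fin 3 → ℂ :=
  ![wave L 1 0 (cosProf a 0) x, wave L 0 1 (cosProf a 0) x, wave L 0 0 (cosProf a 1) x]

/-- The difference s - t is a multiple of L. That s is strictly interior excludes the differences
±L, which are the glued lateral faces. -/
theorem eq_of_exp_latNum_eq {L s t : ℝ} (hL : 0 < L)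
    (h : Complex.exp (Complex.I * (latNum L 1 * s)) = Complex.exp (Complex.I * (latNum L 1 * t)))
    (hs : s ∈ Set.Ioo 0 L) (ht : t ∈ Set.Icc 0 L) : s = t := by
  obtain ⟨n, hn⟩ := Complex.exp_eq_exp_iff_exists_int.1 h
  have h1 : s - t = n * L := by
    have hLc : (L : ℂ) ≠ 0 := by exact_mod_cast hL.ne'
    have hpi : (Real.pi : ℂ) ≠ 0 := by exact_mod_cast Real.pi_ne_zero
    simp only [latNum] at hn
    push_cast at hn
    field_simp at hn
    have h2 : (s : ℂ) - t = n * L := by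
      linear_combination hn
    exact_mod_cast h2
  have h2 : |(n : ℝ)| * L < 1 * L := by
    rw [← abs_of_pos hL, ← abs_mul, abs_of_pos hL, ← h1, one_mul, abs_lt]
    constructor <;> linarith [hs.1, hs.2, ht.1, ht.2]
  have h3 : n = 0 := by
    have := lt_of_mul_lt_mul_right h2 hL.le
    rw [← Int.cast_abs] at this
    exact Int.abs_lt_one_iff.1 (by exact_mod_cast this)
  rw [h3] at h1
  simp at h1
  linarith

theorem torusMap_injOn {L a : ℝ} (hL : 0 < L) (ha : 0 < a) {x y : Pt}
    (hx : ∀ i, x i ∈ Set.Ioo 0 (side L a i)) (hy : y ∈ Set.Icc 0 (side L a))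
    (h : torusMap L a x = torusMap L a y) : x = y := by
  have h0 := congrFun h 0
  have h1 := congrFun h 1
  have h2 := congrFun h 2
  simp only [torusMap, wave, cosProf, latNum, plateNum, Matrix.cons_val] at h0 h1 h2
  simp only [Int.cast_zero, mul_zero, zero_div, Complex.ofReal_zero, zero_mul, Complex.cos_zero,
    mul_one, add_zero, zero_add, Complex.exp_zero, one_mul] at h0 h1 h2
  ext i
  fin_cases i
  · exact eq_of_exp_latNum_eq hL (by simpa [latNum] using h0) (hx 0) ⟨hy.1 0, hy.2 0⟩
  · exact eq_of_exp_latNum_eq hL (by simpa [latNum] using h1) (hx 1) ⟨hy.1 1, hy.2 1⟩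
  · have h3 : Real.cos (Real.pi / a * x 2) = Real.cos (Real.pi / a * y 2) := by
      have : Complex.cos ((Real.pi / a * x 2 : ℝ) : ℂ) =
          Complex.cos ((Real.pi / a * y 2 : ℝ) : ℂ) := by
        simpa using h2
      rw [← Complex.ofReal_cos, ← Complex.ofReal_cos] at this
      exact_mod_cast this
    have hc : 0 < Real.pi / a := by positivity
    have hmem (t : ℝ) (h0 : 0 ≤ t) (h1 : t ≤ a) : Real.pi / a * t ∈ Set.Icc 0 Real.pi := by
      refine ⟨by positivity, ?_⟩
      calc Real.pi / a * t ≤ Real.pi / a * a := by gcongr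
        _ = Real.pi := by field_simp
    have h4 := Real.injOn_cos (hmem _ (hx 2).1.le (hx 2).2.le) (hmem _ (hy.1 2) (hy.2 2)) h3
    exact mul_left_cancel₀ hc.ne' h4

theorem continuous_torusMap (L a : ℝ) : Continuous (torusMap L a) := by
  refine continuous_pi fun i => ?_
  fin_cases i <;> exact (contDiff_wave _ _ _ (contDiff_cosProf _ _)).continuous

/-- Stone–Weierstrass on the slab: functions supported in the open cell are uniform limits of
trigonometric polynomials. -/
theorem exists_cosSpan_approx {L a : ℝ} (hL : 0 < L) (ha : 0 < a) {g : Pt → ℂ}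
    (hg : Continuous g) (h0 : ∀ x, g x ≠ 0 → ∀ i, x i ∈ Set.Ioo 0 (side L a i)) {ε : ℝ}
    (hε : 0 < ε) : ∃ t ∈ cosSpan L a, ∀ x ∈ Set.Icc 0 (side L a), ‖g x - t x‖ ≤ ε := by
  let K := Set.Icc (0 : Pt) (side L a)
  have : CompactSpace K := isCompact_iff_compactSpace.1 isCompact_Icc
  let Y := torusMap L a '' K
  have : CompactSpace Y :=
    isCompact_iff_compactSpace.1 (isCompact_Icc.image (continuous_torusMap L a))
  let ψ : C(K, Y) := ⟨fun x => ⟨torusMap L a x, x, x.2, rfl⟩,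
    ((continuous_torusMap L a).comp continuous_subtype_val).subtype_mk _⟩
  have hψ : Topology.IsQuotientMap ψ := by
    refine ψ.continuous.isClosedMap.isQuotientMap ψ.continuous ?_
    rintro ⟨_, x, hx, rfl⟩
    exact ⟨⟨x, hx⟩, rfl⟩
  let G : C(K, ℂ) := ⟨fun x => g x, hg.comp continuous_subtype_val⟩
  -- Only boundary points can be glued to another point, and `g` vanishes on the boundary; so `g`
  -- descends to the compact image `Y`.
  have hfac (x y : K) (h : ψ x = ψ y) : G x = G y := by
    have hxy : torusMap L a x = torusMap L a y := congrArg Subtype.val h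
    change g x = g y
    by_cases hx : ∀ i, (x : Pt) i ∈ Set.Ioo 0 (side L a i)
    · rw [torusMap_injOn hL ha hx y.2 hxy]
    · by_cases hy : ∀ i, (y : Pt) i ∈ Set.Ioo 0 (side L a i)
      · rw [torusMap_injOn hL ha hy x.2 hxy.symm]
      · rw [not_imp_comm.1 (h0 x) hx, not_imp_comm.1 (h0 y) hy]
  let coord (i : Fin 3) : C(Y, ℂ) :=
    ⟨fun y => (y : Fin 3 → ℂ) i, (continuous_apply i).comp continuous_subtype_val⟩
  let A := StarAlgebra.adjoin ℂ (Set.range coord)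
  have hsep : A.SeparatesPoints := by
    intro y z hyz
    have h1 : (y : Fin 3 → ℂ) ≠ z := fun h => hyz (Subtype.ext h)
    obtain ⟨i, hi⟩ := Function.ne_iff.1 h1
    exact ⟨coord i, ⟨coord i, StarAlgebra.subset_adjoin ℂ _ ⟨i, rfl⟩, rfl⟩, hi⟩
  -- The coordinates of `Y` pull back to three basic waves, and the span is closed under products
  -- and conjugation; so the whole star algebra pulls back to trigonometric polynomials.
  have hA (h : C(Y, ℂ)) (hh : h ∈ A) : ∃ t ∈ cosSpan L a, ∀ x : K, h (ψ x) = t x := by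
    induction hh using StarAlgebra.adjoin_induction with
    | mem h hm =>
      obtain ⟨i, rfl⟩ := hm
      refine ⟨fun x => torusMap L a x i, ?_, fun x => rfl⟩
      fin_cases i <;> exact wave_mem_cosSpan _ _ _ _ _
    | algebraMap r => exact ⟨r • 1, (cosSpan L a).smul_mem _ (one_mem_cosSpan L a), fun x => by simp⟩
    | add f g _ _ hf hg =>
      obtain ⟨s, hs, hs'⟩ := hf
      obtain ⟨t, ht, ht'⟩ := hg
      exact ⟨s + t, (cosSpan L a).add_mem hs ht, fun x => by simp [hs', ht']⟩
    | mul f g _ _ hf hg =>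
      obtain ⟨s, hs, hs'⟩ := hf
      obtain ⟨t, ht, ht'⟩ := hg
      exact ⟨s * t, mul_mem_cosSpan hs ht, fun x => by simp [hs', ht']⟩
    | star f _ hf =>
      obtain ⟨s, hs, hs'⟩ := hf
      exact ⟨star s, star_mem_cosSpan hs, fun x => by simp [hs']⟩
  have hdense : hψ.lift G hfac ∈ A.topologicalClosure := by
    rw [ContinuousMap.starSubalgebra_topologicalClosure_eq_top_of_separatesPoints A hsep]
    trivial
  obtain ⟨f, hf, hfε⟩ := Metric.mem_closure_iff.1 hdense ε hε
  obtain ⟨t, ht, htf⟩ := hA f hf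
  refine ⟨t, ht, fun x hx => ?_⟩
  have h1 := (ContinuousMap.dist_lt_iff hε).1 hfε (ψ ⟨x, hx⟩)
  have h2 : hψ.lift G hfac (ψ ⟨x, hx⟩) = g x :=
    congrArg (fun F : C(K, ℂ) => F ⟨x, hx⟩) (hψ.lift_comp G hfac)
  rw [h2, htf, dist_eq_norm] at h1
  exact h1.le

theorem integrable_continuous_mul {L a : ℝ} {t F : Pt → ℂ} (ht : Continuous t)
    (hF : Integrable F (vol L a)) : Integrable (fun x => t x * F x) (vol L a) := by
  obtain ⟨M, hM⟩ := (isCompact_Icc (a := (0 : Pt)) (b := side L a)).exists_bound_of_continuousOn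
    ht.continuousOn
  refine hF.bdd_mul (c := M) ht.aestronglyMeasurable ?_
  filter_upwards [ae_restrict_mem (measurableSet_cell L a)] with x hx
  exact hM x (cell_subset_Icc L a hx)

/-- Uniform approximation suffices against a merely integrable `F`: smooth functions compactly
supported in the open cell are uniform limits of trigonometric polynomials, so they too integrate to
zero against `F`. -/
theorem ae_eq_zero_of_integral_cos {L a : ℝ} (hL : 0 < L) (ha : 0 < a) {F : Pt → ℂ}
    (hF : Integrable F (vol L a))
    (h : ∀ p q n : ℤ, ∫ x, wave L p q (cosProf a n) x * F x ∂vol L a = 0) :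
    F =ᵐ[vol L a] 0 := by
  have hspan (t : Pt → ℂ) (ht : t ∈ cosSpan L a) : ∫ x, t x * F x ∂vol L a = 0 := by
    induction ht using Submodule.span_induction with
    | mem t hm =>
      obtain ⟨k, rfl⟩ := hm
      exact h _ _ _
    | zero => simp
    | add s t hs' ht' hs ht =>
      simp only [Pi.add_apply, add_mul]
      rw [integral_add (integrable_continuous_mul (continuous_of_mem_cosSpan hs') hF)
        (integrable_continuous_mul (continuous_of_mem_cosSpan ht') hF), hs, ht, add_zero]
    | smul c t _ ht =>
      simp only [Pi.smul_apply, smul_eq_mul, mul_assoc]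
      rw [integral_const_mul, ht, mul_zero]
  let U : Set Pt := Set.univ.pi fun i => Set.Ioo 0 (side L a i)
  have hU : IsOpen U := isOpen_set_pi Set.finite_univ fun _ _ => isOpen_Ioo
  have hF' : LocallyIntegrable F (vol L a) := hF.locallyIntegrable
  have key := hU.ae_eq_zero_of_integral_contDiff_smul_eq_zero (hF'.locallyIntegrableOn U)
    fun g hg _ hsupp => ?_
  · filter_upwards [key, ae_mem_Ioo L a] with x h1 h2
    exact h1 fun i _ => h2 i
  · let gc : Pt → ℂ := fun x => (g x : ℂ)
    have hgc : Continuous gc := Complex.continuous_ofReal.comp hg.continuous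
    have hbound (ε : ℝ) (hε : 0 < ε) :
        ‖∫ x, g x • F x ∂vol L a‖ ≤ ε * ∫ x, ‖F x‖ ∂vol L a := by
      obtain ⟨t, ht, htε⟩ := exists_cosSpan_approx hL ha hgc (fun x hx i =>
        hsupp (subset_tsupport g (by simpa [gc] using hx)) i trivial) hε
      have e : ∫ x, g x • F x ∂vol L a = ∫ x, (gc x - t x) * F x ∂vol L a := by
        simp only [sub_mul]
        rw [integral_sub (integrable_continuous_mul hgc hF)
          (integrable_continuous_mul (continuous_of_mem_cosSpan ht) hF), hspan t ht, sub_zero]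
        simp [gc]
      rw [e, ← integral_const_mul]
      refine norm_integral_le_of_norm_le (hF.norm.const_mul ε) ?_
      filter_upwards [ae_restrict_mem (measurableSet_cell L a)] with x hx
      rw [norm_mul]
      gcongr
      exact htε x (cell_subset_Icc L a hx)
    have hlim : Filter.Tendsto (fun ε : ℝ => ε * ∫ x, ‖F x‖ ∂vol L a)
        (nhdsWithin 0 (Set.Ioi 0)) (nhds 0) := by
      have : Filter.Tendsto (fun ε : ℝ => ε * ∫ x, ‖F x‖ ∂vol L a) (nhds 0)
          (nhds (0 * ∫ x, ‖F x‖ ∂vol L a)) := Filter.Tendsto.mul_const _ Filter.tendsto_id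
      rw [zero_mul] at this
      exact this.mono_left nhdsWithin_le_nhds
    have := ge_of_tendsto hlim (Filter.eventually_of_mem self_mem_nhdsWithin hbound)
    exact norm_le_zero_iff.1 this

theorem sinProf_one_ne_zero {a z : ℝ} (hz : z ∈ Set.Ioo 0 a) : sinProf a 1 z ≠ 0 := by
  have ha : 0 < a := hz.1.trans hz.2
  have h : 0 < Real.sin (plateNum a 1 * z) := by
    refine Real.sin_pos_of_pos_of_lt_pi ?_ ?_
    · have := hz.1
      simp only [plateNum]
      positivity
    · calc plateNum a 1 * z < plateNum a 1 * a := by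
            have := hz.2
            simp only [plateNum]
            gcongr
        _ = Real.pi := by
          simp only [plateNum]
          field_simp
          simp
  rw [sinProf, ← Complex.ofReal_mul, ← Complex.ofReal_sin]
  exact_mod_cast h.ne'

/-- Reduction to the cosine case: multiply `F` by sin(πz/a). Since sin · cos is a sum of sines, the
product is orthogonal to all cosine waves, hence zero; and sin(πz/a) has no zero inside the slab. -/
theorem ae_eq_zero_of_integral_sin {L a : ℝ} (hL : 0 < L) (ha : 0 < a) {F : Pt → ℂ}
    (hF : Integrable F (vol L a))
    (h : ∀ p q n : ℤ, ∫ x, wave L p q (sinProf a n) x * F x ∂vol L a = 0) :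
    F =ᵐ[vol L a] 0 := by
  have hs := (contDiff_wave L 0 0 (contDiff_sinProf a 1)).continuous
  have hi (p q n : ℤ) := integrable_continuous_mul
    (contDiff_wave L p q (contDiff_sinProf a n)).continuous hF
  have h1 := ae_eq_zero_of_integral_cos hL ha (integrable_continuous_mul hs hF) fun p q n => by
    have e (x : Pt) : wave L p q (cosProf a n) x * (wave L 0 0 (sinProf a 1) x * F x) =
        (1 / 2) * (wave L p q (sinProf a (1 + n)) x * F x) +
        (1 / 2) * (wave L p q (sinProf a (1 - n)) x * F x) := by
      rw [← mul_assoc, mul_comm (wave L p q _ x), wave_mul]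
      simp only [wave, sinProf_mul_cosProf, zero_add]
      ring
    simp only [e]
    rw [integral_add ((hi _ _ _).const_mul _) ((hi _ _ _).const_mul _), integral_const_mul,
      integral_const_mul, h, h]
    simp
  filter_upwards [h1, ae_mem_Ioo L a] with x h2 h3
  refine (mul_eq_zero.1 h2).resolve_left (mul_ne_zero (Complex.exp_ne_zero _) ?_)
  exact sinProf_one_ne_zero (h3 2)

/-! ### Cutoffs near the plates -/

/-- A smooth function that vanishes on `t ≤ 1` and equals `1` on `t ≥ 2`. -/
def step (t : ℝ) : ℝ := Real.smoothTransition (t - 1)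

theorem contDiff_step : ContDiff ℝ ∞ step :=
  Real.smoothTransition.contDiff.comp (contDiff_id.sub contDiff_const)

theorem step_eq_zero {t : ℝ} (ht : t ≤ 1) : step t = 0 :=
  Real.smoothTransition.zero_of_nonpos (by linarith)

theorem step_eq_one {t : ℝ} (ht : 2 ≤ t) : step t = 1 :=
  Real.smoothTransition.one_of_one_le (by linarith)

theorem abs_step_le (t : ℝ) : |step t| ≤ 1 := by
  rw [step, abs_of_nonneg (Real.smoothTransition.nonneg _)]
  exact Real.smoothTransition.le_one _

theorem hasDerivAt_step (t : ℝ) : HasDerivAt step (deriv step t) t :=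
  (contDiff_step.differentiable (by simp) t).hasDerivAt

theorem deriv_step_eq_zero {t : ℝ} (ht : 2 < t) : deriv step t = 0 := by
  have h : step =ᶠ[nhds t] fun _ => 1 := by
    filter_upwards [lt_mem_nhds ht] with s hs
    exact step_eq_one hs.le
  rw [h.deriv_eq, deriv_const]

theorem deriv_step_eq_zero' {t : ℝ} (ht : t < 1) : deriv step t = 0 := by
  have h : step =ᶠ[nhds t] fun _ => 0 := by
    filter_upwards [gt_mem_nhds ht] with s hs
    exact step_eq_zero hs.le
  rw [h.deriv_eq, deriv_const]

/-- The quantity t · step'(t) is scale invariant: with t = mz it bounds z times the derivative of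
the rescaled step, uniformly in m. -/
theorem exists_bound_mul_deriv_step : ∃ B, 0 ≤ B ∧ ∀ t, |t * deriv step t| ≤ B := by
  have hc : Continuous fun t => t * deriv step t :=
    continuous_id.mul (contDiff_step.continuous_deriv (by simp))
  have hs : HasCompactSupport fun t => t * deriv step t := by
    refine HasCompactSupport.of_support_subset_isCompact (isCompact_Icc (a := (1 : ℝ)) (b := 2))
      fun t ht => ?_
    by_contra h
    apply ht
    rw [Set.mem_Icc, not_and_or, not_le, not_le] at h
    rcases h with h | h
    · simp [deriv_step_eq_zero' h]
    · simp [deriv_step_eq_zero h]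
  obtain ⟨B, hB⟩ := hs.exists_bound_of_continuous hc
  exact ⟨B, (norm_nonneg _).trans (hB 0), fun t => hB t⟩

/-- A cutoff supported in `1 / m ≤ z ≤ a - 1 / m`. -/
def cutoff (a : ℝ) (m : ℕ) (z : ℝ) : ℝ := step (m * z) * step (m * (a - z))

theorem contDiff_cutoff (a : ℝ) (m : ℕ) : ContDiff ℝ ∞ (cutoff a m) :=
  (contDiff_step.comp (contDiff_const.mul contDiff_id)).mul
    (contDiff_step.comp (contDiff_const.mul (contDiff_const.sub contDiff_id)))

theorem abs_cutoff_le (a : ℝ) (m : ℕ) (z : ℝ) : |cutoff a m z| ≤ 1 := by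
  rw [cutoff, abs_mul]
  exact mul_le_one₀ (abs_step_le _) (abs_nonneg _) (abs_step_le _)

theorem mem_of_cutoff_ne_zero {a : ℝ} {m : ℕ} (hm : 0 < m) {z : ℝ} (h : cutoff a m z ≠ 0) :
    1 / (m : ℝ) ≤ z ∧ z ≤ a - 1 / (m : ℝ) := by
  have hm' : (0 : ℝ) < m := by exact_mod_cast hm
  have h1 : 1 < m * z := by
    by_contra h'
    exact h (by rw [cutoff, step_eq_zero (not_lt.1 h'), zero_mul])
  have h2 : 1 < m * (a - z) := by
    by_contra h'
    exact h (by rw [cutoff, step_eq_zero (not_lt.1 h'), mul_zero])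
  have h3 : 1 / (m : ℝ) ≤ z := by
    rw [div_le_iff₀ hm']
    linarith
  have h4 : 1 / (m : ℝ) ≤ a - z := by
    rw [div_le_iff₀ hm']
    linarith
  exact ⟨h3, by linarith⟩

/-- The derivative of `cutoff`. -/
def cutoffDeriv (a : ℝ) (m : ℕ) (z : ℝ) : ℝ :=
  m * deriv step (m * z) * step (m * (a - z)) - step (m * z) * (m * deriv step (m * (a - z)))

theorem hasDerivAt_cutoff (a : ℝ) (m : ℕ) (z : ℝ) :
    HasDerivAt (cutoff a m) (cutoffDeriv a m z) z := by
  have h1 : HasDerivAt (fun z => step (m * z)) (deriv step (m * z) * (m * 1)) z :=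
    (hasDerivAt_step (m * z)).comp z ((hasDerivAt_id z).const_mul (m : ℝ))
  have h2 : HasDerivAt (fun z => step (m * (a - z))) (deriv step (m * (a - z)) * (m * -1)) z :=
    HasDerivAt.comp (h₂ := step) (h := fun z => (m : ℝ) * (a - z)) z
      (hasDerivAt_step (m * (a - z))) (((hasDerivAt_id z).const_sub a).const_mul (m : ℝ))
  refine (h1.mul h2).congr_deriv ?_
  rw [cutoffDeriv]
  ring

theorem eventually_two_lt_mul {z : ℝ} (hz : 0 < z) :
    ∀ᶠ m : ℕ in Filter.atTop, 2 < (m : ℝ) * z := by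
  have h : Filter.Tendsto (fun m : ℕ => (m : ℝ) * z) Filter.atTop Filter.atTop :=
    tendsto_natCast_atTop_atTop.atTop_mul_const hz
  exact h.eventually_gt_atTop 2

theorem eventually_cutoff {a z : ℝ} (hz : z ∈ Set.Ioo 0 a) :
    ∀ᶠ m : ℕ in Filter.atTop, cutoff a m z = 1 ∧ cutoffDeriv a m z = 0 := by
  filter_upwards [eventually_two_lt_mul hz.1, eventually_two_lt_mul (sub_pos.2 hz.2)] with m h1 h2
  rw [cutoff, cutoffDeriv, step_eq_one h1.le, step_eq_one h2.le, deriv_step_eq_zero h1,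
    deriv_step_eq_zero h2]
  simp

theorem norm_sinProf_le (a : ℝ) (n : ℤ) {z : ℝ} (hz : 0 ≤ z) :
    ‖sinProf a n z‖ ≤ |plateNum a n| * z := by
  rw [sinProf, ← Complex.ofReal_mul, ← Complex.ofReal_sin, Complex.norm_real, Real.norm_eq_abs]
  refine Real.abs_sin_le_abs.trans ?_
  rw [abs_mul, abs_of_nonneg hz]

theorem norm_sinProf_sub {a : ℝ} (ha : a ≠ 0) (n : ℤ) (z : ℝ) :
    ‖sinProf a n (a - z)‖ = ‖sinProf a n z‖ := by
  simp only [sinProf, ← Complex.ofReal_mul, ← Complex.ofReal_sin, Complex.norm_real]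
  have h : plateNum a n * (a - z) = n * Real.pi - plateNum a n * z := by
    simp only [plateNum]
    field_simp
  rw [h, Real.sin_int_mul_pi_sub, norm_neg, norm_mul]
  simp

/-- The cutoff has slope of order m in layers of width of order 1/m at the plates, where the sine is
itself of order 1/m. The product stays bounded in m, as dominated convergence requires. -/
theorem norm_sinProf_mul_cutoffDeriv_le {a : ℝ} (ha : a ≠ 0) {B : ℝ}
    (hB : ∀ t, |t * deriv step t| ≤ B) (n : ℤ) (m : ℕ) {z : ℝ} (hz : z ∈ Set.Ioo 0 a) :
    ‖sinProf a n z * cutoffDeriv a m z‖ ≤ 2 * (|plateNum a n| * B) := by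
  -- Here w is the distance to one plate and s the step factor belonging to the other.
  have key (w : ℝ) (hw : 0 ≤ w) (h : ‖sinProf a n z‖ ≤ |plateNum a n| * w) (s : ℝ)
      (hs : |s| ≤ 1) : ‖sinProf a n z‖ * |m * deriv step (m * w) * s| ≤ |plateNum a n| * B := by
    calc ‖sinProf a n z‖ * |m * deriv step (m * w) * s|
        ≤ (|plateNum a n| * w) * (|m * deriv step (m * w)| * 1) := by
          rw [abs_mul _ s]
          gcongr
      _ = |plateNum a n| * |m * w * deriv step (m * w)| := by
          simp only [abs_mul, abs_of_nonneg hw]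
          ring
      _ ≤ |plateNum a n| * B := by
          gcongr
          exact hB _
  have h1 := key z hz.1.le (norm_sinProf_le a n hz.1.le) (step (m * (a - z))) (abs_step_le _)
  have h2 := key (a - z) (sub_pos.2 hz.2).le
    (norm_sinProf_sub ha n z ▸ norm_sinProf_le a n (sub_pos.2 hz.2).le) (step (m * z))
    (abs_step_le _)
  rw [norm_mul, Complex.norm_real, Real.norm_eq_abs, cutoffDeriv]
  calc _ ≤ ‖sinProf a n z‖ * (|m * deriv step (m * z) * step (m * (a - z))| +
        |step (m * z) * (m * deriv step (m * (a - z)))|) := by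
        gcongr
        exact abs_sub _ _
    _ ≤ _ := by
        rw [mul_add, mul_comm (step (m * z))]
        linarith

/-- A profile multiplied by the cutoff. -/
def cutProf (a : ℝ) (m : ℕ) (χ : ℝ → ℂ) (z : ℝ) : ℂ := χ z * cutoff a m z

theorem contDiff_cutProf (a : ℝ) (m : ℕ) {χ : ℝ → ℂ} (hχ : ContDiff ℝ ∞ χ) :
    ContDiff ℝ ∞ (cutProf a m χ) :=
  hχ.mul (Complex.ofRealCLM.contDiff.comp (contDiff_cutoff a m))

theorem hasDerivAt_cutProf (a : ℝ) (m : ℕ) {χ : ℝ → ℂ} {d : ℂ} {z : ℝ} (hχ : HasDerivAt χ d z) :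
    HasDerivAt (cutProf a m χ) (d * cutoff a m z + χ z * cutoffDeriv a m z) z :=
  hχ.mul (hasDerivAt_cutoff a m z).ofReal_comp

theorem plateSupported_wave_cutProf (L a : ℝ) (p q : ℤ) {m : ℕ} (hm : 0 < m) (χ : ℝ → ℂ) :
    PlateSupported a (wave L p q (cutProf a m χ)) := by
  refine ⟨1 / m, by positivity, fun x hx => mem_of_cutoff_ne_zero hm fun h => hx ?_⟩
  simp [wave, cutProf, h]

theorem testFunction_wave_cutProf {L : ℝ} (hL : L ≠ 0) (a : ℝ) (p q : ℤ) {m : ℕ} (hm : 0 < m)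
    {χ : ℝ → ℂ} (hχ : ContDiff ℝ ∞ χ) : TestFunction L a (wave L p q (cutProf a m χ)) :=
  ⟨contDiff_wave L p q (contDiff_cutProf a m hχ), wave_periodic hL p q _,
    plateSupported_wave_cutProf L a p q hm χ⟩

theorem norm_wave (L : ℝ) (p q : ℤ) (χ : ℝ → ℂ) (x : Pt) : ‖wave L p q χ x‖ = ‖χ (x 2)‖ := by
  have h : Complex.I * (latNum L p * x 0 + latNum L q * x 1) =
      ((latNum L p * x 0 + latNum L q * x 1 : ℝ) : ℂ) * Complex.I := by
    push_cast
    ring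
  rw [wave, norm_mul, h, Complex.norm_exp_ofReal_mul_I, one_mul]

theorem norm_cosProf_le (a : ℝ) (n : ℤ) (z : ℝ) : ‖cosProf a n z‖ ≤ 1 := by
  rw [cosProf, ← Complex.ofReal_mul, ← Complex.ofReal_cos, Complex.norm_real]
  exact Real.abs_cos_le_one _

theorem norm_sinProf_le_one (a : ℝ) (n : ℤ) (z : ℝ) : ‖sinProf a n z‖ ≤ 1 := by
  rw [sinProf, ← Complex.ofReal_mul, ← Complex.ofReal_sin, Complex.norm_real]
  exact Real.abs_sin_le_one _

theorem tendsto_integral_conj_mul {L a : ℝ} {F : Pt → ℂ} (hF : Integrable F (vol L a))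
    {f : ℕ → Pt → ℂ} {g : Pt → ℂ} (hf : ∀ m, Continuous (f m)) {M : ℝ}
    (hM : ∀ᵐ x ∂vol L a, ∀ m, ‖f m x‖ ≤ M)
    (hlim : ∀ᵐ x ∂vol L a, ∀ᶠ m in Filter.atTop, f m x = g x) :
    Filter.Tendsto (fun m => ∫ x, starRingEnd ℂ (f m x) * F x ∂vol L a) Filter.atTop
      (nhds (∫ x, starRingEnd ℂ (g x) * F x ∂vol L a)) := by
  refine tendsto_integral_of_dominated_convergence (fun x => M * ‖F x‖) (fun m => ?_)
    (hF.norm.const_mul M) (fun m => ?_) ?_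
  · exact ((Complex.continuous_conj.comp (hf m)).aestronglyMeasurable).mul hF.1
  · filter_upwards [hM] with x hx
    rw [norm_mul, RCLike.norm_conj]
    gcongr
    exact hx m
  · filter_upwards [hlim] with x hx
    refine tendsto_const_nhds.congr' ?_
    filter_upwards [hx] with m hm
    rw [hm]

theorem integrable_comp_Lp {L a : ℝ} (E : L2 L a) (i : Fin 3) :
    Integrable (fun x => E x i) (vol L a) :=
  ((EuclideanSpace.proj i : V3 →L[ℂ] ℂ).integrable_comp
    ((Lp.memLp E).integrable (by norm_num)))

theorem norm_cutProf_le (a : ℝ) (m : ℕ) (χ : ℝ → ℂ) (z : ℝ) (h : ‖χ z‖ ≤ 1) :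
    ‖cutProf a m χ z‖ ≤ 1 := by
  rw [cutProf, norm_mul, Complex.norm_real]
  exact mul_le_one₀ h (norm_nonneg _) (abs_cutoff_le a m z)

theorem tendsto_integral_wave_cutProf {L a : ℝ} (p q : ℤ) {χ : ℝ → ℂ} (hχ : ContDiff ℝ ∞ χ)
    (hb : ∀ z, ‖χ z‖ ≤ 1) {F : Pt → ℂ} (hF : Integrable F (vol L a)) :
    Filter.Tendsto (fun m => ∫ x, starRingEnd ℂ (wave L p q (cutProf a m χ) x) * F x ∂vol L a)
      Filter.atTop (nhds (∫ x, starRingEnd ℂ (wave L p q χ x) * F x ∂vol L a)) := by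
  refine tendsto_integral_conj_mul hF
    (fun m => (contDiff_wave L p q (contDiff_cutProf a m hχ)).continuous) (M := 1) ?_ ?_
  · refine Filter.Eventually.of_forall fun x m => ?_
    rw [norm_wave]
    exact norm_cutProf_le a m χ _ (hb _)
  · filter_upwards [ae_mem_Ioo L a] with x hx
    filter_upwards [eventually_cutoff (a := a) (hx 2)] with m hm
    simp only [wave, cutProf]
    rw [hm.1, Complex.ofReal_one, mul_one]

theorem testField_single {L a : ℝ} {f : Pt → ℂ} (hf : TestFunction L a f) (i : Fin 3) :
    TestField L a fun x => EuclideanSpace.single i (f x) := by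
  refine ⟨⟨?_, fun x => ?_⟩, ?_⟩
  · rw [contDiff_piLp 2]
    intro j
    by_cases hj : j = i
    · subst hj
      simpa using hf.smooth
    · simpa [hj] using contDiff_const
  · rw [(hf.periodic x).1, (hf.periodic x).2]
    exact ⟨rfl, rfl⟩
  · obtain ⟨ε, hε, h⟩ := hf.supported
    refine ⟨ε, hε, fun x hx => h x fun h0 => hx ?_⟩
    change EuclideanSpace.single i (f x) = 0
    rw [h0]
    simp

theorem inner_single_left (i : Fin 3) (c : ℂ) (v : V3) :
    inner ℂ (EuclideanSpace.single i c) v = starRingEnd ℂ c * v i := by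
  rw [EuclideanSpace.inner_single_left]

theorem L2.eq_zero_of_comp {L a : ℝ} {E : L2 L a} (h : ∀ i, (fun x => E x i) =ᵐ[vol L a] 0) :
    E = 0 := by
  apply Lp.ext
  filter_upwards [h 0, h 1, h 2, Lp.coeFn_zero V3 2 (vol L a)] with x h0 h1 h2 hz
  rw [hz]
  ext i
  fin_cases i
  exacts [h0, h1, h2]

/-- Test fields are total in `L²`. -/
theorem eq_zero_of_integral_testField {L a : ℝ} (hL : 0 < L) (ha : 0 < a) {C : L2 L a}
    (h : ∀ Φ, TestField L a Φ → ∫ x, inner ℂ (Φ x) (C x) ∂vol L a = 0) : C = 0 := by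
  refine L2.eq_zero_of_comp fun i => ?_
  refine ae_eq_zero_of_integral_cos hL ha (integrable_comp_Lp C i) fun p q n => ?_
  -- The opposite indices undo the conjugation in the inner product.
  have h1 := tendsto_integral_wave_cutProf (-p) (-q) (contDiff_cosProf a n) (norm_cosProf_le a n)
    (integrable_comp_Lp C i)
  have h2 : ∀ᶠ m in Filter.atTop, ∫ x, starRingEnd ℂ
      (wave L (-p) (-q) (cutProf a m (cosProf a n)) x) * C x i ∂vol L a = 0 := by
    filter_upwards [Filter.eventually_gt_atTop 0] with m hm
    have := h _ (testField_single (testFunction_wave_cutProf hL.ne' a (-p) (-q) hm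
      (contDiff_cosProf a n)) i)
    simpa only [inner_single_left] using this
  have h3 := tendsto_nhds_unique h1 (tendsto_const_nhds.congr' (h2.mono fun _ h => h.symm))
  simpa only [conj_wave, neg_neg, conj_cosProf] using h3

/-! ### Modes -/

/-- The field with amplitudes `v` in the trigonometric mode with indices `p, q, n`. -/
def modeField (L a : ℝ) (p q n : ℤ) (v : V3) (x : Pt) : V3 :=
  !₂[v 0 * wave L p q (sinProf a n) x, v 1 * wave L p q (sinProf a n) x,
    v 2 * wave L p q (cosProf a n) x]

/-- The direction of the gradient in a mode. -/
def gradDir (L a : ℝ) (p q n : ℤ) : V3 :=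
  !₂[Complex.I * latNum L p, Complex.I * latNum L q, (plateNum a n : ℂ)]

/-- Fourier coefficients of a field. -/
def fourierVec (L a : ℝ) (p q n : ℤ) (E : L2 L a) : V3 :=
  !₂[∫ x, starRingEnd ℂ (wave L p q (sinProf a n) x) * E x 0 ∂vol L a,
    ∫ x, starRingEnd ℂ (wave L p q (sinProf a n) x) * E x 1 ∂vol L a,
    ∫ x, starRingEnd ℂ (wave L p q (cosProf a n) x) * E x 2 ∂vol L a]

theorem integrable_conj_mul_comp {L a : ℝ} {f : Pt → ℂ} (hf : Continuous f) (E : L2 L a)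
    (i : Fin 3) : Integrable (fun x => starRingEnd ℂ (f x) * E x i) (vol L a) :=
  integrable_continuous_mul (Complex.continuous_conj.comp hf) (integrable_comp_Lp E i)

theorem integral_inner_modeField {L a : ℝ} (p q n : ℤ) (v : V3) (E : L2 L a) :
    ∫ x, inner ℂ (modeField L a p q n v x) (E x) ∂vol L a =
      inner ℂ v (fourierVec L a p q n E) := by
  have hs := (contDiff_wave L p q (contDiff_sinProf a n)).continuous
  have hc := (contDiff_wave L p q (contDiff_cosProf a n)).continuous
  simp only [V3.inner_eq, modeField, fourierVec, Matrix.cons_val, map_mul, mul_assoc]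
  refine (integral_add_add ((integrable_conj_mul_comp hs E 0).const_mul _)
    ((integrable_conj_mul_comp hs E 1).const_mul _)
    ((integrable_conj_mul_comp hc E 2).const_mul _)).trans ?_
  simp only [integral_const_mul]

theorem eq_zero_of_fourierVec {L a : ℝ} (hL : 0 < L) (ha : 0 < a) {E : L2 L a}
    (h : ∀ p q n, fourierVec L a p q n E = 0) : E = 0 := by
  have h' (p q n : ℤ) (i : Fin 3) := congrArg (fun v : V3 => v i) (h (-p) (-q) n)
  refine L2.eq_zero_of_comp fun i => ?_
  fin_cases i
  · refine ae_eq_zero_of_integral_sin hL ha (integrable_comp_Lp E 0) fun p q n => ?_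
    simpa [fourierVec, conj_wave, conj_sinProf] using h' p q n 0
  · refine ae_eq_zero_of_integral_sin hL ha (integrable_comp_Lp E 1) fun p q n => ?_
    simpa [fourierVec, conj_wave, conj_sinProf] using h' p q n 1
  · refine ae_eq_zero_of_integral_cos hL ha (integrable_comp_Lp E 2) fun p q n => ?_
    simpa [fourierVec, conj_wave, conj_cosProf] using h' p q n 2

/-- Divergence-free fields have no longitudinal Fourier coefficients. -/
theorem inner_gradDir_fourierVec {L a : ℝ} (hL : 0 < L) (ha : 0 < a) {E : L2 L a}
    (hE : E ∈ divFree L a) (p q n : ℤ) :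
    inner ℂ (gradDir L a p q n) (fourierVec L a p q n E) = 0 := by
  -- The gradient of wave × sine is the mode with amplitudes `gradDir`. The sine profile is not
  -- supported away from the plates, so it is tested with a cutoff, which is then removed in the
  -- limit.
  have hsm := contDiff_sinProf a n
  have h0 := (tendsto_integral_wave_cutProf p q hsm (norm_sinProf_le_one a n)
    (integrable_comp_Lp E 0)).const_mul (starRingEnd ℂ (Complex.I * latNum L p))
  have h1 := (tendsto_integral_wave_cutProf p q hsm (norm_sinProf_le_one a n)
    (integrable_comp_Lp E 1)).const_mul (starRingEnd ℂ (Complex.I * latNum L q))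
  have hcont (m : ℕ) : Continuous (pd 2 (wave L p q (cutProf a m (sinProf a n)))) :=
    pd_continuous 2 (contDiff_wave L p q (contDiff_cutProf a m hsm))
  have hpd (m : ℕ) (x : Pt) : pd 2 (wave L p q (cutProf a m (sinProf a n))) x =
      wave L p q (fun _ => plateNum a n * cosProf a n (x 2) * cutoff a m (x 2) +
        sinProf a n (x 2) * cutoffDeriv a m (x 2)) x :=
    pd_two_wave L p q (hasDerivAt_cutProf a m (hasDerivAt_sinProf a n (x 2)))
  obtain ⟨B, hB0, hB⟩ := exists_bound_mul_deriv_step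
  have h2 : Filter.Tendsto (fun m => ∫ x, starRingEnd ℂ
      (pd 2 (wave L p q (cutProf a m (sinProf a n))) x) * E x 2 ∂vol L a) Filter.atTop
      (nhds (∫ x, starRingEnd ℂ (plateNum a n * wave L p q (cosProf a n) x) * E x 2 ∂vol L a)) := by
    -- The first summand of the bound controls the derivative of the sine, the second the derivative
    -- of the cutoff.
    refine tendsto_integral_conj_mul (integrable_comp_Lp E 2) hcont
      (M := |plateNum a n| + 2 * (|plateNum a n| * B)) ?_ ?_
    · filter_upwards [ae_mem_Ioo L a] with x hx m
      rw [hpd, norm_wave]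
      refine (norm_add_le _ _).trans (add_le_add ?_ ?_)
      · rw [mul_assoc, norm_mul, Complex.norm_real, Real.norm_eq_abs]
        exact mul_le_of_le_one_right (abs_nonneg _)
          (norm_cutProf_le a m (cosProf a n) _ (norm_cosProf_le a n _))
      · exact norm_sinProf_mul_cutoffDeriv_le ha.ne' hB n m (hx 2)
    · filter_upwards [ae_mem_Ioo L a] with x hx
      filter_upwards [eventually_cutoff (a := a) (hx 2)] with m hm
      rw [hpd, hm.1, hm.2]
      simp only [wave, Complex.ofReal_one, Complex.ofReal_zero]
      ring
  have hlim := (h0.add h1).add h2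
  have hzero : ∀ᶠ m in Filter.atTop,
      starRingEnd ℂ (Complex.I * latNum L p) * ∫ x, starRingEnd ℂ
        (wave L p q (cutProf a m (sinProf a n)) x) * E x 0 ∂vol L a +
      starRingEnd ℂ (Complex.I * latNum L q) * ∫ x, starRingEnd ℂ
        (wave L p q (cutProf a m (sinProf a n)) x) * E x 1 ∂vol L a +
      ∫ x, starRingEnd ℂ (pd 2 (wave L p q (cutProf a m (sinProf a n))) x) * E x 2 ∂vol L a =
      0 := by
    filter_upwards [Filter.eventually_gt_atTop 0] with m hm
    have hφ := testFunction_wave_cutProf hL.ne' a p q hm hsm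
    have := hE _ hφ
    simp only [V3.inner_eq, grad, Matrix.cons_val,
      pd_zero_wave L p q (contDiff_cutProf a m hsm), pd_one_wave L p q (contDiff_cutProf a m hsm),
      map_mul, mul_assoc] at this
    rw [← this]
    refine Eq.trans ?_ (integral_add_add
      (((integrable_conj_mul_comp hφ.smooth.continuous E 0).const_mul _).const_mul _)
      (((integrable_conj_mul_comp hφ.smooth.continuous E 1).const_mul _).const_mul _)
      (integrable_conj_mul_comp (hcont m) E 2)).symm
    simp only [integral_const_mul, map_mul, mul_assoc]
  have hfin := tendsto_nhds_unique hlim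
    (tendsto_const_nhds.congr' (hzero.mono fun _ h => h.symm))
  rw [V3.inner_eq]
  simp only [gradDir, fourierVec, PiLp.toLp_apply, Matrix.cons_val]
  rw [← hfin]
  simp only [map_mul, mul_assoc, integral_const_mul]

/-! ### Boundary values and orthogonality relations of the trigonometric profiles. -/

theorem sinProf_zero (a : ℝ) (n : ℤ) : sinProf a n 0 = 0 := by
  simp [sinProf]

theorem sinProf_side {a : ℝ} (ha : a ≠ 0) (n : ℤ) : sinProf a n a = 0 := by
  have h : plateNum a n * a = n * Real.pi := by
    simp only [plateNum]
    field_simp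
  rw [sinProf, ← Complex.ofReal_mul, h, ← Complex.ofReal_sin, Real.sin_int_mul_pi,
    Complex.ofReal_zero]

theorem latNum_ne_zero {L : ℝ} (hL : L ≠ 0) {p : ℤ} (hp : p ≠ 0) : latNum L p ≠ 0 := by
  have h : (p : ℝ) ≠ 0 := by exact_mod_cast hp
  have := Real.pi_ne_zero
  simp only [latNum]
  positivity

theorem plateNum_ne_zero {a : ℝ} (ha : a ≠ 0) {n : ℤ} (hn : n ≠ 0) : plateNum a n ≠ 0 := by
  have h : (n : ℝ) ≠ 0 := by exact_mod_cast hn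
  have := Real.pi_ne_zero
  simp only [plateNum]
  positivity

theorem integral_one_vol {L a : ℝ} (hL : 0 ≤ L) (ha : 0 ≤ a) :
    ∫ _, (1 : ℂ) ∂vol L a = (L ^ 2 * a : ℝ) := by
  have h : (vol L a).real Set.univ = L ^ 2 * a := by
    rw [measureReal_def, Measure.restrict_apply_univ, cell, Real.volume_pi_Ioc,
      Fin.prod_univ_three]
    simp only [sub_zero, Matrix.cons_val, ENNReal.toReal_mul]
    rw [ENNReal.toReal_ofReal hL, ENNReal.toReal_ofReal ha]
    ring
  rw [integral_const, h]
  simp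

/-- A wave with a nonzero wave number is a derivative in that direction: of itself laterally, of the
sine wave across the plates. The boundary values match, so the integral vanishes. -/
theorem integral_wave_cosProf {L a : ℝ} (hL : 0 < L) (ha : 0 < a) (p q n : ℤ) :
    ∫ x, wave L p q (cosProf a n) x ∂vol L a =
      if p = 0 ∧ q = 0 ∧ n = 0 then ((L ^ 2 * a : ℝ) : ℂ) else 0 := by
  have hs := contDiff_wave L p q (contDiff_cosProf a n)
  have hper := wave_periodic hL.ne' p q (cosProf a n)
  by_cases hp : p = 0
  · by_cases hq : q = 0
    · by_cases hn : n = 0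
      · have (x : Pt) : wave L p q (cosProf a n) x = 1 := by
          simp [wave, cosProf, latNum, plateNum, hp, hq, hn]
        simp only [this, integral_one_vol hL.le ha.le]
        rw [if_pos ⟨hp, hq, hn⟩]
      · rw [if_neg (by tauto)]
        have h := integral_pd_eq_zero hL.le ha.le 2
          (contDiff_wave L p q (contDiff_sinProf a n)) fun x hx => by
            have h1 : (x + Pi.single 2 (side L a 2) : Pt) 2 = a := add_single_two x _ hx
            simp only [wave]
            rw [h1, hx, sinProf_zero, sinProf_side ha.ne', mul_zero, mul_zero]
        have e (x : Pt) : pd 2 (wave L p q (sinProf a n)) x =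
            plateNum a n * wave L p q (cosProf a n) x := by
          rw [pd_two_wave L p q (hasDerivAt_sinProf a n (x 2))]
          simp only [wave]
          ring
        simp only [e, integral_const_mul] at h
        refine (mul_eq_zero.1 h).resolve_left ?_
        exact_mod_cast plateNum_ne_zero ha.ne' hn
    · rw [if_neg (by tauto)]
      have h := integral_pd_eq_zero hL.le ha.le 1 hs fun x _ => (hper x).2
      simp only [pd_one_wave L p q (contDiff_cosProf a n), integral_const_mul] at h
      refine (mul_eq_zero.1 h).resolve_left (mul_ne_zero Complex.I_ne_zero ?_)
      exact_mod_cast latNum_ne_zero hL.ne' hq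
  · rw [if_neg (by tauto)]
    have h := integral_pd_eq_zero hL.le ha.le 0 hs fun x _ => (hper x).1
    simp only [pd_zero_wave L p q (contDiff_cosProf a n), integral_const_mul] at h
    refine (mul_eq_zero.1 h).resolve_left (mul_ne_zero Complex.I_ne_zero ?_)
    exact_mod_cast latNum_ne_zero hL.ne' hp

/-- For natural n, n' the frequency n + n' vanishes only when both do; this extra term doubles the
norm of the cosine at n = 0. -/
theorem integral_conj_wave_cos_mul {L a : ℝ} (hL : 0 < L) (ha : 0 < a) (p q p' q' : ℤ)
    (n n' : ℕ) :
    ∫ x, starRingEnd ℂ (wave L p q (cosProf a n) x) * wave L p' q' (cosProf a n') x ∂vol L a =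
      if p = p' ∧ q = q' ∧ n = n' then
        ((if n = 0 then L ^ 2 * a else L ^ 2 * a / 2 : ℝ) : ℂ) else 0 := by
  have e (x : Pt) : starRingEnd ℂ (wave L p q (cosProf a n) x) * wave L p' q' (cosProf a n') x =
      (1 / 2) * wave L (-p + p') (-q + q') (cosProf a (n + n')) x +
      (1 / 2) * wave L (-p + p') (-q + q') (cosProf a (n - n')) x := by
    rw [conj_wave, wave_mul]
    simp only [wave, conj_cosProf, cosProf_mul_cosProf]
    ring
  simp only [e]
  have hi (m : ℤ) := integrable_of_continuous L a
    (contDiff_wave L (-p + p') (-q + q') (contDiff_cosProf a m)).continuous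
  rw [integral_add ((hi _).const_mul _) ((hi _).const_mul _), integral_const_mul,
    integral_const_mul, integral_wave_cosProf hL ha, integral_wave_cosProf hL ha]
  by_cases h : p = p' ∧ q = q' ∧ n = n'
  · obtain ⟨rfl, rfl, rfl⟩ := h
    by_cases hn : n = 0
    · simp [hn]
      ring
    · have : ¬ ((n : ℤ) + n = 0) := by omega
      simp [hn, this]
      ring
  · rw [if_neg h, if_neg (by omega), if_neg (by omega)]
    simp

theorem integral_conj_wave_sin_mul {L a : ℝ} (hL : 0 < L) (ha : 0 < a) (p q p' q' : ℤ)
    (n n' : ℕ) :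
    ∫ x, starRingEnd ℂ (wave L p q (sinProf a n) x) * wave L p' q' (sinProf a n') x ∂vol L a =
      if p = p' ∧ q = q' ∧ n = n' then
        ((if n = 0 then 0 else L ^ 2 * a / 2 : ℝ) : ℂ) else 0 := by
  have e (x : Pt) : starRingEnd ℂ (wave L p q (sinProf a n) x) * wave L p' q' (sinProf a n') x =
      (1 / 2) * wave L (-p + p') (-q + q') (cosProf a (n - n')) x -
      (1 / 2) * wave L (-p + p') (-q + q') (cosProf a (n + n')) x := by
    rw [conj_wave, wave_mul]
    simp only [wave, conj_sinProf, sinProf_mul_sinProf]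
    ring
  simp only [e]
  have hi (m : ℤ) := integrable_of_continuous L a
    (contDiff_wave L (-p + p') (-q + q') (contDiff_cosProf a m)).continuous
  rw [integral_sub ((hi _).const_mul _) ((hi _).const_mul _), integral_const_mul,
    integral_const_mul, integral_wave_cosProf hL ha, integral_wave_cosProf hL ha]
  by_cases h : p = p' ∧ q = q' ∧ n = n'
  · obtain ⟨rfl, rfl, rfl⟩ := h
    by_cases hn : n = 0
    · simp [hn]
    · have : ¬ ((n : ℤ) + n = 0) := by omega
      simp [hn, this]
      ring
  · rw [if_neg h, if_neg (by omega), if_neg (by omega)]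
    simp

/-! #### Smoothness, curl and divergence of the modes -/

/-- The companion of `modeField` with cosine and sine exchanged. -/
def comodeField (L a : ℝ) (p q n : ℤ) (w : V3) (x : Pt) : V3 :=
  !₂[w 0 * wave L p q (cosProf a n) x, w 1 * wave L p q (cosProf a n) x,
    w 2 * wave L p q (sinProf a n) x]

/-- The amplitudes of the curl of a mode. -/
def curlAmp (L a : ℝ) (p q n : ℤ) (v : V3) : V3 :=
  !₂[Complex.I * latNum L q * v 2 - plateNum a n * v 1,
    plateNum a n * v 0 - Complex.I * latNum L p * v 2,
    Complex.I * latNum L p * v 1 - Complex.I * latNum L q * v 0]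

theorem smoothField_of_waves {L : ℝ} (hL : L ≠ 0) (p q : ℤ) (v : V3) (χ : Fin 3 → ℝ → ℂ)
    (hχ : ∀ i, ContDiff ℝ ∞ (χ i)) {F : Pt → V3} (hF : ∀ x i, F x i = v i * wave L p q (χ i) x) :
    SmoothField L F := by
  refine ⟨?_, fun x => ⟨?_, ?_⟩⟩
  · rw [contDiff_piLp 2]
    intro i
    simp only [hF]
    exact contDiff_const.mul (contDiff_wave L p q (hχ i))
  · ext i
    rw [hF, hF, (wave_periodic hL p q (χ i) x).1]
  · ext i
    rw [hF, hF, (wave_periodic hL p q (χ i) x).2]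

theorem smoothField_modeField {L : ℝ} (hL : L ≠ 0) (a : ℝ) (p q n : ℤ) (v : V3) :
    SmoothField L (modeField L a p q n v) := by
  refine smoothField_of_waves hL p q v ![sinProf a n, sinProf a n, cosProf a n] (fun i => ?_)
    fun x i => ?_
  · fin_cases i
    exacts [contDiff_sinProf a n, contDiff_sinProf a n, contDiff_cosProf a n]
  · fin_cases i <;> rfl

theorem smoothField_comodeField {L : ℝ} (hL : L ≠ 0) (a : ℝ) (p q n : ℤ) (v : V3) :
    SmoothField L (comodeField L a p q n v) := by
  refine smoothField_of_waves hL p q v ![cosProf a n, cosProf a n, sinProf a n] (fun i => ?_)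
    fun x i => ?_
  · fin_cases i
    exacts [contDiff_cosProf a n, contDiff_cosProf a n, contDiff_sinProf a n]
  · fin_cases i <;> rfl

theorem smoothPECField_modeField {L a : ℝ} (hL : L ≠ 0) (ha : a ≠ 0) (p q n : ℤ) (v : V3) :
    SmoothPECField L a (modeField L a p q n v) := by
  refine ⟨smoothField_modeField hL a p q n v, fun x hx => ?_⟩
  have h : sinProf a n (x 2) = 0 := by
    rcases hx with hx | hx
    · rw [hx, sinProf_zero]
    · rw [hx, sinProf_side ha]
  simp [modeField, wave, h]

theorem pd_two_wave_cosProf (L a : ℝ) (p q n : ℤ) (x : Pt) :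
    pd 2 (wave L p q (cosProf a n)) x = -(plateNum a n * wave L p q (sinProf a n) x) := by
  rw [pd_two_wave L p q (hasDerivAt_cosProf a n (x 2))]
  simp only [wave]
  ring

theorem pd_two_wave_sinProf (L a : ℝ) (p q n : ℤ) (x : Pt) :
    pd 2 (wave L p q (sinProf a n)) x = plateNum a n * wave L p q (cosProf a n) x := by
  rw [pd_two_wave L p q (hasDerivAt_sinProf a n (x 2))]
  simp only [wave]
  ring

theorem curl_modeField (L a : ℝ) (p q n : ℤ) (v : V3) :
    curl (modeField L a p q n v) = comodeField L a p q n (curlAmp L a p q n v) := by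
  funext x
  have hs := contDiff_wave L p q (contDiff_sinProf a n)
  have hc := contDiff_wave L p q (contDiff_cosProf a n)
  ext i
  fin_cases i <;>
  simp only [curl, modeField, comodeField, curlAmp, Matrix.cons_val, pd_smul _ _ hs,
    pd_smul _ _ hc, pd_zero_wave L p q (contDiff_sinProf a n),
    pd_zero_wave L p q (contDiff_cosProf a n), pd_one_wave L p q (contDiff_sinProf a n),
    pd_one_wave L p q (contDiff_cosProf a n), pd_two_wave_sinProf, Fin.zero_eta, Fin.mk_one,
    Fin.reduceFinMk] <;>
  ring

/-- The squared wave number of a mode. -/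
def eigVal (L a : ℝ) (p q n : ℤ) : ℝ := latNum L p ^ 2 + latNum L q ^ 2 + plateNum a n ^ 2

/-- This is curl curl = grad div - Δ: `hv` makes the divergence vanish, and -Δ acts by the squared
wave number on sine and cosine profiles alike. -/
theorem curl_curl_modeField (L a : ℝ) (p q n : ℤ) {v : V3}
    (hv : inner ℂ (gradDir L a p q n) v = 0) :
    curl (curl (modeField L a p q n v)) = fun x => (eigVal L a p q n : ℂ) •
      modeField L a p q n v x := by
  funext x
  have hs := contDiff_wave L p q (contDiff_sinProf a n)
  have hc := contDiff_wave L p q (contDiff_cosProf a n)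
  have hI := Complex.I_sq
  rw [V3.inner_eq] at hv
  simp only [gradDir, Matrix.cons_val, map_mul, Complex.conj_I, Complex.conj_ofReal] at hv
  rw [curl_modeField]
  ext i
  fin_cases i <;>
  simp only [curl, modeField, comodeField, curlAmp, Matrix.cons_val, pd_smul _ _ hs,
    pd_smul _ _ hc, pd_zero_wave L p q (contDiff_sinProf a n),
    pd_zero_wave L p q (contDiff_cosProf a n), pd_one_wave L p q (contDiff_sinProf a n),
    pd_one_wave L p q (contDiff_cosProf a n), pd_two_wave_cosProf, Fin.zero_eta, Fin.mk_one,
    Fin.reduceFinMk, eigVal, PiLp.smul_apply, smul_eq_mul, Complex.ofReal_add,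
    Complex.ofReal_pow]
  · linear_combination (-Complex.I * latNum L p * wave L p q (sinProf a n) x) * hv +
      (-(latNum L p ^ 2 + latNum L q ^ 2) * v 0 * wave L p q (sinProf a n) x) * hI
  · linear_combination (-Complex.I * latNum L q * wave L p q (sinProf a n) x) * hv +
      (-(latNum L p ^ 2 + latNum L q ^ 2) * v 1 * wave L p q (sinProf a n) x) * hI
  · linear_combination (-plateNum a n * wave L p q (cosProf a n) x) * hv +
      (-(latNum L p ^ 2 + latNum L q ^ 2) * v 2 * wave L p q (cosProf a n) x) * hI

theorem div_modeField (L a : ℝ) (p q n : ℤ) {v : V3}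
    (hv : inner ℂ (gradDir L a p q n) v = 0) (x : Pt) :
    pd 0 (fun y => modeField L a p q n v y 0) x + pd 1 (fun y => modeField L a p q n v y 1) x +
      pd 2 (fun y => modeField L a p q n v y 2) x = 0 := by
  have hs := contDiff_wave L p q (contDiff_sinProf a n)
  have hc := contDiff_wave L p q (contDiff_cosProf a n)
  rw [V3.inner_eq] at hv
  simp only [gradDir, Matrix.cons_val, map_mul, Complex.conj_I, Complex.conj_ofReal] at hv
  simp only [modeField, Matrix.cons_val, pd_smul _ _ hs, pd_smul _ _ hc,
    pd_zero_wave L p q (contDiff_sinProf a n), pd_one_wave L p q (contDiff_sinProf a n),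
    pd_two_wave_cosProf]
  linear_combination (-wave L p q (sinProf a n) x) * hv

/-! #### The modes as elements of `L²` -/

/-- The class in `L²` of a continuous field. -/
def toL2 (L a : ℝ) {F : Pt → V3} (hF : Continuous F) : L2 L a :=
  (memLp_of_continuous L a hF).toLp F

theorem coeFn_toL2 (L a : ℝ) {F : Pt → V3} (hF : Continuous F) : toL2 L a hF =ᵐ[vol L a] F :=
  (memLp_of_continuous L a hF).coeFn_toLp

theorem inner_toL2 (L a : ℝ) {F : Pt → V3} (hF : Continuous F) (E : L2 L a) :
    inner ℂ (toL2 L a hF) E = ∫ x, inner ℂ (F x) (E x) ∂vol L a := by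
  rw [L2.inner_def]
  refine integral_congr_ae ?_
  filter_upwards [coeFn_toL2 L a hF] with x hx
  rw [hx]

theorem continuous_modeField (L a : ℝ) (p q n : ℤ) (v : V3) :
    Continuous (modeField L a p q n v) := by
  have hs := (contDiff_wave L p q (contDiff_sinProf a n)).continuous
  have hc := (contDiff_wave L p q (contDiff_cosProf a n)).continuous
  refine (PiLp.continuous_toLp 2 _).comp (continuous_pi fun i => ?_)
  fin_cases i
  exacts [continuous_const.mul hs, continuous_const.mul hs, continuous_const.mul hc]

/-- The mode with amplitudes `v` as an element of `L²`. -/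
def modeLp (L a : ℝ) (p q n : ℤ) (v : V3) : L2 L a := toL2 L a (continuous_modeField L a p q n v)

theorem inner_modeLp (L a : ℝ) (p q n : ℤ) (v : V3) (E : L2 L a) :
    inner ℂ (modeLp L a p q n v) E = inner ℂ v (fourierVec L a p q n E) := by
  rw [modeLp, inner_toL2, integral_inner_modeField]

/-- At n = 0 the sine profile is zero, so only the normal amplitude survives, and with the larger
norm of the constant profile. -/
theorem fourierVec_modeLp {L a : ℝ} (hL : 0 < L) (ha : 0 < a) (p q p' q' : ℤ) (n n' : ℕ)
    (v : V3) : fourierVec L a p q n (modeLp L a p' q' n' v) =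
      if p = p' ∧ q = q' ∧ n = n' then
        (if n = 0 then !₂[0, 0, ((L ^ 2 * a : ℝ) : ℂ) * v 2] else ((L ^ 2 * a / 2 : ℝ) : ℂ) • v)
      else 0 := by
  have hae := coeFn_toL2 L a (continuous_modeField L a p' q' n' v)
  have h (i : Fin 3) (f g : Pt → ℂ) (hg : ∀ x, modeField L a p' q' n' v x i = v i * g x) :
      ∫ x, starRingEnd ℂ (f x) * modeLp L a p' q' n' v x i ∂vol L a =
        v i * ∫ x, starRingEnd ℂ (f x) * g x ∂vol L a := by
    rw [← integral_const_mul]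
    refine integral_congr_ae ?_
    filter_upwards [hae] with x hx
    rw [modeLp, hx, hg]
    ring
  have h0 := h 0 (wave L p q (sinProf a n)) (wave L p' q' (sinProf a n')) fun x => rfl
  have h1 := h 1 (wave L p q (sinProf a n)) (wave L p' q' (sinProf a n')) fun x => rfl
  have h2 := h 2 (wave L p q (cosProf a n)) (wave L p' q' (cosProf a n')) fun x => rfl
  rw [integral_conj_wave_sin_mul hL ha] at h0 h1
  rw [integral_conj_wave_cos_mul hL ha] at h2
  rw [fourierVec, h0, h1, h2]
  by_cases hk : p = p' ∧ q = q' ∧ n = n'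
  · simp only [hk, and_self, if_true]
    by_cases hn : n' = 0
    · ext i
      fin_cases i <;> simp [hn, mul_comm]
    · ext i
      fin_cases i <;> simp [hn, mul_comm]
  · simp only [hk, if_false]
    ext i
    fin_cases i <;> simp

/-! ### The weak curl with perfect-conductor boundary conditions -/

theorem integral_inner_coeFn_toL2 {L a : ℝ} (G : Pt → V3) {F : Pt → V3} (hF : Continuous F) :
    ∫ x, inner ℂ (G x) (toL2 L a hF x) ∂vol L a = ∫ x, inner ℂ (G x) (F x) ∂vol L a := by
  refine integral_congr_ae ?_
  filter_upwards [coeFn_toL2 L a hF] with x hx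
  rw [hx]

theorem mem_weakCurlGraph_iff {L a : ℝ} {p : L2 L a × L2 L a} : p ∈ weakCurlGraph L a ↔
    ∀ Φ, ∀ hΦ : TestField L a Φ, inner ℂ (toL2 L a (curl_continuous hΦ.smooth)) p.1 =
      inner ℂ (toL2 L a hΦ.smooth.continuous) p.2 := by
  simp only [inner_toL2]
  rfl

theorem isClosed_weakCurlGraph (L a : ℝ) :
    IsClosed (weakCurlGraph L a : Set (L2 L a × L2 L a)) := by
  have h : (weakCurlGraph L a : Set (L2 L a × L2 L a)) = ⋂ (Φ : Pt → V3) (hΦ : TestField L a Φ),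
      {p | inner ℂ (toL2 L a (curl_continuous hΦ.smooth)) p.1 =
        inner ℂ (toL2 L a hΦ.smooth.continuous) p.2} := by
    ext p
    simp only [SetLike.mem_coe, mem_weakCurlGraph_iff, Set.mem_iInter, Set.mem_ofPred_eq]
  rw [h]
  exact isClosed_iInter fun Φ => isClosed_iInter fun hΦ =>
    isClosed_eq (continuous_const.inner continuous_fst) (continuous_const.inner continuous_snd)

theorem isClosed_hzcurlGraph (L a : ℝ) :
    IsClosed (hzcurlGraph L a : Set (L2 L a × L2 L a)) :=
  (isClosed_weakCurlGraph L a).inter (smoothPECGraph L a).isClosed_topologicalClosure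

theorem mem_divFree_iff {L a : ℝ} {E : L2 L a} : E ∈ divFree L a ↔
    ∀ φ, ∀ hφ : TestFunction L a φ, inner ℂ (toL2 L a (grad_continuous hφ.smooth)) E = 0 := by
  simp only [inner_toL2]
  rfl

theorem isClosed_divFree (L a : ℝ) : IsClosed (divFree L a : Set (L2 L a)) := by
  have h : (divFree L a : Set (L2 L a)) = ⋂ (φ : Pt → ℂ) (hφ : TestFunction L a φ),
      {E | inner ℂ (toL2 L a (grad_continuous hφ.smooth)) E = 0} := by
    ext p
    simp only [SetLike.mem_coe, mem_divFree_iff, Set.mem_iInter, Set.mem_ofPred_eq]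
  rw [h]
  exact isClosed_iInter fun Φ => isClosed_iInter fun hΦ =>
    isClosed_eq (continuous_const.inner continuous_id) continuous_const

theorem SmoothPECField.mem_hzcurlGraph {L a : ℝ} (hL : 0 ≤ L) (ha : 0 ≤ a) {F : Pt → V3}
    (hF : SmoothPECField L a F) :
    (toL2 L a hF.smooth.continuous, toL2 L a (curl_continuous hF.smooth)) ∈ hzcurlGraph L a := by
  refine ⟨fun Φ hΦ => ?_, subset_closure ⟨F, hF, coeFn_toL2 L a hF.smooth.continuous,
    coeFn_toL2 L a (curl_continuous hF.smooth)⟩⟩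
  simp only [integral_inner_coeFn_toL2]
  exact integral_inner_curl hL ha hF hΦ.toSmoothField

/-- Green's formula on `H₀(curl)`. -/
theorem inner_curl_eq_of_mem_hzcurlGraph {L a : ℝ} (hL : 0 ≤ L) (ha : 0 ≤ a) {Ψ : Pt → V3}
    (hΨ : SmoothField L Ψ) {p : L2 L a × L2 L a} (hp : p ∈ hzcurlGraph L a) :
    inner ℂ (toL2 L a (curl_continuous hΨ.smooth)) p.1 =
      inner ℂ (toL2 L a hΨ.smooth.continuous) p.2 := by
  -- Both sides are continuous in the graph norm, so it is enough to have the identity for smooth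
  -- conductor fields.
  refine closure_minimal (t := {p : L2 L a × L2 L a |
    inner ℂ (toL2 L a (curl_continuous hΨ.smooth)) p.1 =
      inner ℂ (toL2 L a hΨ.smooth.continuous) p.2}) ?_
    (isClosed_eq (continuous_const.inner continuous_fst) (continuous_const.inner continuous_snd))
    hp.2
  rintro ⟨E, C⟩ ⟨F, hF, h1, h2⟩
  simp only [Set.mem_ofPred_eq, inner_toL2]
  have e1 : ∫ x, inner ℂ (curl Ψ x) (E x) ∂vol L a = ∫ x, inner ℂ (curl Ψ x) (F x) ∂vol L a := by
    refine integral_congr_ae ?_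
    filter_upwards [h1] with x hx
    rw [hx]
  have e2 : ∫ x, inner ℂ (Ψ x) (C x) ∂vol L a = ∫ x, inner ℂ (Ψ x) (curl F x) ∂vol L a := by
    refine integral_congr_ae ?_
    filter_upwards [h2] with x hx
    rw [hx]
  rw [e1, e2, integral_inner_curl hL ha hF hΨ]

/-- A weak curl of zero is orthogonal to every test field, and these are total. So the graph is
single-valued and really defines `hzcurl`. -/
theorem hzcurlGraph_snd_eq_zero {L a : ℝ} (hL : 0 < L) (ha : 0 < a) (p : L2 L a × L2 L a)
    (hp : p ∈ hzcurlGraph L a) (h0 : p.1 = 0) : p.2 = 0 := by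
  refine eq_zero_of_integral_testField hL ha fun Φ hΦ => ?_
  rw [← hp.1 Φ hΦ, h0, pair_zero]

theorem mem_hzcurl_domain {L a : ℝ} {E C : L2 L a} (h : (E, C) ∈ hzcurlGraph L a) :
    E ∈ (hzcurl L a).domain :=
  ⟨(E, C), h, rfl⟩

theorem hzcurl_mem {L a : ℝ} (hL : 0 < L) (ha : 0 < a) (E : (hzcurl L a).domain) :
    ((E : L2 L a), hzcurl L a E) ∈ hzcurlGraph L a :=
  Submodule.mem_graph_toLinearPMap (hzcurlGraph_snd_eq_zero hL ha) E

theorem hzcurl_apply {L a : ℝ} (hL : 0 < L) (ha : 0 < a) {E C : L2 L a}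
    (h : (E, C) ∈ hzcurlGraph L a) (hE : E ∈ (hzcurl L a).domain) : hzcurl L a ⟨E, hE⟩ = C := by
  have h1 := (hzcurlGraph L a).sub_mem (hzcurl_mem hL ha ⟨E, hE⟩) h
  exact sub_eq_zero.1 (hzcurlGraph_snd_eq_zero hL ha _ h1 (sub_self _))

/-! ### The orthonormal basis of transverse modes -/

/-- Amplitudes of the divergence-free modes other than the static one. -/
def polSpace (L a : ℝ) (k : ℤ × ℤ × ℕ) : Submodule ℂ V3 where
  -- The second condition removes tangential amplitudes that multiply the zero profile at n = 0; the
  -- third removes the static mode. Natural n suffices, as -n gives the same profiles up to sign.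
  carrier := {v | inner ℂ (gradDir L a k.1 k.2.1 k.2.2) v = 0 ∧ (k.2.2 = 0 → v 0 = 0 ∧ v 1 = 0) ∧
    (k = 0 → v = 0)}
  zero_mem' := ⟨inner_zero_right _, fun _ => ⟨rfl, rfl⟩, fun _ => rfl⟩
  add_mem' := fun {v w} hv hw => ⟨by rw [inner_add_right, hv.1, hw.1, add_zero],
    fun h => by simp [hv.2.1 h, hw.2.1 h], fun h => by simp [hv.2.2 h, hw.2.2 h]⟩
  smul_mem' := fun c v hv => ⟨by rw [inner_smul_right, hv.1, mul_zero],
    fun h => by simp [hv.2.1 h], fun h => by simp [hv.2.2 h]⟩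

/-- Indices of the transverse modes. -/
abbrev ModeIndex (L a : ℝ) : Type :=
  Σ k : ℤ × ℤ × ℕ, Fin (Module.finrank ℂ (polSpace L a k))

/-- The squared normalization constant of a mode. -/
def normSq (L a : ℝ) (n : ℕ) : ℝ := if n = 0 then 1 / (L ^ 2 * a) else 2 / (L ^ 2 * a)

theorem normSq_pos {L a : ℝ} (hL : 0 < L) (ha : 0 < a) (n : ℕ) : 0 < normSq L a n := by
  rw [normSq]
  split_ifs <;> positivity

/-- The normalized amplitudes of a transverse mode. -/
def modeAmp (L a : ℝ) (i : ModeIndex L a) : V3 :=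
  ((Real.sqrt (normSq L a i.1.2.2) : ℝ) : ℂ) •
    (stdOrthonormalBasis ℂ (polSpace L a i.1) i.2 : V3)

theorem modeAmp_mem (L a : ℝ) (i : ModeIndex L a) : modeAmp L a i ∈ polSpace L a i.1 :=
  (polSpace L a i.1).smul_mem _ (Subtype.property _)

/-- The transverse modes. -/
def transMode (L a : ℝ) (i : ModeIndex L a) : L2 L a :=
  modeLp L a i.1.1 i.1.2.1 i.1.2.2 (modeAmp L a i)

theorem inner_modeLp_modeLp {L a : ℝ} (hL : 0 < L) (ha : 0 < a) (k k' : ℤ × ℤ × ℕ) {v w : V3}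
    (hv : k.2.2 = 0 → v 0 = 0 ∧ v 1 = 0) :
    inner ℂ (modeLp L a k.1 k.2.1 k.2.2 v) (modeLp L a k'.1 k'.2.1 k'.2.2 w) =
      if k = k' then (((normSq L a k.2.2)⁻¹ : ℝ) : ℂ) * inner ℂ v w else 0 := by
  obtain ⟨p, q, n⟩ := k
  obtain ⟨p', q', n'⟩ := k'
  rw [inner_modeLp, fourierVec_modeLp hL ha]
  simp only [Prod.mk.injEq]
  by_cases hk : p = p' ∧ q = q' ∧ n = n'
  · rw [if_pos hk, if_pos hk]
    by_cases hn : n = 0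
    · rw [if_pos hn, normSq, if_pos hn, V3.inner_eq, V3.inner_eq]
      simp only [(hv hn).1, (hv hn).2, Matrix.cons_val, one_div, inv_inv]
      simp
      ring
    · rw [if_neg hn, normSq, if_neg hn, inner_smul_right, inv_div]
  · rw [if_neg hk, if_neg hk, inner_zero_right]

theorem orthonormal_transMode {L a : ℝ} (hL : 0 < L) (ha : 0 < a) :
    Orthonormal ℂ (transMode L a) := by
  classical
  rw [orthonormal_iff_ite]
  rintro ⟨k, s⟩ ⟨k', s'⟩
  rw [transMode, transMode, inner_modeLp_modeLp hL ha k k' (modeAmp_mem L a ⟨k, s⟩).2.1]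
  by_cases hk : k = k'
  · subst hk
    have h1 := orthonormal_iff_ite.1 (stdOrthonormalBasis ℂ (polSpace L a k)).orthonormal s s'
    rw [Submodule.coe_inner] at h1
    rw [if_pos rfl, modeAmp, modeAmp, inner_smul_left, inner_smul_right, h1, Complex.conj_ofReal,
      ← mul_assoc, ← mul_assoc, ← Complex.ofReal_mul, ← Complex.ofReal_mul, mul_assoc,
      Real.mul_self_sqrt (normSq_pos hL ha _).le, inv_mul_cancel₀ (normSq_pos hL ha _).ne']
    simp
  · rw [if_neg hk, if_neg]
    rintro h
    exact hk (congrArg Sigma.fst h)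

theorem inner_hzero (L a : ℝ) (E : L2 L a) : inner ℂ (hzero L a) E =
    inner ℂ (!₂[0, 0, (((Real.sqrt (L ^ 2 * a))⁻¹ : ℝ) : ℂ)] : V3) (fourierVec L a 0 0 0 E) := by
  rw [← integral_inner_modeField]
  refine (inner_toL2 L a continuous_const E).trans ?_
  congr 1
  funext x
  congr 1
  ext i
  fin_cases i <;> simp [modeField, wave, cosProf, latNum, plateNum]

theorem inner_hzero_transMode {L a : ℝ} (hL : 0 < L) (ha : 0 < a) (i : ModeIndex L a) :
    inner ℂ (hzero L a) (transMode L a i) = 0 := by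
  rw [inner_hzero]
  have h := fourierVec_modeLp hL ha 0 0 i.1.1 i.1.2.1 0 i.1.2.2 (modeAmp L a i)
  rw [Nat.cast_zero] at h
  rw [transMode, h]
  by_cases hk : 0 = i.1.1 ∧ 0 = i.1.2.1 ∧ 0 = i.1.2.2
  · have h0 : i.1 = 0 := Prod.ext hk.1.symm (Prod.ext hk.2.1.symm hk.2.2.symm)
    rw [(modeAmp_mem L a i).2.2 h0, if_pos hk, if_pos rfl, V3.inner_eq]
    simp
  · rw [if_neg hk, inner_zero_right]

theorem fourierVec_sin_zero (L a : ℝ) (p q : ℤ) (E : L2 L a) :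
    fourierVec L a p q 0 E 0 = 0 ∧ fourierVec L a p q 0 E 1 = 0 := by
  have h (x : Pt) : wave L p q (sinProf a 0) x = 0 := by
    simp [wave, sinProf, plateNum]
  simp [fourierVec, h]

theorem fourierVec_neg (L a : ℝ) (p q n : ℤ) (E : L2 L a) (h : fourierVec L a p q n E = 0) :
    fourierVec L a p q (-n) E = 0 := by
  have hs (x : Pt) : wave L p q (sinProf a (-n)) x = -wave L p q (sinProf a n) x := by
    simp [wave, sinProf, plateNum, neg_div]
  have hc (x : Pt) : wave L p q (cosProf a (-n)) x = wave L p q (cosProf a n) x := by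
    simp [wave, cosProf, plateNum, neg_div]
  have h' (i : Fin 3) := congrArg (fun v : V3 => v i) h
  have h0 := h' 0
  have h1 := h' 1
  have h2 := h' 2
  simp only [fourierVec, Matrix.cons_val, PiLp.zero_apply] at h0 h1 h2
  simp only [fourierVec, hs, hc, map_neg, neg_mul, integral_neg, h0, h1, h2]
  ext i
  fin_cases i <;> simp

/-- Zero divergence and orthogonality to the static mode put each Fourier vector into its
`polSpace`; there it is orthogonal to a basis, hence zero. Parity covers negative n, and the
trigonometric systems are complete. -/
theorem eq_zero_of_inner_transMode {L a : ℝ} (hL : 0 < L) (ha : 0 < a) {E : L2 L a}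
    (hE : E ∈ divFree L a) (h0 : inner ℂ (hzero L a) E = 0)
    (h : ∀ i, inner ℂ (transMode L a i) E = 0) : E = 0 := by
  have hnat (p q : ℤ) (n : ℕ) : fourierVec L a p q n E = 0 := by
    have hmem : fourierVec L a p q n E ∈ polSpace L a (p, q, n) := by
      refine ⟨inner_gradDir_fourierVec hL ha hE p q n, ?_, ?_⟩
      · rintro (rfl : n = 0)
        exact fourierVec_sin_zero L a p q E
      · intro hk
        simp only [Prod.mk_eq_zero] at hk
        obtain ⟨rfl, rfl, rfl⟩ := hk
        rw [inner_hzero, V3.inner_eq] at h0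
        have hs := fourierVec_sin_zero L a 0 0 E
        have h2 : fourierVec L a 0 0 0 E 2 = 0 := by
          simp only [Matrix.cons_val, map_zero, zero_mul, zero_add, Complex.conj_ofReal] at h0
          refine (mul_eq_zero.1 h0).resolve_left ?_
          have : (Real.sqrt (L ^ 2 * a))⁻¹ ≠ 0 := by positivity
          exact_mod_cast this
        rw [Nat.cast_zero]
        ext i
        fin_cases i
        exacts [hs.1, hs.2, h2]
    have hzero : (⟨_, hmem⟩ : polSpace L a (p, q, n)) = 0 := by
      apply (stdOrthonormalBasis ℂ (polSpace L a (p, q, n))).repr.injective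
      ext s
      rw [OrthonormalBasis.repr_apply_apply, map_zero, Submodule.coe_inner]
      have h1 := h ⟨(p, q, n), s⟩
      rw [transMode, inner_modeLp, modeAmp, inner_smul_left] at h1
      refine (mul_eq_zero.1 h1).resolve_left ?_
      rw [Complex.conj_ofReal]
      have : Real.sqrt (normSq L a n) ≠ 0 := (Real.sqrt_pos.2 (normSq_pos hL ha n)).ne'
      exact_mod_cast this
    exact congrArg Subtype.val hzero
  refine eq_zero_of_fourierVec hL ha fun p q n => ?_
  obtain ⟨m, rfl | rfl⟩ := n.eq_nat_or_neg
  · exact hnat p q m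
  · exact fourierVec_neg L a p q m E (hnat p q m)

/-! ### The transverse modes in the form domain, and their completeness in the physical space. -/

theorem transMode_mem_divFree {L a : ℝ} (hL : 0 < L) (ha : 0 < a) (i : ModeIndex L a) :
    transMode L a i ∈ divFree L a := by
  intro φ hφ
  refine (integral_inner_coeFn_toL2 (grad φ) (continuous_modeField L a _ _ _ _)).trans ?_
  rw [integral_inner_grad hL.le ha.le (smoothField_modeField hL.ne' a _ _ _ _) hφ]
  simp only [div_modeField L a _ _ _ (modeAmp_mem L a i).1, mul_zero, integral_zero, neg_zero]

/-- The field whose class is `transMode`. -/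
def transField (L a : ℝ) (i : ModeIndex L a) : Pt → V3 :=
  modeField L a i.1.1 i.1.2.1 i.1.2.2 (modeAmp L a i)

theorem smoothPECField_transField {L a : ℝ} (hL : 0 < L) (ha : 0 < a) (i : ModeIndex L a) :
    SmoothPECField L a (transField L a i) :=
  smoothPECField_modeField hL.ne' ha.ne' _ _ _ _

theorem smoothField_curl_transField {L a : ℝ} (hL : 0 < L) (i : ModeIndex L a) :
    SmoothField L (curl (transField L a i)) := by
  rw [transField, curl_modeField]
  exact smoothField_comodeField hL.ne' a _ _ _ _

/-- The eigenvalue of a transverse mode. -/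
def transEig (L a : ℝ) (i : ModeIndex L a) : ℝ := eigVal L a i.1.1 i.1.2.1 i.1.2.2

/-- The curl of a transverse mode. -/
def transCurl {L a : ℝ} (hL : 0 < L) (i : ModeIndex L a) : L2 L a :=
  toL2 L a (smoothField_curl_transField hL i).smooth.continuous

theorem transMode_mem_hzcurlGraph {L a : ℝ} (hL : 0 < L) (ha : 0 < a) (i : ModeIndex L a) :
    (transMode L a i, transCurl hL i) ∈ hzcurlGraph L a :=
  (smoothPECField_transField hL ha i).mem_hzcurlGraph hL.le ha.le

/-- The weak eigenvalue equation against all of H₀(curl): Green's formula with the curl of a mode as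
smooth field, followed by curl curl of the mode. -/
theorem inner_transCurl {L a : ℝ} (hL : 0 < L) (ha : 0 < a) (i : ModeIndex L a)
    {p : L2 L a × L2 L a} (hp : p ∈ hzcurlGraph L a) :
    inner ℂ (transCurl hL i) p.2 = transEig L a i * inner ℂ (transMode L a i) p.1 := by
  have h := inner_curl_eq_of_mem_hzcurlGraph hL.le ha.le (smoothField_curl_transField hL i) hp
  rw [transCurl, ← h, inner_toL2]
  have e : curl (curl (transField L a i)) = fun x => (transEig L a i : ℂ) • transField L a i x :=
    curl_curl_modeField L a _ _ _ (modeAmp_mem L a i).1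
  have e2 : inner ℂ (transMode L a i) p.1 =
      ∫ x, inner ℂ (transField L a i x) (p.1 x) ∂vol L a :=
    inner_toL2 L a (continuous_modeField L a _ _ _ _) _
  rw [e, e2, ← integral_const_mul]
  simp only [inner_smul_left, Complex.conj_ofReal]

theorem transMode_mem_VPEC {L a : ℝ} (hL : 0 < L) (ha : 0 < a) (i : ModeIndex L a) :
    transMode L a i ∈ VPEC L a :=
  ⟨mem_hzcurl_domain (transMode_mem_hzcurlGraph hL ha i), transMode_mem_divFree hL ha i⟩

theorem transMode_mem_Hphys {L a : ℝ} (hL : 0 < L) (ha : 0 < a) (i : ModeIndex L a) :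
    transMode L a i ∈ Hphys L a :=
  ⟨subset_closure (transMode_mem_VPEC hL ha i),
    Submodule.mem_orthogonal_singleton_iff_inner_right.2 (inner_hzero_transMode hL ha i)⟩

theorem Hphys_le_divFree (L a : ℝ) : Hphys L a ≤ divFree L a := fun _ hE =>
  closure_minimal (fun _ h => h.2) (isClosed_divFree L a) hE.1

/-- The transverse modes as elements of the physical Hilbert space. -/
def transVec {L a : ℝ} (hL : 0 < L) (ha : 0 < a) (i : ModeIndex L a) : Hphys L a :=
  ⟨transMode L a i, transMode_mem_Hphys hL ha i⟩

theorem inner_transVec {L a : ℝ} (hL : 0 < L) (ha : 0 < a) (i : ModeIndex L a)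
    (E : Hphys L a) : inner ℂ (transVec hL ha i) E = inner ℂ (transMode L a i) (E : L2 L a) := by
  rw [Submodule.coe_inner, transVec]

theorem orthonormal_transVec {L a : ℝ} (hL : 0 < L) (ha : 0 < a) :
    Orthonormal ℂ (transVec hL ha) := by
  classical
  rw [orthonormal_iff_ite]
  intro i j
  rw [inner_transVec]
  exact orthonormal_iff_ite.1 (orthonormal_transMode hL ha) i j

theorem span_transVec_orthogonal {L a : ℝ} (hL : 0 < L) (ha : 0 < a) :
    (Submodule.span ℂ (Set.range (transVec hL ha)))ᗮ = ⊥ := by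
  rw [Submodule.eq_bot_iff]
  intro E hE
  refine Subtype.ext (eq_zero_of_inner_transMode hL ha (Hphys_le_divFree L a E.2)
    (Submodule.mem_orthogonal_singleton_iff_inner_right.1 E.2.2) fun i => ?_)
  rw [← inner_transVec hL ha]
  exact (Submodule.mem_orthogonal _ _).1 hE _ (Submodule.subset_span ⟨i, rfl⟩)

/-- The Hilbert basis of transverse modes. -/
def transBasis {L a : ℝ} (hL : 0 < L) (ha : 0 < a) :
    HilbertBasis (ModeIndex L a) ℂ (Hphys L a) :=
  HilbertBasis.mkOfOrthogonalEqBot (orthonormal_transVec hL ha) (span_transVec_orthogonal hL ha)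

theorem coe_transBasis {L a : ℝ} (hL : 0 < L) (ha : 0 < a) (i : ModeIndex L a) :
    (transBasis hL ha i : L2 L a) = transMode L a i := by
  rw [transBasis, HilbertBasis.coe_mkOfOrthogonalEqBot, transVec]

theorem inner_transBasis {L a : ℝ} (hL : 0 < L) (ha : 0 < a) (i : ModeIndex L a)
    (E : Hphys L a) : inner ℂ (transBasis hL ha i) E = inner ℂ (transMode L a i) (E : L2 L a) := by
  rw [Submodule.coe_inner, coe_transBasis]

/-! ### The spectrum of the Maxwell operator -/

theorem le_transEig {L a : ℝ} (i : ModeIndex L a) :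
    min ((2 * Real.pi / L) ^ 2) ((Real.pi / a) ^ 2) ≤ transEig L a i := by
  obtain ⟨⟨p, q, n⟩, s⟩ := i
  -- Over the zero wave vector `polSpace` is trivial, so no index lies there; this is what opens the
  -- spectral gap.
  have hk : (p, q, n) ≠ (0 : ℤ × ℤ × ℕ) := by
    intro h0
    have hbot : polSpace L a (p, q, n) = ⊥ :=
      (Submodule.eq_bot_iff _).2 fun v hv => hv.2.2 h0
    have hrank : Module.finrank ℂ (polSpace L a (p, q, n)) = 0 := by rw [hbot, finrank_bot]
    exact (Fin.cast hrank s).elim0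
  have hint (c : ℝ) (m : ℤ) (hm : m ≠ 0) : c ^ 2 ≤ (c * m) ^ 2 := by
    have h1 : (1 : ℝ) ≤ (m : ℝ) ^ 2 := by
      have : (1 : ℤ) ≤ m ^ 2 := by
        have := sq_pos_of_ne_zero hm
        omega
      exact_mod_cast this
    rw [mul_pow]
    exact le_mul_of_one_le_right (sq_nonneg c) h1
  have e1 (m : ℤ) : latNum L m = 2 * Real.pi / L * m := by
    rw [latNum]
    ring
  have e2 (m : ℤ) : plateNum a m = Real.pi / a * m := by
    rw [plateNum]
    ring
  simp only [transEig, eigVal]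
  have hp := sq_nonneg (latNum L p)
  have hq := sq_nonneg (latNum L q)
  have hn := sq_nonneg (plateNum a n)
  by_cases h1 : p = 0
  · by_cases h2 : q = 0
    · have h3 : (n : ℤ) ≠ 0 := by
        intro h3
        exact hk (by simp [h1, h2, Int.natCast_eq_zero.1 h3])
      refine (min_le_right _ _).trans ((hint _ _ h3).trans ?_)
      rw [← e2]
      linarith
    · refine (min_le_left _ _).trans ((hint _ _ h2).trans ?_)
      rw [← e1]
      linarith
  · refine (min_le_left _ _).trans ((hint _ _ h1).trans ?_)
    rw [← e1]
    linarith

theorem transEig_lower_pos {L a : ℝ} (hL : 0 < L) (ha : 0 < a) :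
    0 < min ((2 * Real.pi / L) ^ 2) ((Real.pi / a) ^ 2) := by
  have := Real.pi_pos
  exact lt_min (by positivity) (by positivity)

theorem transEig_pos {L a : ℝ} (hL : 0 < L) (ha : 0 < a) (i : ModeIndex L a) :
    0 < transEig L a i :=
  (transEig_lower_pos hL ha).trans_le (le_transEig i)

/-! ### Diagonalization of the Maxwell operator. -/

theorem qPEC_eq {L a : ℝ} (hL : 0 < L) (ha : 0 < a) {E F C D : L2 L a} (hE : E ∈ VPEC L a)
    (hF : F ∈ VPEC L a) (hC : (E, C) ∈ hzcurlGraph L a) (hD : (F, D) ∈ hzcurlGraph L a) :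
    qPEC L a ⟨E, hE⟩ ⟨F, hF⟩ = inner ℂ D C := by
  rw [qPEC, hzcurl_apply hL ha hC, hzcurl_apply hL ha hD]

theorem summable_smul_of_orthogonal {ι K : Type*} [NormedAddCommGroup K]
    [InnerProductSpace ℂ K] [CompleteSpace K] {c : ι → K} {lam : ι → ℝ} (h0 : ∀ i, 0 < lam i)
    (hon : ∀ i, inner ℂ (c i) (c i) = lam i) (horth : ∀ i j, i ≠ j → inner ℂ (c i) (c j) = 0)
    {e : ι → ℂ} (he : Summable fun i => lam i * ‖e i‖ ^ 2) : Summable fun i => e i • c i := by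
  classical
  have hsq (i : ι) : (Real.sqrt (lam i) : ℂ) ≠ 0 := by
    exact_mod_cast (Real.sqrt_pos.2 (h0 i)).ne'
  have hw : Orthonormal ℂ fun i => (Real.sqrt (lam i) : ℂ)⁻¹ • c i := by
    rw [orthonormal_iff_ite]
    intro i j
    rw [inner_smul_left, inner_smul_right, map_inv₀, Complex.conj_ofReal]
    by_cases hij : i = j
    · have h1 : (lam i : ℂ) = Real.sqrt (lam i) * Real.sqrt (lam i) := by
        exact_mod_cast (Real.mul_self_sqrt (h0 i).le).symm
      subst hij
      rw [if_pos rfl, hon, h1, inv_mul_cancel_left₀ (hsq i), inv_mul_cancel₀ (hsq i)]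
    · rw [horth i j hij, if_neg hij, mul_zero, mul_zero]
  have h2 : Summable fun i => ‖(Real.sqrt (lam i) : ℂ) * e i‖ ^ 2 := by
    refine he.congr fun i => ?_
    rw [norm_mul, mul_pow, Complex.norm_real, Real.norm_eq_abs, sq_abs, Real.sq_sqrt (h0 i).le]
  refine ((hw.orthogonalFamily.summable_iff_norm_sq_summable _).2 h2).congr fun i => ?_
  rw [LinearIsometry.toSpanSingleton_apply, smul_smul, mul_right_comm, mul_inv_cancel₀ (hsq i),
    one_mul]

/-- These are the absolute values of the terms in the Parseval series of ⟨x, y⟩: membership in the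
operator domain gives finite form energy. -/
theorem _root_.HilbertBasis.summable_mul_norm_sq {ι H : Type*} [NormedAddCommGroup H]
    [InnerProductSpace ℂ H] (u : HilbertBasis ι ℂ H) {lam : ι → ℝ} (h0 : ∀ i, 0 ≤ lam i) {x y : H}
    (h : ∀ i, inner ℂ (u i) y = lam i * inner ℂ (u i) x) :
    Summable fun i => lam i * ‖inner ℂ (u i) x‖ ^ 2 := by
  refine (u.summable_inner_mul_inner x y).norm.congr fun i => ?_
  rw [h, norm_mul, norm_mul, Complex.norm_real, Real.norm_of_nonneg (h0 i), norm_inner_symm x]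
  ring

theorem inner_transCurl_transCurl {L a : ℝ} (hL : 0 < L) (ha : 0 < a) (i j : ModeIndex L a) :
    inner ℂ (transCurl hL i) (transCurl hL j) =
      transEig L a i * inner ℂ (transMode L a i) (transMode L a j) :=
  inner_transCurl hL ha i (transMode_mem_hzcurlGraph hL ha j)

theorem summable_transCurl {L a : ℝ} (hL : 0 < L) (ha : 0 < a) {e : ModeIndex L a → ℂ}
    (he : Summable fun i => transEig L a i * ‖e i‖ ^ 2) :
    Summable fun i => e i • transCurl hL i := by
  refine summable_smul_of_orthogonal (transEig_pos hL ha) (fun i => ?_) (fun i j hij => ?_) he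
  · rw [inner_transCurl_transCurl hL ha, inner_self_eq_norm_sq_to_K,
      (orthonormal_transMode hL ha).1 i]
    simp
  · rw [inner_transCurl_transCurl hL ha, (orthonormal_transMode hL ha).2 hij, mul_zero]

theorem hasSum_transMode {L a : ℝ} (hL : 0 < L) (ha : 0 < a) (E : Hphys L a) :
    HasSum (fun i => (inner ℂ (transBasis hL ha i) E : ℂ) • transMode L a i) (E : L2 L a) := by
  refine (((transBasis hL ha).hasSum_repr E).mapL (Hphys L a).subtypeL).of_forall_eq fun i => ?_
  rw [map_smul, (transBasis hL ha).repr_apply_apply, ← coe_transBasis hL ha]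
  rfl

/-- Finite partial sums lie in the graph, and the graph is closed. -/
theorem mem_hzcurlGraph_of_hasSum {L a : ℝ} (hL : 0 < L) (ha : 0 < a)
    {e : ModeIndex L a → ℂ} {E C : L2 L a} (hE : HasSum (fun i => e i • transMode L a i) E)
    (hC : HasSum (fun i => e i • transCurl hL i) C) : (E, C) ∈ hzcurlGraph L a := by
  refine (isClosed_hzcurlGraph L a).mem_of_tendsto (hE.prodMk hC)
    (Filter.Eventually.of_forall fun s => ?_)
  refine (hzcurlGraph L a).sum_mem fun i _ => ?_
  have h := (hzcurlGraph L a).smul_mem (e i) (transMode_mem_hzcurlGraph hL ha i)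
  rwa [Prod.smul_mk] at h

/-- The expansion of the curl of a field with finite Maxwell energy. -/
theorem exists_hasSum_transCurl {L a : ℝ} (hL : 0 < L) (ha : 0 < a) {E G : Hphys L a}
    (h : ∀ i, inner ℂ (transBasis hL ha i) G =
      transEig L a i * inner ℂ (transBasis hL ha i) E) :
    ∃ C : L2 L a, HasSum (fun i => (inner ℂ (transBasis hL ha i) E : ℂ) • transCurl hL i) C ∧
      ((E : L2 L a), C) ∈ hzcurlGraph L a := by
  have hs : Summable fun i => transEig L a i * ‖inner ℂ (transBasis hL ha i) E‖ ^ 2 :=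
    (transBasis hL ha).summable_mul_norm_sq (fun i => (transEig_pos hL ha i).le) h
  obtain ⟨C, hC⟩ := summable_transCurl hL ha hs
  exact ⟨C, hC, mem_hzcurlGraph_of_hasSum hL ha (hasSum_transMode hL ha E) hC⟩

/-- Forward, test the form against each mode. Backward, the coordinate relation makes the energy of
E finite, so its curl series converges, E enters the form domain, and the form against any F is
summed term by term. -/
theorem mem_maxwellGraph_iff {L a : ℝ} (hL : 0 < L) (ha : 0 < a) (E G : Hphys L a) :
    (E, G) ∈ maxwellGraph L a ↔ ∀ i, inner ℂ (transBasis hL ha i) G =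
      transEig L a i * inner ℂ (transBasis hL ha i) E := by
  constructor
  · rintro ⟨hE, h⟩ i
    have h1 := h ⟨transMode L a i, transMode_mem_Hphys hL ha i⟩ (transMode_mem_VPEC hL ha i)
    rw [qPEC_eq hL ha hE _ (hzcurl_mem hL ha ⟨E, hE.1⟩) (transMode_mem_hzcurlGraph hL ha i),
      inner_transCurl hL ha i (hzcurl_mem hL ha ⟨E, hE.1⟩)] at h1
    rw [inner_transBasis, inner_transBasis, h1]
    rfl
  · intro h
    obtain ⟨C, hC, hEC⟩ := exists_hasSum_transCurl hL ha h
    have hE : (E : L2 L a) ∈ VPEC L a := ⟨mem_hzcurl_domain hEC, Hphys_le_divFree L a E.2⟩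
    refine ⟨hE, fun F hF => ?_⟩
    have hD := hzcurl_mem hL ha ⟨F, hF.1⟩
    rw [qPEC_eq hL ha hE hF hEC hD]
    refine (hC.mapL (innerSL ℂ (hzcurl L a ⟨F, hF.1⟩))).unique ?_
    refine ((transBasis hL ha).hasSum_inner_mul_inner F G).of_forall_eq fun i => ?_
    rw [innerSL_apply_apply, inner_smul_right, ← inner_conj_symm (hzcurl L a ⟨F, hF.1⟩),
      inner_transCurl hL ha i hD, h, map_mul, Complex.conj_ofReal, inner_conj_symm,
      ← inner_conj_symm F, inner_transBasis hL ha i F, inner_conj_symm]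
    ring

theorem isDiagonalPMap_LMx {L a : ℝ} (hL : 0 < L) (ha : 0 < a) :
    IsDiagonalPMap (transBasis hL ha) (transEig L a) (LMx L a) := by
  intro E G
  rw [LMx, Submodule.toLinearPMap_graph_eq, mem_maxwellGraph_iff hL ha]
  rintro ⟨E, G⟩ hp (rfl : E = 0)
  refine (transBasis hL ha).ext_inner fun i => ?_
  rw [(mem_maxwellGraph_iff hL ha _ _).1 hp i]
  simp

end Slab

/-! ### Noise filtered by the functional calculus of a positive diagonal operator -/

theorem Real.exists_rpow_mul_exp_neg_le {s τ : ℝ} (hs : 0 < s) (hτ : 0 < τ) :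
    ∃ K, 0 ≤ K ∧ ∀ x, 0 < x → x ^ s * Real.exp (-τ * x) ≤ K * Real.exp (-(τ / 2) * x) := by
  have hε : 0 < τ / (2 * s) := by positivity
  -- The constant is ε^{-s} with ε = τ/(2s): log(εx) ≤ εx - 1, multiplied by s, bounds s log x by
  -- τx/2 - s log ε.
  refine ⟨Real.exp (-(s * Real.log (τ / (2 * s)))), (Real.exp_pos _).le, fun x hx => ?_⟩
  rw [Real.rpow_def_of_pos hx, ← Real.exp_add, ← Real.exp_add, Real.exp_le_exp]
  have h := Real.log_le_sub_one_of_pos (mul_pos hε hx)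
  rw [Real.log_mul hε.ne' hx.ne'] at h
  have h2 : s * (τ / (2 * s) * x) = τ / 2 * x := by field_simp
  nlinarith

theorem Real.abs_rpow_mul_exp_neg_le {s τ K : ℝ} (hτ : 0 < τ) (hK : 0 ≤ K)
    (h : ∀ x, 0 < x → x ^ s * Real.exp (-τ * x) ≤ K * Real.exp (-(τ / 2) * x)) {x : ℝ}
    (hx : 0 < x) : |x ^ s * Real.exp (-τ * x)| ≤ K := by
  rw [abs_of_nonneg (by positivity)]
  refine (h x hx).trans (mul_le_of_le_one_right hK (Real.exp_le_one_iff.2 ?_))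
  nlinarith

theorem summable_rpow_mul_exp_neg {ι : Type*} {lam : ι → ℝ} (hpos : ∀ i, 0 < lam i)
    (hsum : ∀ t, 0 < t → Summable fun i => Real.exp (-t * lam i)) {s τ : ℝ} (hs : 0 < s)
    (hτ : 0 < τ) : Summable fun i => lam i ^ s * Real.exp (-τ * lam i) := by
  obtain ⟨K, -, h⟩ := Real.exists_rpow_mul_exp_neg_le hs hτ
  exact Summable.of_nonneg_of_le (fun i => by have := hpos i; positivity)
    (fun i => h _ (hpos i)) ((hsum (τ / 2) (by positivity)).mul_left K)

section RealSmul

variable {H : Type} [NormedAddCommGroup H] [InnerProductSpace ℂ H]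

theorem IsDiagonal.real_smul {ι : Type} {u : HilbertBasis ι ℂ H} {m : ι → ℝ} {T : H →L[ℂ] H} (hT : IsDiagonal u m T) (r : ℝ) :
    IsDiagonal u (fun i => r * m i) ((r : ℂ) • T) := by
  intro x i
  rw [smul_apply, inner_smul_right, hT, Complex.ofReal_mul, mul_assoc]

theorem half_mul_inner_real_smul (g : ℝ) (x y : H) :
    (1 / 2 : ℂ) * inner ℂ x ((g : ℂ) • y) = ((g / 2 : ℝ) : ℂ) * inner ℂ x y := by
  rw [inner_smul_right]
  push_cast
  ring

end RealSmul

section PositiveDiagonal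

variable {H : Type} [NormedAddCommGroup H] [InnerProductSpace ℂ H] [CompleteSpace H] {ι : Type}
  {u : HilbertBasis ι ℂ H} {lam : ι → ℝ} {A : H →ₗ.[ℂ] H}

theorem IsDiagonalPMap.functionOf_rpow_mul_exp_neg (hA : IsDiagonalPMap u lam A)
    (hpos : ∀ i, 0 < lam i) {s τ : ℝ} (hs : 0 < s) (hτ : 0 < τ) :
    IsFunctionOf A (fun t => t ^ s * Real.exp (-τ * t))
        (_root_.functionOf A fun t => t ^ s * Real.exp (-τ * t)) ∧
      IsDiagonal u (fun i => lam i ^ s * Real.exp (-τ * lam i))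
        (_root_.functionOf A fun t => t ^ s * Real.exp (-τ * t)) := by
  obtain ⟨K, hK, h⟩ := Real.exists_rpow_mul_exp_neg_le hs hτ
  exact hA.functionOf fun i => Real.abs_rpow_mul_exp_neg_le hτ hK h (hpos i)

theorem IsDiagonalPMap.boundedInverse (hA : IsDiagonalPMap u lam A) {ε : ℝ} (hε : 0 < ε)
    (hlam : ∀ i, ε ≤ lam i) :
    IsBoundedInverse A (_root_.boundedInverse A) ∧
      IsDiagonal u (fun i => (lam i)⁻¹) (_root_.boundedInverse A) := by
  have hpos (i : ι) : 0 < lam i := hε.trans_le (hlam i)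
  obtain ⟨G, hG⟩ := exists_isDiagonal u (fun i => (lam i)⁻¹) (C := ε⁻¹) fun i => by
    rw [abs_of_pos (inv_pos.2 (hpos i))]
    exact inv_anti₀ hε (hlam i)
  have h1 := hA.isBoundedInverse (fun i => (hpos i).ne') hG
  have h2 := isBoundedInverse_boundedInverse h1
  exact ⟨h2, h2.eq h1 ▸ hG⟩

/-- For a positive operator `A` with heat operators of trace class, the energy of the thermally
filtered white noise is the trace of `A^{1/2} e^{-τ A}`. -/
theorem IsDiagonalPMap.integral_energy [Countable ι] (hA : IsDiagonalPMap u lam A) {ε : ℝ}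
    (hε : 0 < ε) (hlam : ∀ i, ε ≤ lam i)
    (hsum : ∀ t, 0 < t → Summable fun i => Real.exp (-t * lam i)) {Ω : Type*} [MeasurableSpace Ω]
    {P : Measure Ω} [IsProbabilityMeasure P] {Ξ : H → Ω → ℂ} (hΞ : IsCylindricalWhiteNoise P Ξ)
    {τ σ : ℝ} (hτ : 0 < τ) (hσ : 0 ≤ σ) :
    IsBoundedInverse A (_root_.boundedInverse A) ∧
    IsFunctionOf A (fun t => t ^ (3 / 4 : ℝ) * Real.exp (-τ * t / 2))
      (_root_.functionOf A fun t => t ^ (3 / 4 : ℝ) * Real.exp (-τ * t / 2)) ∧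
    IsFunctionOf A (fun t => t ^ (1 / 2 : ℝ) * Real.exp (-τ * t))
      (_root_.functionOf A fun t => t ^ (1 / 2 : ℝ) * Real.exp (-τ * t)) ∧
    IsTraceClass (_root_.functionOf A fun t => t ^ (1 / 2 : ℝ) * Real.exp (-τ * t)) ∧
    (∃ S, IsNoiseImage P Ξ (((Real.sqrt σ : ℝ) : ℂ) •
      _root_.functionOf A fun t => t ^ (3 / 4 : ℝ) * Real.exp (-τ * t / 2)) S) ∧
    ∀ S, IsNoiseImage P Ξ (((Real.sqrt σ : ℝ) : ℂ) •
        _root_.functionOf A fun t => t ^ (3 / 4 : ℝ) * Real.exp (-τ * t / 2)) S →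
      Integrable (fun ω => inner ℂ (S ω) (_root_.boundedInverse A (S ω))) P ∧
      ∫ ω, inner ℂ (S ω) (_root_.boundedInverse A (S ω)) ∂P =
        σ * opTrace (_root_.functionOf A fun t => t ^ (1 / 2 : ℝ) * Real.exp (-τ * t)) := by
  have hpos (i : ι) : 0 < lam i := hε.trans_le (hlam i)
  obtain ⟨hinv, hG⟩ := hA.boundedInverse hε hlam
  obtain ⟨hhalf, hheat⟩ := hA.functionOf_rpow_mul_exp_neg hpos (s := 1 / 2) (by norm_num) hτ
  -- Halving τ brings the source filter into the same shape as the heat filter.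
  have hfun : (fun t : ℝ => t ^ (3 / 4 : ℝ) * Real.exp (-τ * t / 2)) =
      fun t => t ^ (3 / 4 : ℝ) * Real.exp (-(τ / 2) * t) := by
    funext t
    ring_nf
  rw [hfun]
  obtain ⟨hsrc, hT⟩ := hA.functionOf_rpow_mul_exp_neg hpos (s := 3 / 4) (by norm_num)
    (half_pos hτ)
  have hnn (i : ι) : 0 ≤ lam i ^ (1 / 2 : ℝ) * Real.exp (-τ * lam i) := by
    have := hpos i
    positivity
  have hs := summable_rpow_mul_exp_neg hpos hsum (s := 1 / 2) (by norm_num) hτ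
  have hsq (i : ι) : (Real.sqrt σ * (lam i ^ (3 / 4 : ℝ) * Real.exp (-(τ / 2) * lam i))) ^ 2 =
      σ * (lam i ^ (3 / 2 : ℝ) * Real.exp (-τ * lam i)) := by
    rw [mul_pow, mul_pow, Real.sq_sqrt hσ, ← Real.rpow_natCast (lam i ^ (3 / 4 : ℝ)),
      ← Real.rpow_mul (hpos i).le, ← Real.exp_nat_mul]
    norm_num
    ring_nf
    simp
  -- The exponents combine as -1 + 2 · 3/4 = 1/2, and squaring restores the full heat time τ.
  have hκ (i : ι) : (lam i)⁻¹ *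
      (Real.sqrt σ * (lam i ^ (3 / 4 : ℝ) * Real.exp (-(τ / 2) * lam i))) ^ 2 =
      σ * (lam i ^ (1 / 2 : ℝ) * Real.exp (-τ * lam i)) := by
    rw [hsq, ← Real.rpow_neg_one, mul_left_comm, ← mul_assoc _ (lam i ^ (3 / 2 : ℝ)),
      ← Real.rpow_add (hpos i)]
    norm_num
  refine ⟨hinv, hsrc, hhalf, hheat.isTraceClass hnn hs, ?_, fun S hS => ?_⟩
  · refine hΞ.exists_isNoiseImage (hT.real_smul _) ?_
    simp only [hsq]
    exact (summable_rpow_mul_exp_neg hpos hsum (by norm_num) hτ).mul_left σ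
  · have h := hS.integral_inner hΞ (hT.real_smul _) hG (fun i => (inv_pos.2 (hpos i)).le) (by
      simp only [hκ]
      exact hs.mul_left σ)
    refine ⟨h.1, h.2.trans ?_⟩
    simp only [hκ]
    rw [tsum_mul_left, Complex.ofReal_mul, hheat.opTrace_eq hnn hs]

end PositiveDiagonal

namespace Slab

/-! ### The heat trace of the slab -/

theorem summable_exp_neg_sq_nat {c : ℝ} (hc : 0 < c) :
    Summable fun n : ℕ => Real.exp (-(c * (n : ℝ) ^ 2)) := by
  refine (Real.summable_exp_nat_mul_of_ge (neg_lt_zero.2 hc) (f := fun n => (n : ℝ) ^ 2)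
    fun n => ?_).congr fun n => by rw [neg_mul]
  exact_mod_cast Nat.le_self_pow two_ne_zero n

theorem summable_exp_neg_sq_int {c : ℝ} (hc : 0 < c) :
    Summable fun p : ℤ => Real.exp (-(c * (p : ℝ) ^ 2)) := by
  rw [summable_int_iff_summable_nat_and_neg]
  simpa using summable_exp_neg_sq_nat hc

/-- The crude bound by the dimension of ℂ³ is enough for summability. -/
theorem finrank_polSpace_le (L a : ℝ) (k : ℤ × ℤ × ℕ) :
    Module.finrank ℂ (polSpace L a k) ≤ 3 :=
  (Submodule.finrank_le _).trans (by simp)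

theorem summable_exp_neg_transEig {L a : ℝ} (hL : 0 < L) (ha : 0 < a) {t : ℝ} (ht : 0 < t) :
    Summable fun i => Real.exp (-t * transEig L a i) := by
  have hπ := Real.pi_pos
  have hlat : 0 < t * (2 * Real.pi / L) ^ 2 := by positivity
  have hplate : 0 < t * (Real.pi / a) ^ 2 := by positivity
  -- The squared wave number is a sum over directions, so the heat trace is dominated by a product
  -- of three Gaussian sums times the polarization bound.
  have h3 := (summable_exp_neg_sq_int hlat).mul_of_nonneg
    ((summable_exp_neg_sq_int hlat).mul_of_nonneg (summable_exp_neg_sq_nat hplate)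
      (fun _ => (Real.exp_pos _).le) (fun _ => (Real.exp_pos _).le))
    (fun _ => (Real.exp_pos _).le) (fun _ => by positivity)
  rw [summable_sigma_of_nonneg fun _ => (Real.exp_pos _).le]
  refine ⟨fun k => Summable.of_finite, ?_⟩
  refine Summable.of_nonneg_of_le (fun k => tsum_nonneg fun _ => (Real.exp_pos _).le)
    (fun k => ?_) (h3.mul_left 3)
  obtain ⟨p, q, n⟩ := k
  have he : -t * eigVal L a p q n = -(t * (2 * Real.pi / L) ^ 2 * (p : ℝ) ^ 2) +
      (-(t * (2 * Real.pi / L) ^ 2 * (q : ℝ) ^ 2) +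
        -(t * (Real.pi / a) ^ 2 * (n : ℝ) ^ 2)) := by
    simp only [eigVal, latNum, plateNum, Int.cast_natCast]
    ring
  rw [← Real.exp_add, ← Real.exp_add, ← he]
  simp only [transEig, tsum_fintype, Finset.sum_const, Finset.card_univ, Fintype.card_fin,
    nsmul_eq_mul]
  gcongr
  exact_mod_cast finrank_polSpace_le L a (p, q, n)

end Slab

/-! ### The energy identity for the slab. -/

theorem theorem4p1 (L a hbar c g : ℝ) (hL : 0 < L) (ha : 0 < a) (hhbar : 0 < hbar) (hc : 0 < c)
    (hg : 0 < g) {Ω : Type*} [MeasurableSpace Ω] (P : Measure Ω) [IsProbabilityMeasure P]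
    (Ξ : Slab.Hphys L a → Ω → ℂ) (hΞ : IsCylindricalWhiteNoise P Ξ) (τ : ℝ) (hτ : 0 < τ) :
    -- the operators that enter are well defined
    IsBoundedInverse (Slab.LMx L a) (boundedInverse (Slab.LMx L a)) ∧
    IsFunctionOf (Slab.LMx L a) (fun t => t ^ (3 / 4 : ℝ) * Real.exp (-τ * t / 2))
      (functionOf (Slab.LMx L a) fun t => t ^ (3 / 4 : ℝ) * Real.exp (-τ * t / 2)) ∧
    IsFunctionOf (Slab.LMx L a) (fun t => t ^ (1 / 2 : ℝ) * Real.exp (-τ * t))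
      (Slab.heatOp L a τ) ∧
    -- the trace is finite
    IsTraceClass (Slab.heatOp L a τ) ∧
    -- the source exists, and its energy has the stated expectation
    (∃ S, IsNoiseImage P Ξ (Slab.sourceOp L a hbar c g τ) S) ∧
    ∀ S, IsNoiseImage P Ξ (Slab.sourceOp L a hbar c g τ) S →
      Integrable (fun ω => Slab.energy L a g (S ω)) P ∧
      ∫ ω, Slab.energy L a g (S ω) ∂P =
        ((hbar * c / 2 : ℝ) : ℂ) * opTrace (Slab.heatOp L a τ) := by
  obtain ⟨h1, h2, h3, h4, h5, h6⟩ := (Slab.isDiagonalPMap_LMx hL ha).integral_energy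
    (Slab.transEig_lower_pos hL ha) Slab.le_transEig
    (fun t ht => Slab.summable_exp_neg_transEig hL ha ht) hΞ hτ
    (σ := hbar * c / g) (by positivity)
  refine ⟨h1, h2, h3, h4, h5, fun S hS => ?_⟩
  obtain ⟨hint, hE⟩ := h6 S hS
  have he (ω : Ω) : Slab.energy L a g (S ω) =
      ((g / 2 : ℝ) : ℂ) * inner ℂ (S ω) (boundedInverse (Slab.LMx L a) (S ω)) :=
    half_mul_inner_real_smul g (S ω) _
  simp only [he]
  refine ⟨hint.const_mul _, ?_⟩
  rw [integral_const_mul]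
  refine (congrArg _ hE).trans ?_
  rw [← mul_assoc, ← Complex.ofReal_mul, show g / 2 * (hbar * c / g) = hbar * c / 2 by field_simp]
  rfl

end
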